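/- Let $M=2m+1$ ($m\ge 0$) be odd and write $W=(W_e,W_o)$ with $W_e=(w_0,w_2,\dots,w_{M-1})^T$, $W_o=(w_1,w_3,\dots,w_M)^T$. Put $$A_c=\begin{pmatrix}0&M_c\\ M_c^T&0\end{pmatrix},\qquad Q_c=\mathrm{diag}(0,1,\dots,1),$$ where $M_c$ is the $(m+1)\times(m+1)$ lower bidiagonal matrix with diagonal entries $1,\sqrt3,\sqrt5,\dots,\sqrt M$ and subdiagonal entries $\sqrt2,\sqrt4,\dots,\sqrt{M-1}$. Let $0<\chi\le 1$, $\hat\chi=\frac{2\chi}{(2-\chi)\sqrt{2\pi}}$, let $S_c$ be a symmetric positive definite $(m+1)\times(m+1)$ matrix, and put $$B_c=(\hat\chi S_c,\,M_c),\qquad b_c(t)=\hat\chi S_c\,(u^w(t),0,\dots,0)^T,$$ where $u^w\in C^3([0,\infty))$ satisfies $u^w(0)=0$ and $(u^w)'(0)=0$. For $\varepsilon>0$ and $T>0$, an exact solution on $[0,T]$ is a function $W_c$, continuous on $[0,T]\times[0,\infty)$ and $C^1$ in the interior, with $$\partial_tW_c+A_c\partial_xW_c=-\tfrac1\varepsilon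 Q_cW_c,\qquad B_cW_c(t,0)=b_c(t),\qquad W_c(0,x)=0 .$$ Boundary-layer coefficients are functions $V_0,\dots,V_3$ of $(t,y)$ (viscous layer) and $K_0,\dots,K_3$ of $(t,z)$ (Knudsen layer) with values in $\mathbb R^{M+1}$, each continuous on $[0,\infty)^2$, $C^1$ in the interior, zero at $t=0$ and tending to $0$ as $y\to\infty$, resp. $z\to\infty$, for each $t$; for every $T>0$, $\partial_tV_j,\partial_yV_j\in L^2((0,T)\times\mathbb R^+)$ and $\partial_tK_j\in L^1(0,T;L^2(\mathbb R^+))$; and for $t>0$ the following hold. * Viscous layer ($y>0$): $$Q_cV_0=0,\quad A_c\partial_yV_0+Q_cV_1=0,\quad \partial_tV_0+A_c\partial_yV_1+Q_cV_2=0,\quad \partial_tV_1+A_c\partial_yV_2+Q_cV_3=0,$$ the first component of $\partial_tV_2+A_c\partial_yV_3$ vanishes, and the first component of $V_3$ is set to $0$. * Knudsen layer ($z>0$): $$A_c\partial_zK_j+Q_cK_j=0\ (j=0,1),\qquad \partial_tK_{j-2}+A_c\partial_zK_j+Q_cK_j=0\ (j=2,3).$$ * Boundary conditions ($t\ge 0$):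 $$B_c[V_0(t,0)+K_0(t,0)]=b_c(t),\qquad B_c[V_j(t,0)+K_j(t,0)]=0\ (j=1,2).$$ Given such coefficients, the three-scale truncated approximation, whose outer part is $0$, is $$W_c^{app}(t,x)=\sum_{j=0}^{3}\varepsilon^{j/2}\Big[V_j\big(t,\tfrac{x}{\sqrt\varepsilon}\big)+K_j\big(t,\tfrac{x}{\varepsilon}\big)\Big].$$ **Theorem.** Such boundary-layer coefficients exist. Moreover, for any such coefficients and any $T>0$ there is a constant $C(T)$, independent of $\varepsilon$, such that for all $\varepsilon\in(0,1]$, every exact solution $W_c$ on $[0,T]$ and all $t\in[0,T]$, $$\|(W_c^{app}-W_c)(t,\cdot)\|_{L^2(\mathbb R^+)}+\Big(\int_0^T|W_c^{app}(s,0)-W_c(s,0)|^2\,ds\Big)^{1/2}\le C(T)\,\varepsilon^{3/2}.$$ -/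

import Mathlib

open MeasureTheory Set Filter Topology
open scoped Matrix ENNReal

noncomputable section

namespace CouetteMoment

/-- Values of the moment vector `W_c = (W_e, W_o)` for the odd moment order `M = 2 m + 1`, with the
Euclidean norm. `Sum.inl i` is the even moment `w_{2i}` and `Sum.inr i` the odd moment
`w_{2i+1}`, for `i = 0, …, m`. In particular `Sum.inl 0` is the velocity `u = w_0` and
`Sum.inr 0` is the stress `σ = w_1`. -/
abbrev State (m : ℕ) : Type := EuclideanSpace ℝ (Fin (m + 1) ⊕ Fin (m + 1))

/-- The lower bidiagonal matrix `M_c`, with rows `(1)`, `(√2, √3)`, `(√4, √5)`, …,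
`(√(M-1), √M)`. -/
def Mc (m : ℕ) : Matrix (Fin (m + 1)) (Fin (m + 1)) ℝ :=
  Matrix.of fun i j =>
    if j = i then Real.sqrt (2 * (i : ℕ) + 1)
    else if (j : ℕ) + 1 = (i : ℕ) then Real.sqrt (2 * (i : ℕ))
    else 0

/-- The coefficient matrix `A_c`. -/
def Ac (m : ℕ) : Matrix (Fin (m + 1) ⊕ Fin (m + 1)) (Fin (m + 1) ⊕ Fin (m + 1)) ℝ :=
  Matrix.fromBlocks 0 (Mc m) (Mc m)ᵀ 0

/-- The collision matrix `Q_c = diag(0, 1, …, 1)`. -/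
def Qc (m : ℕ) : Matrix (Fin (m + 1) ⊕ Fin (m + 1)) (Fin (m + 1) ⊕ Fin (m + 1)) ℝ :=
  Matrix.diagonal fun i => if i = Sum.inl 0 then 0 else 1

/-- `χ̂ = 2 χ / ((2 - χ) √(2π))`, where `χ` is the accommodation coefficient. -/
def chiHat (χ : ℝ) : ℝ := 2 * χ / ((2 - χ) * Real.sqrt (2 * Real.pi))

/-- The boundary matrix `B_c = (χ̂ S_c, M_c)`. -/
def Bc {m : ℕ} (χ : ℝ) (S : Matrix (Fin (m + 1)) (Fin (m + 1)) ℝ) :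
    Matrix (Fin (m + 1)) (Fin (m + 1) ⊕ Fin (m + 1)) ℝ :=
  Matrix.fromCols (chiHat χ • S) (Mc m)

/-- The boundary data `b_c(t) = χ̂ S_c (u^w(t), 0, …, 0)ᵀ`. -/
def bc {m : ℕ} (χ : ℝ) (S : Matrix (Fin (m + 1)) (Fin (m + 1)) ℝ) (uw : ℝ → ℝ) (t : ℝ) :
    Fin (m + 1) → ℝ :=
  chiHat χ • (S *ᵥ Pi.single 0 (uw t))

/-- The partial derivative in the first (time) variable. -/
def dTime {m : ℕ} (W : ℝ → ℝ → State m) (t x : ℝ) : State m := deriv (fun s => W s x) t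

/-- The partial derivative in the second (space) variable. -/
def dSpace {m : ℕ} (W : ℝ → ℝ → State m) (t x : ℝ) : State m := deriv (fun y => W t y) x

/-- `W` is a classical solution on `[0, T] × [0, ∞)` of the initial-boundary value problem
`∂ₜ W + A_c ∂ₓ W = -ε⁻¹ Q_c W`, `B_c W(t, 0) = b_c(t)`, `W(0, x) = 0`: it is of class `C¹` in the
interior, and continuous up to the boundary. -/
structure IsExactSolution {m : ℕ} (χ : ℝ) (S : Matrix (Fin (m + 1)) (Fin (m + 1)) ℝ)
    (uw : ℝ → ℝ) (T ε : ℝ) (W : ℝ → ℝ → State m) : Prop where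
  continuousOn : ContinuousOn (fun p : ℝ × ℝ => W p.1 p.2) (Icc 0 T ×ˢ Ici 0)
  contDiffOn : ContDiffOn ℝ 1 (fun p : ℝ × ℝ => W p.1 p.2) (Ioo 0 T ×ˢ Ioi 0)
  equation : ∀ t ∈ Ioo 0 T, ∀ x ∈ Ioi (0 : ℝ),
    (dTime W t x).ofLp + Ac m *ᵥ (dSpace W t x).ofLp = -(1 / ε) • (Qc m *ᵥ (W t x).ofLp)
  boundary : ∀ t ∈ Icc 0 T, Bc χ S *ᵥ (W t 0).ofLp = bc χ S uw t
  initial : ∀ x ∈ Ici (0 : ℝ), W 0 x = 0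

/-- Regularity, initial value and behaviour at infinity required of every coefficient of either
boundary layer: continuous on `[0, ∞) × [0, ∞)`, of class `C¹` in the interior, zero at the
initial time, and tending to zero away from the boundary. -/
structure IsLayerFunction {m : ℕ} (U : ℝ → ℝ → State m) : Prop where
  continuousOn : ContinuousOn (fun p : ℝ × ℝ => U p.1 p.2) (Ici 0 ×ˢ Ici 0)
  contDiffOn : ContDiffOn ℝ 1 (fun p : ℝ × ℝ => U p.1 p.2) (Ioi 0 ×ˢ Ioi 0)
  initial : ∀ y ∈ Ici (0 : ℝ), U 0 y = 0
  decay : ∀ t ∈ Ici (0 : ℝ), Tendsto (U t) atTop (𝓝 0)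

/-- The coefficients `V 0, …, V 3` of the viscous layer, functions of `(t, y)`, `y = x / √ε`.
The equations are the coefficients of `ε^{-1}, ε^{-1/2}, ε^0, ε^{1/2}` in the system, together with
the coefficient of `ε` in the first equation of the system, when `∑ⱼ (√ε)ʲ V j (t, x / √ε)` is
substituted. The velocity component of `V 3` is not used in the expansion and is set to zero. -/
structure IsViscousLayer {m : ℕ} (V : Fin 4 → ℝ → ℝ → State m) : Prop where
  layer : ∀ j, IsLayerFunction (V j)
  memLp_dTime : ∀ j, ∀ T > 0, MemLp (fun p : ℝ × ℝ => dTime (V j) p.1 p.2) 2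
    (volume.restrict (Ioo 0 T ×ˢ Ioi 0))
  memLp_dSpace : ∀ j, ∀ T > 0, MemLp (fun p : ℝ × ℝ => dSpace (V j) p.1 p.2) 2
    (volume.restrict (Ioo 0 T ×ˢ Ioi 0))
  order_neg_one : ∀ t > 0, ∀ y > 0, Qc m *ᵥ (V 0 t y).ofLp = 0
  order_neg_half : ∀ t > 0, ∀ y > 0,
    Ac m *ᵥ (dSpace (V 0) t y).ofLp + Qc m *ᵥ (V 1 t y).ofLp = 0
  order_zero : ∀ t > 0, ∀ y > 0,
    (dTime (V 0) t y).ofLp + Ac m *ᵥ (dSpace (V 1) t y).ofLp + Qc m *ᵥ (V 2 t y).ofLp = 0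
  order_half : ∀ t > 0, ∀ y > 0,
    (dTime (V 1) t y).ofLp + Ac m *ᵥ (dSpace (V 2) t y).ofLp + Qc m *ᵥ (V 3 t y).ofLp = 0
  order_one_first : ∀ t > 0, ∀ y > 0,
    ((dTime (V 2) t y).ofLp + Ac m *ᵥ (dSpace (V 3) t y).ofLp) (Sum.inl 0) = 0
  velocity_three : ∀ t ≥ 0, ∀ y ≥ 0, V 3 t y (Sum.inl 0) = 0

/-- The coefficients `K 0, …, K 3` of the Knudsen layer, functions of `(t, z)`, `z = x / ε`.
The equations are the coefficients of `ε^{-1}, ε^{-1/2}, ε^0, ε^{1/2}` in the system when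
`∑ⱼ (√ε)ʲ K j (t, x / ε)` is substituted. -/
structure IsKnudsenLayer {m : ℕ} (K : Fin 4 → ℝ → ℝ → State m) : Prop where
  layer : ∀ j, IsLayerFunction (K j)
  integrable_dTime : ∀ j, ∀ T > 0,
    ∫⁻ t in Ioo 0 T, eLpNorm (fun z => dTime (K j) t z) 2 (volume.restrict (Ioi 0)) < ⊤
  order_neg_one : ∀ t > 0, ∀ z > 0,
    Ac m *ᵥ (dSpace (K 0) t z).ofLp + Qc m *ᵥ (K 0 t z).ofLp = 0
  order_neg_half : ∀ t > 0, ∀ z > 0,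
    Ac m *ᵥ (dSpace (K 1) t z).ofLp + Qc m *ᵥ (K 1 t z).ofLp = 0
  order_zero : ∀ t > 0, ∀ z > 0,
    (dTime (K 0) t z).ofLp + Ac m *ᵥ (dSpace (K 2) t z).ofLp + Qc m *ᵥ (K 2 t z).ofLp = 0
  order_half : ∀ t > 0, ∀ z > 0,
    (dTime (K 1) t z).ofLp + Ac m *ᵥ (dSpace (K 3) t z).ofLp + Qc m *ᵥ (K 3 t z).ofLp = 0

/-- `V` and `K` are coefficients of the two boundary layers, matched in the boundary condition
at the orders `ε^0`, `ε^{1/2}` and `ε^1`. -/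
structure IsLayerExpansion {m : ℕ} (χ : ℝ) (S : Matrix (Fin (m + 1)) (Fin (m + 1)) ℝ)
    (uw : ℝ → ℝ) (V K : Fin 4 → ℝ → ℝ → State m) : Prop where
  viscous : IsViscousLayer V
  knudsen : IsKnudsenLayer K
  boundary_zero : ∀ t ≥ 0, Bc χ S *ᵥ (V 0 t 0 + K 0 t 0).ofLp = bc χ S uw t
  boundary_half : ∀ t ≥ 0, Bc χ S *ᵥ (V 1 t 0 + K 1 t 0).ofLp = 0
  boundary_one : ∀ t ≥ 0, Bc χ S *ᵥ (V 2 t 0 + K 2 t 0).ofLp = 0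

/-- The outer part of the approximate solution; it vanishes because the initial data are zero. -/
def outerApp (m : ℕ) : ℝ → ℝ → State m := fun _ _ => 0

/-- The viscous part of the approximate solution. -/
def viscousApp {m : ℕ} (V : Fin 4 → ℝ → ℝ → State m) (ε t x : ℝ) : State m :=
  ∑ j : Fin 4, Real.sqrt ε ^ (j : ℕ) • V j t (x / Real.sqrt ε)

/-- The Knudsen part of the approximate solution. -/
def knudsenApp {m : ℕ} (K : Fin 4 → ℝ → ℝ → State m) (ε t x : ℝ) : State m :=
  ∑ j : Fin 4, Real.sqrt ε ^ (j : ℕ) • K j t (x / ε)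

/-- The truncated three-scale approximation `W_c^{app}`. -/
def Wapp {m : ℕ} (V K : Fin 4 → ℝ → ℝ → State m) (ε t x : ℝ) : State m :=
  outerApp m t x + viscousApp V ε t x + knudsenApp K ε t x

end CouetteMoment

end

namespace CouetteMoment

/-! Write `ε = η²`. The theorem combines an explicit construction of the layers with an energy
estimate that uses only the properties listed in `IsLayerExpansion`, and so applies to arbitrary
coefficients.

Construction. All coefficients have separated form. Let `D₀` solve the heat equation on the half
line with boundary value `u^w`, and let `Dⱼ` be its space derivatives, so that `∂ₜ Dⱼ = Dⱼ₊₂`. With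
`e` the velocity vector and `f = A e`, take `V₀ = D₀ e`. The order `ε^{-1/2}` equation forces the
stress `-D₁` in `V₁`, and since the stress alone drives the velocity, the velocity equation at order
zero is exactly the heat equation. The velocity of `V₂` obeys a heat equation with a source
proportional to `D₄`; a multiple of `y D₃` solves it and vanishes at `y = 0`. These functions are
time convolutions with `erfc (y / 2√τ)`, the heat kernel and their multiples by `y`
(`exists_heat_hierarchy`). The regularity of `u^w` is just enough: `D₅` contains `u''(0)` times the
heat kernel, which is locally square integrable in `(t, y)`, and at `y = 0` behaves like `t^{-1/2}`,
integrable in time.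

Knudsen layers are combinations of modes `exp (-γ z) k` with `γ A k = Q k`. Diagonalizing a positive
semidefinite matrix produces them, and positivity of `S` shows that together with the velocity they
attain every boundary value (`exists_modes`). `V₀` meets the boundary data alone, so `K₀ = 0`; `K₁`
and `K₂` correct the boundary values of `V₁` and `V₂`. `K₃` is driven by `∂ₜ K₁`, hence resonantly,
and needs terms `z exp (-γ z)` (`exists_resonant_solution`).

Error. The difference `E = W_app - W` starts from zero, its boundary value under `B` is of order
`η³` (`boundaryOp_error`), and it solves the system with a source in two parts (`Wapp_residual`).
The part `η² R(t, x / η)` would by size alone give less than `η³`; but its first component vanishes,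
so it pairs only with `Q E`, and the dissipation `|Q E|² / η²` absorbs it at the cost of `η⁶ |R|² /
4` (`inner_residual_le`). The other part consists of time derivatives; the one carrying only `η²`
lives on the scale `x / η²`, whose `L²` rescaling supplies another `η`. The form `A E · E` at the
wall is strictly negative up to `|B E|²` (`exists_boundary_dissipation`). No decay of `W` in `x` is
assumed, so the energy identity carries a cutoff moving with a speed that bounds propagation
(`weighted_energy_le`), which is then sent to infinity (`energy_estimate`). -/

/-- A function of two real variables with continuous partial derivatives is of class `C¹`. -/
theorem contDiffOn_one_of_hasDerivAt {F : Type*} [NormedAddCommGroup F] [NormedSpace ℝ F]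
    {s : Set (ℝ × ℝ)} (hs : IsOpen s) {f f₁ f₂ : ℝ → ℝ → F}
    (h₁ : ∀ p ∈ s, HasDerivAt (fun t => f t p.2) (f₁ p.1 p.2) p.1)
    (h₂ : ∀ p ∈ s, HasDerivAt (fun x => f p.1 x) (f₂ p.1 p.2) p.2)
    (c₁ : ContinuousOn (fun p : ℝ × ℝ => f₁ p.1 p.2) s)
    (c₂ : ContinuousOn (fun p : ℝ × ℝ => f₂ p.1 p.2) s) :
    ContDiffOn ℝ 1 (fun p : ℝ × ℝ => f p.1 p.2) s := by
  set D : ℝ × ℝ → (ℝ × ℝ →L[ℝ] F) := fun p =>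
    (ContinuousLinearMap.toSpanSingleton ℝ (f₁ p.1 p.2)).coprod
      (ContinuousLinearMap.toSpanSingleton ℝ (f₂ p.1 p.2)) with hD
  have hts : ∀ {g : ℝ × ℝ → F}, ContinuousOn g s →
      ContinuousOn (fun p => ContinuousLinearMap.toSpanSingleton ℝ (g p)) s := fun hg =>
    (ContinuousLinearMap.toSpanSingletonCLE (𝕜 := ℝ) (E := F)).continuous.comp_continuousOn hg
  have key : ∀ p ∈ s, HasFDerivAt (fun p : ℝ × ℝ => f p.1 p.2) (D p) p := by
    intro p hp
    have hn := hs.mem_nhds hp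
    exact (hasStrictFDerivAt_uncurry_coprod (𝕜 := ℝ) (u := p) (f := f)
      (f₁ := fun a b => ContinuousLinearMap.toSpanSingleton ℝ (f₁ a b))
      (f₂ := fun a b => ContinuousLinearMap.toSpanSingleton ℝ (f₂ a b))
      (eventually_of_mem hn fun q hq => (h₁ q hq).hasFDerivAt)
      (eventually_of_mem hn fun q hq => (h₂ q hq).hasFDerivAt)
      ((hts c₁).continuousAt hn) ((hts c₂).continuousAt hn)).hasFDerivAt
  rw [← zero_add (1 : WithTop ℕ∞), contDiffOn_succ_iff_fderiv_of_isOpen hs]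
  refine ⟨fun p hp => (key p hp).differentiableAt.differentiableWithinAt, by simp, ?_⟩
  rw [contDiffOn_zero]
  refine ContinuousOn.congr ?_ fun p hp => (key p hp).fderiv
  have := (ContinuousLinearMap.coprodEquivL (𝕜 := ℝ) (E := ℝ) (F := ℝ) (G := F) ℝ).continuous.comp_continuousOn ((hts c₁).prodMk (hts c₂))
  exact this

/-! ### Kernels of parabolic layer potentials on the half line -/

/-- The weight `1 + τ^{-1/2}`. -/
noncomputable def kernelWeight (τ : ℝ) : ℝ := 1 + (√τ)⁻¹

theorem kernelWeight_nonneg (τ : ℝ) : 0 ≤ kernelWeight τ := by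
  unfold kernelWeight; positivity

theorem inv_sqrt_le_kernelWeight (τ : ℝ) : (√τ)⁻¹ ≤ kernelWeight τ := by
  unfold kernelWeight; linarith

theorem one_le_kernelWeight (τ : ℝ) : 1 ≤ kernelWeight τ := by
  unfold kernelWeight; have : 0 ≤ (√τ)⁻¹ := by positivity
  linarith

theorem intervalIntegrable_kernelWeight (a b : ℝ) :
    IntervalIntegrable kernelWeight volume a b := by
  have key : ∀ c : ℝ, IntervalIntegrable (fun τ : ℝ => (√τ)⁻¹) volume 0 c := by
    intro c
    rcases le_total 0 c with hc | hc
    · have h := intervalIntegral.intervalIntegrable_rpow' (a := 0) (b := c) (r := -(1 / 2))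
        (by norm_num)
      refine h.congr fun τ hτ => ?_
      rw [uIoc_of_le hc] at hτ
      rw [Real.rpow_neg hτ.1.le, Real.sqrt_eq_rpow]
    -- At nonpositive arguments `√τ` and its inverse are both zero by convention.
    · refine (intervalIntegrable_const (c := (0 : ℝ))).congr fun τ hτ => ?_
      rw [uIoc_of_ge hc] at hτ
      simp [Real.sqrt_eq_zero_of_nonpos hτ.2]
  exact intervalIntegrable_const.add ((key a).symm.trans (key b))

/-- Kernels on `(0, ∞) × [0, ∞)` that are continuous and bounded by
`(1 + τ^{-1/2}) exp (-y² / 8τ)`. -/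
structure GoodKernel (k : ℝ → ℝ → ℝ) : Prop where
  cont : ContinuousOn (fun p : ℝ × ℝ => k p.1 p.2) (Ioi 0 ×ˢ Ici 0)
  bound : ∃ C, 0 ≤ C ∧ ∀ τ > 0, ∀ y ≥ 0, |k τ y| ≤ C * kernelWeight τ * Real.exp (-(y ^ 2 / (8 * τ)))

/-- The time convolution of a kernel with a density. -/
noncomputable def layerPotential (k : ℝ → ℝ → ℝ) (f : ℝ → ℝ) (t y : ℝ) : ℝ :=
  ∫ τ in (0 : ℝ)..t, k τ y * f (t - τ)

theorem layerPotential_zero (k : ℝ → ℝ → ℝ) (f : ℝ → ℝ) (y : ℝ) : layerPotential k f 0 y = 0 := by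
  simp [layerPotential]

theorem exp_div_le {y τ T : ℝ} (hτ : 0 < τ) (hT : τ ≤ T) :
    Real.exp (-(y ^ 2 / (8 * τ))) ≤ Real.exp (-(y ^ 2 / (8 * T))) := by
  apply Real.exp_le_exp.2
  apply neg_le_neg
  gcongr

namespace GoodKernel

variable {k : ℝ → ℝ → ℝ}

theorem exists_bound (hk : GoodKernel k) :
    ∃ C, 0 ≤ C ∧ ∀ τ > 0, ∀ y ≥ 0, |k τ y| ≤ C * kernelWeight τ := by
  obtain ⟨C, hC, h⟩ := hk.bound
  refine ⟨C, hC, fun τ hτ y hy => (h τ hτ y hy).trans ?_⟩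
  apply mul_le_of_le_one_right (mul_nonneg hC (kernelWeight_nonneg _))
  rw [Real.exp_le_one_iff]
  have : 0 ≤ y ^ 2 / (8 * τ) := by positivity
  linarith

theorem continuousOn_left (hk : GoodKernel k) {y : ℝ} (hy : 0 ≤ y) :
    ContinuousOn (fun τ => k τ y) (Ioi 0) :=
  hk.cont.comp (f := fun τ => (τ, y)) (by fun_prop) fun _ hτ => ⟨hτ, hy⟩

theorem intervalIntegrable (hk : GoodKernel k) {y t : ℝ} (hy : 0 ≤ y) (ht : 0 ≤ t) :
    IntervalIntegrable (fun τ => k τ y) volume 0 t := by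
  obtain ⟨C, hC, h⟩ := hk.exists_bound
  refine ((intervalIntegrable_kernelWeight 0 t).const_mul C).mono_fun ?_ ?_
  · rw [uIoc_of_le ht]
    exact ((hk.continuousOn_left hy).mono Ioc_subset_Ioi_self).aestronglyMeasurable
      measurableSet_Ioc
  · rw [uIoc_of_le ht]
    filter_upwards [ae_restrict_mem measurableSet_Ioc] with τ hτ
    rw [Real.norm_eq_abs, Real.norm_eq_abs]
    exact (h τ hτ.1 y hy).trans (le_abs_self _)

theorem intervalIntegrable_mul (hk : GoodKernel k) {y t : ℝ} (hy : 0 ≤ y) (ht : 0 ≤ t) {f : ℝ → ℝ}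
    (hf : Continuous f) (s : ℝ) :
    IntervalIntegrable (fun τ => k τ y * f (s - τ)) volume 0 t :=
  (hk.intervalIntegrable hy ht).mul_continuousOn (by fun_prop)

/-- For `τ ≤ T` the Gaussian factor is at most its value at `τ = T` and leaves the integral; the
weight that remains is integrable. The surviving decay in `y` yields both the limit at infinity and
the `L²` bounds. -/
theorem exists_layerPotential_bound (hk : GoodKernel k) {f : ℝ → ℝ} (hf : Continuous f) (T : ℝ) :
    ∃ C, 0 ≤ C ∧ ∀ t ∈ Icc 0 T, ∀ y ≥ 0,
      |layerPotential k f t y| ≤ C * Real.exp (-(y ^ 2 / (8 * T))) := by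
  obtain ⟨C, hC, h⟩ := hk.bound
  obtain ⟨M, hM⟩ := (isCompact_Icc (a := (0 : ℝ)) (b := T)).exists_bound_of_continuousOn
    hf.continuousOn
  rcases lt_or_ge T 0 with hT | hT
  · exact ⟨0, le_rfl, fun t ht => absurd (ht.1.trans ht.2) (not_le.2 hT)⟩
  have hM0 : 0 ≤ M := (norm_nonneg _).trans (hM 0 ⟨le_rfl, hT⟩)
  have hI : 0 ≤ ∫ τ in (0 : ℝ)..T, kernelWeight τ :=
    intervalIntegral.integral_nonneg hT fun τ _ => kernelWeight_nonneg τ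
  refine ⟨C * M * ∫ τ in (0 : ℝ)..T, kernelWeight τ, by positivity, fun t ht y hy => ?_⟩
  set e := Real.exp (-(y ^ 2 / (8 * T)))
  have h1 : |layerPotential k f t y| ≤ ∫ τ in (0 : ℝ)..t, C * M * e * kernelWeight τ := by
    rw [← Real.norm_eq_abs]
    refine intervalIntegral.norm_integral_le_of_norm_le ht.1 ?_
      ((intervalIntegrable_kernelWeight 0 t).const_mul _)
    refine Eventually.of_forall fun τ hτ => ?_
    rw [norm_mul, Real.norm_eq_abs]
    have h2 := h τ hτ.1 y hy
    have h3 := hM (t - τ) ⟨by linarith [hτ.2], by linarith [hτ.1, ht.2]⟩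
    have h4 := exp_div_le (y := y) hτ.1 (hτ.2.trans ht.2)
    calc |k τ y| * ‖f (t - τ)‖ ≤ (C * kernelWeight τ * e) * M := by
          have := kernelWeight_nonneg τ
          gcongr
          exact h2.trans (by gcongr)
      _ = _ := by ring
  refine h1.trans ?_
  rw [intervalIntegral.integral_const_mul]
  have h5 : ∫ τ in (0 : ℝ)..t, kernelWeight τ ≤ ∫ τ in (0 : ℝ)..T, kernelWeight τ :=
    intervalIntegral.integral_mono_interval le_rfl ht.1 ht.2
      (Eventually.of_forall fun τ => kernelWeight_nonneg τ) (intervalIntegrable_kernelWeight 0 T)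
  calc C * M * e * ∫ τ in (0 : ℝ)..t, kernelWeight τ
      ≤ C * M * e * ∫ τ in (0 : ℝ)..T, kernelWeight τ := by gcongr
    _ = _ := by ring

/-- Dominated convergence, with the moving upper limit `t` turned into an indicator. The integrand
is then continuous at `(t₀, y₀)` for every `τ` except `τ = t₀`. -/
theorem continuousOn_layerPotential (hk : GoodKernel k) {f : ℝ → ℝ} (hf : Continuous f) :
    ContinuousOn (fun p : ℝ × ℝ => layerPotential k f p.1 p.2) (Ici 0 ×ˢ Ici 0) := by
  obtain ⟨C, hC, h⟩ := hk.exists_bound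
  intro p₀ hp₀
  set T := p₀.1 + 1 with hT
  have hT0 : 0 ≤ T := by have := hp₀.1; simp only [mem_Ici] at this; linarith
  obtain ⟨M, hM⟩ := (isCompact_Icc (a := (0 : ℝ)) (b := T)).exists_bound_of_continuousOn
    hf.continuousOn
  have hM0 : 0 ≤ M := (norm_nonneg _).trans (hM 0 ⟨le_rfl, hT0⟩)
  set F : ℝ × ℝ → ℝ → ℝ := fun p => (Ioc 0 p.1).indicator fun τ => k τ p.2 * f (p.1 - τ) with hF
  have hrep : ∀ p ∈ Ici (0 : ℝ) ×ˢ Ici (0 : ℝ), layerPotential k f p.1 p.2 = ∫ τ, F p τ := by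
    intro p hp
    rw [layerPotential, intervalIntegral.integral_of_le hp.1, hF,
      integral_indicator measurableSet_Ioc]
  refine ContinuousWithinAt.congr ?_ hrep (hrep p₀ hp₀)
  have hev : ∀ᶠ p in 𝓝[Ici (0 : ℝ) ×ˢ Ici (0 : ℝ)] p₀, p.1 < T ∧ 0 ≤ p.1 ∧ 0 ≤ p.2 := by
    have h1 : ∀ᶠ p : ℝ × ℝ in 𝓝 p₀, p.1 < T :=
      continuous_fst.continuousAt.eventually (gt_mem_nhds (by simp [hT]))
    filter_upwards [mem_nhdsWithin_of_mem_nhds h1, self_mem_nhdsWithin] with p hp hp'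
    exact ⟨hp, hp'.1, hp'.2⟩
  refine continuousWithinAt_of_dominated
    (bound := (Ioc 0 T).indicator fun τ => C * M * kernelWeight τ) ?_ ?_ ?_ ?_
  · filter_upwards [hev] with p hp
    rw [hF, aestronglyMeasurable_indicator_iff measurableSet_Ioc]
    exact (((hk.continuousOn_left hp.2.2).mono Ioc_subset_Ioi_self).mul
      (by fun_prop)).aestronglyMeasurable measurableSet_Ioc
  · filter_upwards [hev] with p hp
    refine Eventually.of_forall fun τ => ?_
    by_cases hτ : τ ∈ Ioc 0 p.1
    · rw [hF]
      simp only
      rw [indicator_of_mem hτ, indicator_of_mem (show τ ∈ Ioc 0 T from ⟨hτ.1, hτ.2.trans hp.1.le⟩),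
        norm_mul, Real.norm_eq_abs]
      have h2 := h τ hτ.1 p.2 hp.2.2
      have h3 := hM (p.1 - τ) ⟨by linarith [hτ.2], by linarith [hτ.1, hp.1]⟩
      calc |k τ p.2| * ‖f (p.1 - τ)‖ ≤ (C * kernelWeight τ) * M := by
            have := kernelWeight_nonneg τ
            gcongr
        _ = _ := by ring
    · rw [hF]
      simp only
      rw [indicator_of_notMem hτ, norm_zero]
      exact indicator_nonneg (fun τ _ => mul_nonneg (mul_nonneg hC hM0) (kernelWeight_nonneg τ)) _
  · rw [integrable_indicator_iff measurableSet_Ioc]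
    exact ((intervalIntegrable_kernelWeight 0 T).const_mul _).1
  · have h0 : ∀ᵐ τ : ℝ, τ ≠ p₀.1 := by simp [ae_iff, measure_singleton]
    filter_upwards [h0] with τ hτ
    rcases lt_or_gt_of_ne hτ with h1 | h1
    · rcases le_or_gt τ 0 with h2 | h2
      · have : (fun p => F p τ) = fun _ => 0 := by
          funext p
          exact indicator_of_notMem (fun h : τ ∈ Ioc 0 p.1 => absurd h.1 (not_lt.2 h2)) _
        rw [this]
        exact continuousWithinAt_const
      · have hc : ContinuousWithinAt (fun p : ℝ × ℝ => k τ p.2 * f (p.1 - τ))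
            (Ici (0 : ℝ) ×ˢ Ici (0 : ℝ)) p₀ := by
          refine ContinuousWithinAt.mul ?_ (by fun_prop)
          have hm : MapsTo (fun p : ℝ × ℝ => (τ, p.2)) (Ici (0 : ℝ) ×ˢ Ici (0 : ℝ))
              (Ioi 0 ×ˢ Ici 0) := fun p hp => ⟨h2, hp.2⟩
          exact (hk.cont.comp (by fun_prop) hm) p₀ hp₀
        refine hc.congr_of_eventuallyEq ?_ ?_
        · have : ∀ᶠ p : ℝ × ℝ in 𝓝 p₀, τ < p.1 :=
            continuous_fst.continuousAt.eventually (lt_mem_nhds h1)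
          filter_upwards [mem_nhdsWithin_of_mem_nhds this] with p hp
          exact indicator_of_mem (show τ ∈ Ioc 0 p.1 from ⟨h2, hp.le⟩) _
        · exact indicator_of_mem (show τ ∈ Ioc 0 p₀.1 from ⟨h2, h1.le⟩) _
    · refine (continuousWithinAt_const (b := (0 : ℝ))).congr_of_eventuallyEq ?_ ?_
      · have : ∀ᶠ p : ℝ × ℝ in 𝓝 p₀, p.1 < τ :=
          continuous_fst.continuousAt.eventually (gt_mem_nhds h1)
        filter_upwards [mem_nhdsWithin_of_mem_nhds this] with p hp
        exact indicator_of_notMem (fun h => absurd h.2 (not_le.2 hp)) _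
      · exact indicator_of_notMem (fun h => absurd h.2 (not_le.2 h1)) _

theorem tendsto_layerPotential (hk : GoodKernel k) {f : ℝ → ℝ} (hf : Continuous f) {t : ℝ}
    (ht : 0 ≤ t) : Tendsto (layerPotential k f t) atTop (𝓝 0) := by
  rcases ht.eq_or_lt with rfl | ht
  · simp only [funext (layerPotential_zero k f)]
    exact tendsto_const_nhds
  obtain ⟨C, hC, h⟩ := hk.exists_layerPotential_bound hf t
  have h1 : Tendsto (fun y : ℝ => C * Real.exp (-(y ^ 2 / (8 * t)))) atTop (𝓝 (C * 0)) := by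
    refine Tendsto.const_mul _ (Real.tendsto_exp_neg_atTop_nhds_zero.comp ?_)
    exact (tendsto_pow_atTop two_ne_zero).atTop_div_const (by positivity)
  rw [mul_zero] at h1
  refine squeeze_zero_norm' ?_ h1
  filter_upwards [eventually_ge_atTop 0] with y hy
  exact h t ⟨ht.le, le_rfl⟩ y hy

end GoodKernel

/-- Fubini on the triangle `0 < τ ≤ r ≤ t`: convolution in time commutes with taking primitives. -/
theorem integral_integral_triangle {k g : ℝ → ℝ} {t : ℝ} (ht : 0 ≤ t)
    (hk : IntervalIntegrable k volume 0 t) (hg : Continuous g) :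
    ∫ τ in (0 : ℝ)..t, k τ * ∫ r in (0 : ℝ)..(t - τ), g r =
      ∫ r in (0 : ℝ)..t, ∫ τ in (0 : ℝ)..r, k τ * g (r - τ) := by
  set μ := (volume : Measure ℝ).restrict (Ioc 0 t) with hμ
  set F : ℝ → ℝ → ℝ := fun r τ => (Iic r).indicator (fun τ => k τ * g (r - τ)) τ with hF
  obtain ⟨M, hM⟩ := (isCompact_Icc (a := (0 : ℝ)) (b := t)).exists_bound_of_continuousOn
    hg.continuousOn
  have hM0 : 0 ≤ M := (norm_nonneg _).trans (hM 0 ⟨le_rfl, ht⟩)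
  have hkμ : Integrable k μ := hk.1
  have hint : Integrable (Function.uncurry F) (μ.prod μ) := by
    have h1 : Integrable (fun p : ℝ × ℝ => ‖k p.2‖ * M) (μ.prod μ) :=
      (hkμ.norm.comp_snd μ).mul_const M
    have hms : MeasurableSet {p : ℝ × ℝ | p.2 ≤ p.1} :=
      measurableSet_le measurable_snd measurable_fst
    have hFeq : Function.uncurry F = {p : ℝ × ℝ | p.2 ≤ p.1}.indicator
        (fun p => k p.2 * g (p.1 - p.2)) := by
      funext p
      simp only [Function.uncurry, hF, indicator, mem_Iic, mem_ofPred_eq]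
    refine h1.mono' ?_ ?_
    · rw [hFeq]
      refine AEStronglyMeasurable.indicator ?_ hms
      exact (hkμ.comp_snd μ).aestronglyMeasurable.mul
        (Continuous.aestronglyMeasurable (by fun_prop))
    · rw [hμ, Measure.prod_restrict]
      filter_upwards [ae_restrict_mem (measurableSet_Ioc.prod measurableSet_Ioc)] with p hp
      rw [hFeq]
      by_cases h : p.2 ≤ p.1
      · rw [indicator_of_mem (by exact h), norm_mul]
        gcongr
        exact hM _ ⟨by linarith, by linarith [hp.1.2, hp.2.1]⟩
      · rw [indicator_of_notMem (by exact h), norm_zero]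
        positivity
  have hswap := integral_integral_swap hint
  rw [intervalIntegral.integral_of_le ht, intervalIntegral.integral_of_le ht]
  refine Eq.trans ?_ (hswap.symm.trans ?_)
  · refine setIntegral_congr_fun measurableSet_Ioc fun τ hτ => ?_
    have h1 : ∀ r, F r τ = (Ici τ).indicator (fun r => k τ * g (r - τ)) r := by
      intro r
      simp only [hF, indicator, mem_Iic, mem_Ici]
    simp only [h1]
    rw [integral_indicator measurableSet_Ici, hμ, Measure.restrict_restrict measurableSet_Ici]
    have h2 : Ici τ ∩ Ioc 0 t = Icc τ t := by
      ext r
      simp only [mem_inter_iff, mem_Ici, mem_Ioc, mem_Icc]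
      exact ⟨fun h => ⟨h.1, h.2.2⟩, fun h => ⟨h.1, hτ.1.trans_le h.1, h.2⟩⟩
    rw [h2, integral_Icc_eq_integral_Ioc, ← intervalIntegral.integral_of_le hτ.2,
      intervalIntegral.integral_const_mul, intervalIntegral.integral_comp_sub_right]
    simp
  · refine setIntegral_congr_fun measurableSet_Ioc fun r hr => ?_
    simp only [hF]
    rw [integral_indicator measurableSet_Iic, hμ, Measure.restrict_restrict measurableSet_Iic]
    have h2 : Iic r ∩ Ioc 0 t = Ioc 0 r := by
      ext τ
      simp only [mem_inter_iff, mem_Iic, mem_Ioc]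
      exact ⟨fun h => ⟨h.2.1, h.1⟩, fun h => ⟨h.2, h.1, h.2.trans hr.2⟩⟩
    rw [h2, ← intervalIntegral.integral_of_le hr.1.le]

namespace GoodKernel

variable {k : ℝ → ℝ → ℝ}

/-- Differentiation of a layer potential in time. -/
theorem hasDerivAt_layerPotential_time (hk : GoodKernel k) {f g : ℝ → ℝ} (hg : Continuous g)
    (hfg : ∀ t, f t = f 0 + ∫ s in (0 : ℝ)..t, g s) {t y : ℝ} (ht : 0 < t) (hy : 0 ≤ y) :
    HasDerivAt (fun t => layerPotential k f t y) (layerPotential k g t y + f 0 * k t y) t := by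
  have hcont : ContinuousOn (fun t => layerPotential k g t y) (Ici 0) :=
    (hk.continuousOn_layerPotential hg).comp (f := fun t => (t, y)) (by fun_prop)
      fun _ ht => ⟨ht, hy⟩
  have hii : ∀ s, 0 ≤ s → IntervalIntegrable (fun t => layerPotential k g t y) volume 0 s :=
    fun s hs => (hcont.mono (by rw [uIcc_of_le hs]; exact Icc_subset_Ici_self)).intervalIntegrable
  -- The potential is exhibited as the primitive of the claimed derivative. No derivative of the
  -- kernel in `τ` is needed, and its singularity at `τ = 0` enters only through integrability.
  have hrep : ∀ s, 0 ≤ s → layerPotential k f s y =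
      ∫ r in (0 : ℝ)..s, (layerPotential k g r y + f 0 * k r y) := by
    intro s hs
    have hg' : Continuous fun x => ∫ r in (0 : ℝ)..x, g r :=
      intervalIntegral.continuous_primitive (fun a b => hg.intervalIntegrable a b) 0
    rw [intervalIntegral.integral_add (hii s hs) ((hk.intervalIntegrable hy hs).const_mul _)]
    unfold layerPotential
    rw [← integral_integral_triangle hs (hk.intervalIntegrable hy hs) hg,
      intervalIntegral.integral_const_mul, ← intervalIntegral.integral_const_mul,
      ← intervalIntegral.integral_add
        (hk.intervalIntegrable_mul hy hs hg' s) ((hk.intervalIntegrable hy hs).const_mul _)]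
    refine intervalIntegral.integral_congr fun τ _ => ?_
    rw [hfg (s - τ)]
    ring
  have hc : ContinuousOn (fun r => layerPotential k g r y + f 0 * k r y) (Ioi 0) :=
    (hcont.mono Ioi_subset_Ici_self).add (continuousOn_const.mul (hk.continuousOn_left hy))
  have hd := intervalIntegral.integral_hasDerivAt_right
    ((hii t ht.le).add ((hk.intervalIntegrable hy ht.le).const_mul (f 0)))
    (hc.stronglyMeasurableAtFilter isOpen_Ioi t ht) (hc.continuousAt (Ioi_mem_nhds ht))
  refine hd.congr_of_eventuallyEq ?_
  filter_upwards [Ioi_mem_nhds ht] with s hs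
  exact hrep s (le_of_lt hs)

/-- Differentiation of a layer potential in space. -/
theorem hasDerivAt_layerPotential_space (hk : GoodKernel k) {k' : ℝ → ℝ → ℝ}
    {f : ℝ → ℝ} (hf : Continuous f) {t y C : ℝ} (ht : 0 ≤ t) (hy : 0 < y)
    (hk' : ContinuousOn (fun τ => k' τ y) (Ioi 0))
    (hbound : ∀ τ > 0, ∀ x > y / 2, |k' τ x| ≤ C * kernelWeight τ)
    (hderiv : ∀ τ > 0, ∀ x > 0, HasDerivAt (k τ) (k' τ x) x) :
    HasDerivAt (layerPotential k f t) (layerPotential k' f t y) y := by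
  obtain ⟨M, hM⟩ := (isCompact_Icc (a := (0 : ℝ)) (b := t)).exists_bound_of_continuousOn
    hf.continuousOn
  have hM0 : 0 ≤ M := (norm_nonneg _).trans (hM 0 ⟨le_rfl, ht⟩)
  -- Domination is required only for `x > y / 2`: the double layer kernel, to which this is applied,
  -- is not bounded by the weight uniformly up to the wall.
  refine (intervalIntegral.hasDerivAt_integral_of_dominated_loc_of_deriv_le
    (F := fun x τ => k τ x * f (t - τ)) (F' := fun x τ => k' τ x * f (t - τ))
    (bound := fun τ => C * M * kernelWeight τ)
    (Ioi_mem_nhds (half_lt_self hy)) ?_ (hk.intervalIntegrable_mul hy.le ht hf t) ?_ ?_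
    ((intervalIntegrable_kernelWeight 0 t).const_mul _) ?_).2
  · filter_upwards [Ioi_mem_nhds hy] with x hx
    rw [uIoc_of_le ht]
    exact (((hk.continuousOn_left (le_of_lt hx)).mono Ioc_subset_Ioi_self).mul
      (by fun_prop)).aestronglyMeasurable measurableSet_Ioc
  · rw [uIoc_of_le ht]
    exact ((hk'.mono Ioc_subset_Ioi_self).mul
      (by fun_prop)).aestronglyMeasurable measurableSet_Ioc
  · refine Eventually.of_forall fun τ hτ x hx => ?_
    rw [uIoc_of_le ht] at hτ
    rw [norm_mul, Real.norm_eq_abs]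
    have h2 := hbound τ hτ.1 x hx
    have h3 := hM (t - τ) ⟨by linarith [hτ.2], by linarith [hτ.1]⟩
    calc |k' τ x| * ‖f (t - τ)‖ ≤ (C * kernelWeight τ) * M := by
          have := (abs_nonneg _).trans h2
          gcongr
      _ = _ := by ring
  · refine Eventually.of_forall fun τ hτ x hx => ?_
    rw [uIoc_of_le ht] at hτ
    exact (hderiv τ hτ.1 x ((half_pos hy).trans hx)).mul_const _

end GoodKernel

/-! ### The complementary error function -/

/-- The complementary error function. -/
noncomputable def erfc (x : ℝ) : ℝ := 1 - 2 / √Real.pi * ∫ r in (0 : ℝ)..x, Real.exp (-r ^ 2)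

theorem erfc_zero : erfc 0 = 1 := by simp [erfc]

theorem hasDerivAt_erfc (x : ℝ) : HasDerivAt erfc (-(2 / √Real.pi * Real.exp (-x ^ 2))) x := by
  have hc : Continuous fun r : ℝ => Real.exp (-r ^ 2) := by fun_prop
  exact ((intervalIntegral.integral_hasDerivAt_right (hc.intervalIntegrable 0 x)
    hc.aestronglyMeasurable.stronglyMeasurableAtFilter hc.continuousAt).const_mul _).const_sub _

theorem continuous_erfc : Continuous erfc :=
  continuous_iff_continuousAt.2 fun x => (hasDerivAt_erfc x).continuousAt

/-- For `r ≥ x ≥ 0` one has `r² ≥ x² / 2 + r² / 2`, so half of the exponent leaves the tail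
integral. At `x = y / 2√τ` this is the factor `exp (-y² / 8τ)` demanded of a good kernel. -/
theorem abs_erfc_le : ∃ C, 0 ≤ C ∧ ∀ x ≥ 0, |erfc x| ≤ C * Real.exp (-(x ^ 2 / 2)) := by
  have hi : ∀ b : ℝ, 0 < b → Integrable fun r : ℝ => Real.exp (-b * r ^ 2) :=
    fun b hb => integrable_exp_neg_mul_sq hb
  refine ⟨2 / √Real.pi * ∫ r, Real.exp (-(1 / 2) * r ^ 2),
    mul_nonneg (by positivity) (integral_nonneg fun _ => (Real.exp_pos _).le), fun x hx => ?_⟩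
  have h1 : erfc x = 2 / √Real.pi * ∫ r in Ioi x, Real.exp (-1 * r ^ 2) := by
    have h2 := intervalIntegral.integral_interval_add_Ioi
      ((hi 1 one_pos).integrableOn (s := Ioi 0)) ((hi 1 one_pos).integrableOn (s := Ioi x))
    rw [integral_gaussian_Ioi, div_one] at h2
    have h3 : ∫ r in Ioi x, Real.exp (-1 * r ^ 2) =
        √Real.pi / 2 - ∫ r in (0 : ℝ)..x, Real.exp (-1 * r ^ 2) := by linarith
    have h4 : √Real.pi ≠ 0 := by positivity
    rw [h3, erfc]
    simp only [neg_mul, one_mul]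
    field_simp
  have h5 : ∫ r in Ioi x, Real.exp (-1 * r ^ 2) ≤
      ∫ r in Ioi x, Real.exp (-(x ^ 2 / 2)) * Real.exp (-(1 / 2) * r ^ 2) := by
    refine setIntegral_mono_on (hi 1 one_pos).integrableOn
      ((hi (1 / 2) (by norm_num)).const_mul _).integrableOn measurableSet_Ioi fun r hr => ?_
    rw [← Real.exp_add]
    apply Real.exp_le_exp.2
    have : x ^ 2 ≤ r ^ 2 := pow_le_pow_left₀ hx (le_of_lt hr) 2
    linarith
  have h6 : ∫ r in Ioi x, Real.exp (-(x ^ 2 / 2)) * Real.exp (-(1 / 2) * r ^ 2) ≤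
      ∫ r, Real.exp (-(x ^ 2 / 2)) * Real.exp (-(1 / 2) * r ^ 2) :=
    setIntegral_le_integral ((hi (1 / 2) (by norm_num)).const_mul _)
      (Eventually.of_forall fun r => by positivity)
  have h7 : 0 ≤ ∫ r in Ioi x, Real.exp (-1 * r ^ 2) := integral_nonneg fun _ => (Real.exp_pos _).le
  rw [h1, abs_of_nonneg (by positivity)]
  calc 2 / √Real.pi * ∫ r in Ioi x, Real.exp (-1 * r ^ 2)
      ≤ 2 / √Real.pi * (Real.exp (-(x ^ 2 / 2)) * ∫ r, Real.exp (-(1 / 2) * r ^ 2)) := by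
        gcongr
        exact h5.trans (h6.trans_eq (integral_const_mul _ _))
    _ = _ := by ring

/-! ### Heat kernels on the half line -/

/-- The single layer heat kernel `(πτ)^{-1/2} exp (-y² / 4τ)`. -/
noncomputable def heatG (τ y : ℝ) : ℝ := (√Real.pi)⁻¹ * (√τ)⁻¹ * Real.exp (-(y ^ 2 / (4 * τ)))

/-- The time primitive `erfc (y / 2√τ)` of the double layer heat kernel. -/
noncomputable def heatE (τ y : ℝ) : ℝ := erfc (y / (2 * √τ))

/-- The double layer heat kernel. -/
noncomputable def heatH (τ y : ℝ) : ℝ := y / (2 * τ) * heatG τ y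

/-- The single layer heat kernel times `y`. -/
noncomputable def heatYG (τ y : ℝ) : ℝ := y * heatG τ y

/-- The double layer heat kernel times `y`. -/
noncomputable def heatYH (τ y : ℝ) : ℝ := y ^ 2 / (2 * τ) * heatG τ y

theorem heatYH_eq (τ y : ℝ) : heatYH τ y = y * heatH τ y := by
  unfold heatYH heatH; ring

theorem heatH_eq {y : ℝ} (hy : y ≠ 0) (τ : ℝ) : heatH τ y = heatYH τ y / y := by
  rw [heatYH_eq]; field_simp

/-- One half of the Gaussian is spent on absorbing powers of `y / √τ`; the other is the decay kept
in `GoodKernel`. -/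
theorem exp_heat_eq (τ y : ℝ) : Real.exp (-(y ^ 2 / (4 * τ))) =
    Real.exp (-(y ^ 2 / (8 * τ))) * Real.exp (-(y ^ 2 / (8 * τ))) := by
  rw [← Real.exp_add]
  congr 1
  rcases eq_or_ne τ 0 with rfl | h
  · simp
  · field_simp; ring

theorem mul_exp_neg_le_one {x : ℝ} : x * Real.exp (-x) ≤ 1 := by
  rw [Real.exp_neg, ← div_eq_mul_inv, div_le_one (Real.exp_pos x)]
  linarith [Real.add_one_le_exp x]

theorem continuousOn_heatG :
    ContinuousOn (fun p : ℝ × ℝ => heatG p.1 p.2) (Ioi 0 ×ˢ univ) := by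
  unfold heatG
  have h1 : ∀ p ∈ (Ioi 0 ×ˢ univ : Set (ℝ × ℝ)), √p.1 ≠ 0 :=
    fun p hp => (Real.sqrt_pos.2 hp.1).ne'
  have h2 : ∀ p ∈ (Ioi 0 ×ˢ univ : Set (ℝ × ℝ)), 4 * p.1 ≠ 0 :=
    fun p hp => mul_ne_zero four_ne_zero (ne_of_gt hp.1)
  refine ContinuousOn.mul (ContinuousOn.mul continuousOn_const
    (ContinuousOn.inv₀ (by fun_prop) h1)) (Real.continuous_exp.comp_continuousOn ?_)
  exact (ContinuousOn.div (by fun_prop) (by fun_prop) h2).neg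

theorem continuousOn_heatE :
    ContinuousOn (fun p : ℝ × ℝ => heatE p.1 p.2) (Ioi 0 ×ˢ univ) := by
  unfold heatE
  exact continuous_erfc.comp_continuousOn (ContinuousOn.div (by fun_prop) (by fun_prop)
    fun p hp => mul_ne_zero two_ne_zero (Real.sqrt_pos.2 hp.1).ne')

theorem heatG_nonneg (τ y : ℝ) : 0 ≤ heatG τ y := by unfold heatG; positivity

theorem goodKernel_heatE : GoodKernel heatE where
  cont := continuousOn_heatE.mono (prod_mono_right (subset_univ _))
  bound := by
    obtain ⟨C, hC, h⟩ := abs_erfc_le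
    refine ⟨C, hC, fun τ hτ y hy => ?_⟩
    have h1 := h (y / (2 * √τ)) (by positivity)
    rw [div_pow, mul_pow, Real.sq_sqrt hτ.le, div_div,
      show 2 ^ 2 * τ * 2 = 8 * τ by ring] at h1
    refine h1.trans ?_
    gcongr
    exact le_mul_of_one_le_right hC (one_le_kernelWeight τ)

theorem heatG_le {τ : ℝ} (y : ℝ) :
    heatG τ y ≤ (√Real.pi)⁻¹ * (√τ)⁻¹ * Real.exp (-(y ^ 2 / (8 * τ))) *
      Real.exp (-(y ^ 2 / (8 * τ))) := by
  rw [heatG, exp_heat_eq, mul_assoc ((√Real.pi)⁻¹ * (√τ)⁻¹)]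

theorem exp_neg_div_le_one {τ : ℝ} (hτ : 0 < τ) (y : ℝ) : Real.exp (-(y ^ 2 / (8 * τ))) ≤ 1 := by
  rw [Real.exp_le_one_iff, neg_nonpos]; positivity

theorem goodKernel_heatG : GoodKernel heatG where
  cont := continuousOn_heatG.mono (prod_mono_right (subset_univ _))
  bound := by
    refine ⟨(√Real.pi)⁻¹, by positivity, fun τ hτ y hy => ?_⟩
    rw [abs_of_nonneg (heatG_nonneg _ _)]
    refine (heatG_le y).trans ?_
    have h1 := exp_neg_div_le_one hτ y
    have h2 := inv_sqrt_le_kernelWeight τ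
    refine mul_le_of_le_one_right (by positivity) h1 |>.trans ?_
    gcongr

theorem goodKernel_heatYG : GoodKernel heatYG where
  cont := (continuousOn_snd.mul continuousOn_heatG).mono (prod_mono_right (subset_univ _))
  bound := by
    refine ⟨2 * (√Real.pi)⁻¹, by positivity, fun τ hτ y hy => ?_⟩
    have hpos : 0 ≤ heatYG τ y := mul_nonneg hy (heatG_nonneg _ _)
    rw [abs_of_nonneg hpos, heatYG]
    set e := Real.exp (-(y ^ 2 / (8 * τ)))
    have hs : y * (√τ)⁻¹ * e ≤ 2 := by
      set s := y * (√τ)⁻¹ with hs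
      have h1 : y ^ 2 / (8 * τ) = s ^ 2 / 8 := by
        rw [hs, mul_pow, inv_pow, Real.sq_sqrt hτ.le]; field_simp
      have h2 : e = (Real.exp (s ^ 2 / 8))⁻¹ := by
        rw [← Real.exp_neg, ← h1]
      rw [h2, ← div_eq_mul_inv, div_le_iff₀ (Real.exp_pos _)]
      nlinarith [Real.add_one_le_exp (s ^ 2 / 8), sq_nonneg (s - 2)]
    calc y * heatG τ y ≤ y * ((√Real.pi)⁻¹ * (√τ)⁻¹ * e * e) := by gcongr; exact heatG_le y
      _ = (y * (√τ)⁻¹ * e) * ((√Real.pi)⁻¹ * e) := by ring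
      _ ≤ 2 * ((√Real.pi)⁻¹ * e) := by gcongr
      _ = (2 * (√Real.pi)⁻¹ * 1) * e := by ring
      _ ≤ _ := by gcongr; exact one_le_kernelWeight τ

theorem heatYH_le {τ y : ℝ} (hτ : 0 < τ) :
    heatYH τ y ≤ 4 * (√Real.pi)⁻¹ * (√τ)⁻¹ * Real.exp (-(y ^ 2 / (8 * τ))) := by
  rw [heatYH]
  have h1 := mul_exp_neg_le_one (x := y ^ 2 / (8 * τ))
  have h2 : 0 ≤ y ^ 2 / (2 * τ) := by positivity
  set e := Real.exp (-(y ^ 2 / (8 * τ))) with he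
  calc y ^ 2 / (2 * τ) * heatG τ y ≤ y ^ 2 / (2 * τ) * ((√Real.pi)⁻¹ * (√τ)⁻¹ * e * e) := by
        gcongr; exact heatG_le y
    _ = 4 * (√Real.pi)⁻¹ * (√τ)⁻¹ * e * (y ^ 2 / (8 * τ) * e) := by field_simp; ring
    _ ≤ 4 * (√Real.pi)⁻¹ * (√τ)⁻¹ * e * 1 := by gcongr
    _ = _ := mul_one _

theorem heatYH_nonneg {τ : ℝ} (hτ : 0 < τ) (y : ℝ) : 0 ≤ heatYH τ y :=
  mul_nonneg (by positivity) (heatG_nonneg _ _)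

/-- Half of the Gaussian absorbs `y² / τ`. The double layer kernel without the factor `y` has size
`τ⁻¹` at `y ∼ √τ` and is not a good kernel, so it is handled through this one and division by `y >
0`. -/
theorem goodKernel_heatYH : GoodKernel heatYH where
  cont := by
    refine ContinuousOn.mul (ContinuousOn.div (by fun_prop) (by fun_prop) fun p hp => ?_)
      (continuousOn_heatG.mono (prod_mono_right (subset_univ _)))
    exact mul_ne_zero two_ne_zero (ne_of_gt hp.1)
  bound := by
    refine ⟨4 * (√Real.pi)⁻¹, by positivity, fun τ hτ y hy => ?_⟩
    rw [abs_of_nonneg (heatYH_nonneg hτ y)]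
    refine (heatYH_le hτ).trans ?_
    have h2 := inv_sqrt_le_kernelWeight τ
    gcongr

theorem hasDerivAt_heatE_space {τ : ℝ} (hτ : 0 < τ) (y : ℝ) :
    HasDerivAt (heatE τ) (-heatG τ y) y := by
  have h1 : HasDerivAt (fun y : ℝ => y / (2 * √τ)) (1 / (2 * √τ)) y :=
    (hasDerivAt_id y).div_const _
  refine ((hasDerivAt_erfc _).comp y h1).congr_deriv ?_
  have h2 : (√τ) ^ 2 = τ := Real.sq_sqrt hτ.le
  have h3 : √τ ≠ 0 := (Real.sqrt_pos.2 hτ).ne'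
  rw [heatG, div_pow, mul_pow, h2, show (2 : ℝ) ^ 2 = 4 by norm_num]
  field_simp

theorem hasDerivAt_heatE_time {τ : ℝ} (hτ : 0 < τ) (y : ℝ) :
    HasDerivAt (fun τ => heatE τ y) (heatH τ y) τ := by
  have h3 : √τ ≠ 0 := (Real.sqrt_pos.2 hτ).ne'
  have h1 : HasDerivAt (fun τ : ℝ => y / (2 * √τ))
      ((0 * (2 * √τ) - y * (2 * (1 / (2 * √τ)))) / (2 * √τ) ^ 2) τ :=
    (hasDerivAt_const τ y).div ((Real.hasDerivAt_sqrt hτ.ne').const_mul 2) (by positivity)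
  refine ((hasDerivAt_erfc _).comp τ h1).congr_deriv ?_
  have h2 : (√τ) ^ 2 = τ := Real.sq_sqrt hτ.le
  rw [heatH, heatG, div_pow, mul_pow, h2, show (2 : ℝ) ^ 2 = 4 by norm_num]
  field_simp
  ring

theorem hasDerivAt_heatG_space (τ y : ℝ) : HasDerivAt (heatG τ) (-heatH τ y) y := by
  have h1 : HasDerivAt (fun y : ℝ => -(y ^ 2 / (4 * τ))) (-(2 * y / (4 * τ))) y := by
    simpa using ((hasDerivAt_pow 2 y).div_const (4 * τ)).fun_neg
  refine (h1.exp.const_mul _).congr_deriv ?_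
  rw [heatH, heatG]
  ring

theorem heatE_zero_right (τ : ℝ) : heatE τ 0 = 1 := by simp [heatE, erfc_zero]

theorem tendsto_heatE_zero {y : ℝ} (hy : 0 < y) :
    Tendsto (fun τ => heatE τ y) (𝓝[>] 0) (𝓝 0) := by
  obtain ⟨C, hC, h⟩ := abs_erfc_le
  have h1 : Tendsto (fun τ : ℝ => (√τ)⁻¹) (𝓝[>] 0) atTop := by
    refine tendsto_inv_nhdsGT_zero.comp (tendsto_nhdsWithin_iff.2 ⟨?_, ?_⟩)
    · have := (Real.continuous_sqrt.tendsto 0).mono_left (nhdsWithin_le_nhds (s := Ioi (0 : ℝ)))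
      rwa [Real.sqrt_zero] at this
    · filter_upwards [self_mem_nhdsWithin] with τ hτ using Real.sqrt_pos.2 hτ
  have h2 : Tendsto (fun τ : ℝ => y / (2 * √τ)) (𝓝[>] 0) atTop := by
    refine (h1.const_mul_atTop (half_pos hy)).congr fun τ => ?_
    rw [div_mul_eq_mul_div, ← div_eq_mul_inv]
    field_simp
  have h3 : Tendsto (fun x : ℝ => C * Real.exp (-(x ^ 2 / 2))) atTop (𝓝 (C * 0)) :=
    (Real.tendsto_exp_neg_atTop_nhds_zero.comp
      ((tendsto_pow_atTop two_ne_zero).atTop_div_const two_pos)).const_mul _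
  rw [mul_zero] at h3
  exact (squeeze_zero_norm' ((eventually_ge_atTop 0).mono fun x hx => h x hx) h3).comp h2

/-- Away from the wall, division by `x > y / 2` costs only a constant. -/
theorem heatH_bound {y : ℝ} (hy : 0 < y) : ∃ C, ∀ τ > 0, ∀ x > y / 2,
    |heatH τ x| ≤ C * kernelWeight τ := by
  obtain ⟨C, hC, h⟩ := goodKernel_heatYH.exists_bound
  refine ⟨C * (y / 2)⁻¹, fun τ hτ x hx => ?_⟩
  have hx0 : 0 < x := (half_pos hy).trans hx
  rw [heatH_eq hx0.ne', abs_div, abs_of_pos hx0, div_le_iff₀ hx0]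
  have h1 := h τ hτ x hx0.le
  have h2 : 1 ≤ (y / 2)⁻¹ * x := by
    rw [inv_mul_eq_div, one_le_div (half_pos hy)]; exact hx.le
  calc |heatYH τ x| ≤ C * kernelWeight τ * 1 := by rwa [mul_one]
    _ ≤ C * kernelWeight τ * ((y / 2)⁻¹ * x) := by
      gcongr
      exact mul_nonneg hC (kernelWeight_nonneg τ)
    _ = _ := by ring

/-! ### Potentials of the heat kernels -/

section

variable {f g : ℝ → ℝ} {t y : ℝ}

theorem layerPotential_neg (k : ℝ → ℝ → ℝ) (f : ℝ → ℝ) (t y : ℝ) :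
    layerPotential (fun τ y => -k τ y) f t y = -layerPotential k f t y := by
  simp [layerPotential, intervalIntegral.integral_neg]

theorem layerPotential_heatYH (f : ℝ → ℝ) (t y : ℝ) :
    layerPotential heatYH f t y = y * layerPotential heatH f t y := by
  unfold layerPotential
  rw [← intervalIntegral.integral_const_mul]
  simp only [heatYH_eq, mul_assoc]

theorem layerPotential_heatYG (f : ℝ → ℝ) (t y : ℝ) :
    layerPotential heatYG f t y = y * layerPotential heatG f t y := by
  unfold layerPotential
  rw [← intervalIntegral.integral_const_mul]
  simp only [heatYG, mul_assoc]

theorem hasDerivAt_layerPotential_heatE (hf : Continuous f) (ht : 0 ≤ t) (hy : 0 < y) :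
    HasDerivAt (layerPotential heatE f t) (-layerPotential heatG f t y) y := by
  obtain ⟨C, hC, h⟩ := goodKernel_heatG.exists_bound
  rw [← layerPotential_neg]
  refine goodKernel_heatE.hasDerivAt_layerPotential_space hf ht hy (C := C)
    (goodKernel_heatG.continuousOn_left hy.le).neg (fun τ hτ x hx => ?_)
    (fun τ hτ x _ => hasDerivAt_heatE_space hτ x)
  rw [abs_neg]
  exact h τ hτ x (by linarith)

/-- Integration by parts in the double layer potential. -/
theorem layerPotential_heatH (hfd : ∀ t, HasDerivAt f (g t) t) (hg : Continuous g) (ht : 0 < t)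
    (hy : 0 < y) :
    layerPotential heatH f t y = layerPotential heatE g t y + f 0 * heatE t y := by
  have hf : Continuous f := continuous_iff_continuousAt.2 fun t => (hfd t).continuousAt
  have hi1 : IntervalIntegrable (fun τ => heatH τ y * f (t - τ)) volume 0 t := by
    simp only [heatH_eq hy.ne', div_mul_eq_mul_div]
    exact (goodKernel_heatYH.intervalIntegrable_mul hy.le ht.le hf t).div_const y
  have hi2 := goodKernel_heatE.intervalIntegrable_mul hy.le ht.le hg t
  have hd : ∀ τ ∈ Ioo 0 t, HasDerivAt (fun τ => heatE τ y * f (t - τ))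
      (heatH τ y * f (t - τ) - heatE τ y * g (t - τ)) τ := by
    intro τ hτ
    have h1 : HasDerivAt (fun τ => f (t - τ)) (-g (t - τ)) τ := by
      simpa using (hfd (t - τ)).comp_const_sub t τ
    refine ((hasDerivAt_heatE_time hτ.1 y).mul h1).congr_deriv ?_
    ring
  have hc : ContinuousAt (fun τ => heatE τ y) t :=
    (goodKernel_heatE.continuousOn_left hy.le).continuousAt (Ioi_mem_nhds ht)
  -- `heatE` is a primitive of `heatH` in `τ`. The boundary term at `τ → 0` vanishes because `y > 0`
  -- sends the argument of `erfc` to infinity; the one at `τ = t` leaves `f 0`.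
  have key := intervalIntegral.integral_eq_sub_of_hasDerivAt_of_tendsto ht hd (hi1.sub hi2)
    (fa := 0) (fb := heatE t y * f 0) ?_ ?_
  · rw [intervalIntegral.integral_sub hi1 hi2] at key
    unfold layerPotential
    linarith
  · have h1 : Tendsto (fun τ => f (t - τ)) (𝓝[>] 0) (𝓝 (f (t - 0))) :=
      ((by fun_prop : Continuous fun τ => f (t - τ)).tendsto 0).mono_left nhdsWithin_le_nhds
    simpa using (tendsto_heatE_zero hy).mul h1
  · have h1 : Tendsto (fun τ => f (t - τ)) (𝓝 t) (𝓝 (f (t - t))) :=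
      (by fun_prop : Continuous fun τ => f (t - τ)).tendsto t
    rw [sub_self] at h1
    exact (hc.tendsto.mul h1).mono_left nhdsWithin_le_nhds

/-- The space derivative of the single layer kernel is minus the double layer kernel, whose
potential is integrated by parts back to `heatE`. -/
theorem hasDerivAt_layerPotential_heatG (hfd : ∀ t, HasDerivAt f (g t) t) (hg : Continuous g)
    (ht : 0 < t) (hy : 0 < y) :
    HasDerivAt (layerPotential heatG f t)
      (-(layerPotential heatE g t y + f 0 * heatE t y)) y := by
  have hf : Continuous f := continuous_iff_continuousAt.2 fun t => (hfd t).continuousAt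
  obtain ⟨C, h⟩ := heatH_bound hy
  rw [← layerPotential_heatH hfd hg ht hy, ← layerPotential_neg]
  refine goodKernel_heatG.hasDerivAt_layerPotential_space hf ht.le hy (C := C) ?_
    (fun τ hτ x hx => ?_) (fun τ hτ x _ => hasDerivAt_heatG_space τ x)
  · simp only [heatH_eq hy.ne']
    exact ((goodKernel_heatYH.continuousOn_left hy.le).div_const y).neg
  · rw [abs_neg]
    exact h τ hτ x hx

end

/-! ### Square integrability of layer potentials -/

theorem memLp_two_of_sq_le {f : ℝ → ℝ → ℝ} {T : ℝ} {a b : ℝ → ℝ}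
    (hf : ContinuousOn (fun p : ℝ × ℝ => f p.1 p.2) (Ioi 0 ×ˢ Ioi 0))
    (ha : IntegrableOn a (Ioo 0 T)) (hb : IntegrableOn b (Ioi 0))
    (h : ∀ t ∈ Ioo 0 T, ∀ y > 0, f t y ^ 2 ≤ a t * b y) :
    MemLp (fun p : ℝ × ℝ => f p.1 p.2) 2 (volume.restrict (Ioo 0 T ×ˢ Ioi 0)) := by
  have hms : MeasurableSet (Ioo 0 T ×ˢ Ioi 0 : Set (ℝ × ℝ)) :=
    measurableSet_Ioo.prod measurableSet_Ioi
  have hm : AEStronglyMeasurable (fun p : ℝ × ℝ => f p.1 p.2)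
      (volume.restrict (Ioo 0 T ×ˢ Ioi 0)) :=
    (hf.mono (prod_mono_left Ioo_subset_Ioi_self)).aestronglyMeasurable hms
  rw [memLp_two_iff_integrable_sq hm]
  have hab : Integrable (fun p : ℝ × ℝ => a p.1 * b p.2)
      (volume.restrict (Ioo 0 T ×ˢ Ioi 0)) := by
    rw [Measure.volume_eq_prod, ← Measure.prod_restrict]
    exact ha.mul_prod hb
  refine hab.mono' (hm.pow 2) ?_
  filter_upwards [ae_restrict_mem hms] with p hp
  rw [Real.norm_of_nonneg (sq_nonneg _)]
  exact h p.1 hp.1 p.2 hp.2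

theorem integrableOn_exp_neg_sq_div {T : ℝ} (hT : 0 < T) :
    IntegrableOn (fun y : ℝ => Real.exp (-(y ^ 2 / (8 * T)))) (Ioi 0) := by
  refine ((integrable_exp_neg_mul_sq (b := (8 * T)⁻¹) (by positivity)).congr ?_).integrableOn
  refine Eventually.of_forall fun y => ?_
  simp only
  congr 1
  rw [div_eq_mul_inv]
  ring

namespace GoodKernel

variable {k : ℝ → ℝ → ℝ}

theorem memLp_layerPotential (hk : GoodKernel k) {f : ℝ → ℝ} (hf : Continuous f) {T : ℝ}
    (hT : 0 < T) : MemLp (fun p : ℝ × ℝ => layerPotential k f p.1 p.2) 2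
      (volume.restrict (Ioo 0 T ×ˢ Ioi 0)) := by
  obtain ⟨C, hC, h⟩ := hk.exists_layerPotential_bound hf T
  refine memLp_two_of_sq_le (a := fun _ => C ^ 2)
    ((hk.continuousOn_layerPotential hf).mono
      (prod_mono Ioi_subset_Ici_self Ioi_subset_Ici_self)) (by simp)
    (integrableOn_exp_neg_sq_div hT) fun t ht y hy => ?_
  have h1 := h t ⟨ht.1.le, ht.2.le⟩ y hy.le
  have h2 := exp_neg_div_le_one hT y
  rw [← sq_abs]
  calc |layerPotential k f t y| ^ 2 ≤ (C * Real.exp (-(y ^ 2 / (8 * T)))) ^ 2 := by gcongr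
    _ = C ^ 2 * (Real.exp (-(y ^ 2 / (8 * T))) * Real.exp (-(y ^ 2 / (8 * T)))) := by ring
    _ ≤ C ^ 2 * (Real.exp (-(y ^ 2 / (8 * T))) * 1) := by gcongr
    _ = _ := by rw [mul_one]

/-- The kernel itself, singular at the corner, appears in the highest time derivatives through
`u''(0)`. Its square is of size `t⁻¹` times a Gaussian, and giving up a quarter power of `y² / t`
bounds it by `t^{-3/4} y^{-1/2}` times a Gaussian in `y`, a product of integrable functions of one
variable. -/
theorem memLp (hk : GoodKernel k) {T : ℝ} (hT : 0 < T) :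
    MemLp (fun p : ℝ × ℝ => k p.1 p.2) 2 (volume.restrict (Ioo 0 T ×ˢ Ioi 0)) := by
  obtain ⟨C, hC, h⟩ := hk.bound
  set c := C * (√T + 1) with hc
  have hb : IntegrableOn (fun y : ℝ => y ^ (-(1 / 2) : ℝ) * Real.exp (-(8 * T)⁻¹ * y ^ 2)) (Ioi 0) :=
    integrableOn_rpow_mul_exp_neg_mul_sq (by positivity) (by norm_num)
  have ha : IntegrableOn (fun t : ℝ => 8 * c ^ 2 * t ^ (-(3 / 4) : ℝ)) (Ioo 0 T) := by
    have := (intervalIntegral.intervalIntegrable_rpow' (a := 0) (b := T) (r := -(3 / 4))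
      (by norm_num)).1
    exact (this.mono_set Ioo_subset_Ioc_self).const_mul _
  refine memLp_two_of_sq_le (hk.cont.mono (prod_mono_right Ioi_subset_Ici_self)) ha hb
    fun t ht y hy => ?_
  have ht0 := ht.1
  set e := Real.exp (-(y ^ 2 / (8 * t))) with he
  have h1 : |k t y| ≤ c * (√t)⁻¹ * e := by
    refine (h t ht0 y hy.le).trans ?_
    have hs : 0 < √t := Real.sqrt_pos.2 ht0
    have : kernelWeight t ≤ (√T + 1) * (√t)⁻¹ := by
      rw [kernelWeight, add_mul, one_mul]
      have : 1 ≤ √T * (√t)⁻¹ := by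
        rw [← div_eq_mul_inv, one_le_div hs]; exact Real.sqrt_le_sqrt ht.2.le
      linarith
    calc C * kernelWeight t * e ≤ C * ((√T + 1) * (√t)⁻¹) * e := by gcongr
      _ = _ := by rw [hc]; ring
  have h2 : e ≤ Real.exp (-(8 * T)⁻¹ * y ^ 2) := by
    refine (exp_div_le ht0 ht.2.le).trans_eq ?_
    congr 1
    rw [div_eq_mul_inv]; ring
  set s := y ^ 2 / (8 * t) with hs
  have hs0 : 0 < s := by positivity
  have h3 : t⁻¹ * e ≤ 8 * t ^ (-(3 / 4) : ℝ) * y ^ (-(1 / 2) : ℝ) := by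
    have h4 : t⁻¹ = t ^ (-(3 / 4) : ℝ) * y ^ (-(1 / 2) : ℝ) * (8 * s) ^ (1 / 4 : ℝ) := by
      have : 8 * s = y ^ (2 : ℝ) * t ^ (-1 : ℝ) := by
        rw [hs, Real.rpow_neg_one, Real.rpow_two]; field_simp
      rw [this, Real.mul_rpow (by positivity) (by positivity), ← Real.rpow_mul hy.le,
        ← Real.rpow_mul ht0.le]
      calc t⁻¹ = t ^ (-(3 / 4) + (-1) * (1 / 4) : ℝ) * y ^ (-(1 / 2) + 2 * (1 / 4) : ℝ) := by
            norm_num [Real.rpow_neg_one]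
        _ = _ := by rw [Real.rpow_add ht0, Real.rpow_add hy]; ring
    have h5 : (8 * s) ^ (1 / 4 : ℝ) * e ≤ 8 := by
      have h6 : (8 * s) ^ (1 / 4 : ℝ) ≤ 1 + 8 * s := by
        calc (8 * s) ^ (1 / 4 : ℝ) ≤ (1 + 8 * s) ^ (1 / 4 : ℝ) :=
              Real.rpow_le_rpow (by positivity) (by linarith) (by norm_num)
          _ ≤ (1 + 8 * s) ^ (1 : ℝ) :=
              Real.rpow_le_rpow_of_exponent_le (by linarith) (by norm_num)
          _ = _ := Real.rpow_one _
      have h7 : 1 + 8 * s ≤ 8 * Real.exp s := by linarith [Real.add_one_le_exp s]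
      rw [he, Real.exp_neg, ← div_eq_mul_inv, div_le_iff₀ (Real.exp_pos _)]
      linarith
    rw [h4, mul_assoc]
    calc t ^ (-(3 / 4) : ℝ) * y ^ (-(1 / 2) : ℝ) * ((8 * s) ^ (1 / 4 : ℝ) * e)
        ≤ t ^ (-(3 / 4) : ℝ) * y ^ (-(1 / 2) : ℝ) * 8 := by
          have := Real.rpow_nonneg hy.le (-(1 / 2))
          gcongr
      _ = _ := by ring
  rw [← sq_abs]
  calc |k t y| ^ 2 ≤ (c * (√t)⁻¹ * e) ^ 2 := by gcongr
    _ = c ^ 2 * (t⁻¹ * e) * e := by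
      rw [mul_pow, mul_pow, inv_pow, Real.sq_sqrt ht0.le]; ring
    _ ≤ c ^ 2 * (8 * t ^ (-(3 / 4) : ℝ) * y ^ (-(1 / 2) : ℝ)) *
        Real.exp (-(8 * T)⁻¹ * y ^ 2) := by gcongr
    _ = _ := by ring

end GoodKernel

/-! ### Layer functions together with their partial derivatives -/

/-- `U` is a layer function with partial derivatives `U₁` in time and `U₂` in space, both locally
square integrable in time. -/
structure HasLayerDeriv {F : Type*} [NormedAddCommGroup F] [NormedSpace ℝ F]
    (U U₁ U₂ : ℝ → ℝ → F) : Prop where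
  cont : ContinuousOn (fun p : ℝ × ℝ => U p.1 p.2) (Ici 0 ×ˢ Ici 0)
  initial : ∀ y ∈ Ici (0 : ℝ), U 0 y = 0
  decay : ∀ t ∈ Ici (0 : ℝ), Tendsto (U t) atTop (𝓝 0)
  time : ∀ t > 0, ∀ y > 0, HasDerivAt (fun s => U s y) (U₁ t y) t
  space : ∀ t > 0, ∀ y > 0, HasDerivAt (fun x => U t x) (U₂ t y) y
  cont_time : ContinuousOn (fun p : ℝ × ℝ => U₁ p.1 p.2) (Ioi 0 ×ˢ Ioi 0)
  cont_space : ContinuousOn (fun p : ℝ × ℝ => U₂ p.1 p.2) (Ioi 0 ×ˢ Ioi 0)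
  memLp_time : ∀ T > 0, MemLp (fun p : ℝ × ℝ => U₁ p.1 p.2) 2
    (volume.restrict (Ioo 0 T ×ˢ Ioi 0))
  memLp_space : ∀ T > 0, MemLp (fun p : ℝ × ℝ => U₂ p.1 p.2) 2
    (volume.restrict (Ioo 0 T ×ˢ Ioi 0))

namespace HasLayerDeriv

variable {F : Type*} [NormedAddCommGroup F] [NormedSpace ℝ F] {U U₁ U₂ V V₁ V₂ : ℝ → ℝ → F}

theorem add (hU : HasLayerDeriv U U₁ U₂) (hV : HasLayerDeriv V V₁ V₂) :
    HasLayerDeriv (fun t y => U t y + V t y) (fun t y => U₁ t y + V₁ t y)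
      (fun t y => U₂ t y + V₂ t y) where
  cont := hU.cont.add hV.cont
  initial y hy := by rw [hU.initial y hy, hV.initial y hy, add_zero]
  decay t ht := by simpa using (hU.decay t ht).add (hV.decay t ht)
  time t ht y hy := (hU.time t ht y hy).add (hV.time t ht y hy)
  space t ht y hy := (hU.space t ht y hy).add (hV.space t ht y hy)
  cont_time := hU.cont_time.add hV.cont_time
  cont_space := hU.cont_space.add hV.cont_space
  memLp_time T hT := (hU.memLp_time T hT).add (hV.memLp_time T hT)
  memLp_space T hT := (hU.memLp_space T hT).add (hV.memLp_space T hT)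

theorem smul_const {D D₁ D₂ : ℝ → ℝ → ℝ} (hD : HasLayerDeriv D D₁ D₂) (p : F) :
    HasLayerDeriv (fun t y => D t y • p) (fun t y => D₁ t y • p) (fun t y => D₂ t y • p) where
  cont := hD.cont.smul continuousOn_const
  initial y hy := by rw [hD.initial y hy, zero_smul]
  decay t ht := by simpa using (hD.decay t ht).smul_const p
  time t ht y hy := (hD.time t ht y hy).smul_const p
  space t ht y hy := (hD.space t ht y hy).smul_const p
  cont_time := hD.cont_time.smul continuousOn_const
  cont_space := hD.cont_space.smul continuousOn_const
  memLp_time T hT :=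
    ((ContinuousLinearMap.toSpanSingleton ℝ p).comp_memLp' (hD.memLp_time T hT))
  memLp_space T hT :=
    ((ContinuousLinearMap.toSpanSingleton ℝ p).comp_memLp' (hD.memLp_space T hT))

section State

variable {m : ℕ} {U U₁ U₂ : ℝ → ℝ → State m}

theorem isLayerFunction (hU : HasLayerDeriv U U₁ U₂) : IsLayerFunction U where
  continuousOn := hU.cont
  contDiffOn := contDiffOn_one_of_hasDerivAt (isOpen_Ioi.prod isOpen_Ioi)
    (fun p hp => hU.time p.1 hp.1 p.2 hp.2) (fun p hp => hU.space p.1 hp.1 p.2 hp.2)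
    hU.cont_time hU.cont_space
  initial := hU.initial
  decay := hU.decay

theorem dTime_eq (hU : HasLayerDeriv U U₁ U₂) {t y : ℝ} (ht : 0 < t) (hy : 0 < y) :
    dTime U t y = U₁ t y := (hU.time t ht y hy).deriv

theorem dSpace_eq (hU : HasLayerDeriv U U₁ U₂) {t y : ℝ} (ht : 0 < t) (hy : 0 < y) :
    dSpace U t y = U₂ t y := (hU.space t ht y hy).deriv

theorem memLp_dTime (hU : HasLayerDeriv U U₁ U₂) {T : ℝ} (hT : 0 < T) :
    MemLp (fun p : ℝ × ℝ => dTime U p.1 p.2) 2 (volume.restrict (Ioo 0 T ×ˢ Ioi 0)) := by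
  refine (memLp_congr_ae ?_).1 (hU.memLp_time T hT)
  filter_upwards [ae_restrict_mem (measurableSet_Ioo.prod measurableSet_Ioi)] with p hp
  exact (hU.dTime_eq hp.1.1 hp.2).symm

theorem memLp_dSpace (hU : HasLayerDeriv U U₁ U₂) {T : ℝ} (hT : 0 < T) :
    MemLp (fun p : ℝ × ℝ => dSpace U p.1 p.2) 2 (volume.restrict (Ioo 0 T ×ˢ Ioi 0)) := by
  refine (memLp_congr_ae ?_).1 (hU.memLp_space T hT)
  filter_upwards [ae_restrict_mem (measurableSet_Ioo.prod measurableSet_Ioi)] with p hp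
  exact (hU.dSpace_eq hp.1.1 hp.2).symm

end State

end HasLayerDeriv

/-- `g` is continuous, vanishes at time zero, and has for positive times the continuous and locally
integrable derivative `g'`. -/
structure HasTimeDeriv (g g' : ℝ → ℝ) : Prop where
  cont : ContinuousOn g (Ici 0)
  initial : g 0 = 0
  deriv : ∀ t > 0, HasDerivAt g (g' t) t
  cont_deriv : ContinuousOn g' (Ioi 0)
  integrable : ∀ T > 0, IntegrableOn g' (Ioo 0 T)

/-! ### Layer potentials with `C¹` density -/

/-- The time derivative of the layer potential with density of derivative `g` and initial
value `a`. -/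
noncomputable def layerDeriv (k : ℝ → ℝ → ℝ) (g : ℝ → ℝ) (a t y : ℝ) : ℝ :=
  layerPotential k g t y + a * k t y

namespace GoodKernel

variable {k : ℝ → ℝ → ℝ}

theorem continuousOn_layerDeriv (hk : GoodKernel k) {g : ℝ → ℝ} (hg : Continuous g) (a : ℝ) :
    ContinuousOn (fun p : ℝ × ℝ => layerDeriv k g a p.1 p.2) (Ioi 0 ×ˢ Ici 0) :=
  ((hk.continuousOn_layerPotential hg).mono (prod_mono_left Ioi_subset_Ici_self)).add
    (continuousOn_const.mul hk.cont)

theorem memLp_layerDeriv (hk : GoodKernel k) {g : ℝ → ℝ} (hg : Continuous g) (a : ℝ) {T : ℝ}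
    (hT : 0 < T) : MemLp (fun p : ℝ × ℝ => layerDeriv k g a p.1 p.2) 2
      (volume.restrict (Ioo 0 T ×ˢ Ioi 0)) :=
  (hk.memLp_layerPotential hg hT).add ((hk.memLp hT).const_mul a)

theorem hasLayerDeriv (hk : GoodKernel k) {f g : ℝ → ℝ} {D : ℝ → ℝ → ℝ} (hf : Continuous f)
    (hg : Continuous g) (hfg : ∀ t, f t = f 0 + ∫ s in (0 : ℝ)..t, g s)
    (hD : ∀ t > 0, ∀ y > 0, HasDerivAt (layerPotential k f t) (D t y) y)
    (hDc : ContinuousOn (fun p : ℝ × ℝ => D p.1 p.2) (Ioi 0 ×ˢ Ioi 0))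
    (hDm : ∀ T > 0, MemLp (fun p : ℝ × ℝ => D p.1 p.2) 2
      (volume.restrict (Ioo 0 T ×ˢ Ioi 0))) :
    HasLayerDeriv (layerPotential k f) (layerDeriv k g (f 0)) D where
  cont := hk.continuousOn_layerPotential hf
  initial y _ := layerPotential_zero k f y
  decay _ ht := hk.tendsto_layerPotential hf ht
  time _ ht _ hy := hk.hasDerivAt_layerPotential_time hg hfg ht hy.le
  space := hD
  cont_time := (hk.continuousOn_layerDeriv hg _).mono (prod_mono_right Ioi_subset_Ici_self)
  cont_space := hDc
  memLp_time _ hT := hk.memLp_layerDeriv hg _ hT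
  memLp_space := hDm

theorem hasTimeDeriv (hk : GoodKernel k) {f g : ℝ → ℝ} (hf : Continuous f)
    (hg : Continuous g) (hfg : ∀ t, f t = f 0 + ∫ s in (0 : ℝ)..t, g s) {y : ℝ} (hy : 0 ≤ y) :
    HasTimeDeriv (fun t => layerPotential k f t y) (fun t => layerDeriv k g (f 0) t y) where
  cont := (hk.continuousOn_layerPotential hf).comp (f := fun t => (t, y)) (by fun_prop)
    fun _ ht => ⟨ht, hy⟩
  initial := layerPotential_zero k f y
  deriv t ht := hk.hasDerivAt_layerPotential_time hg hfg ht hy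
  cont_deriv := (hk.continuousOn_layerDeriv hg _).comp (f := fun t => (t, y)) (by fun_prop)
    fun _ ht => ⟨ht, hy⟩
  integrable T hT := by
    have h1 : ContinuousOn (fun t => layerPotential k g t y) (Icc 0 T) :=
      (hk.continuousOn_layerPotential hg).comp (f := fun t => (t, y)) (by fun_prop)
        fun _ ht => ⟨ht.1, hy⟩
    have h2 := (hk.intervalIntegrable hy hT.le).1.mono_set (Ioo_subset_Ioc_self)
    exact (h1.integrableOn_Icc.mono_set Ioo_subset_Icc_self).add (h2.const_mul (f 0))

end GoodKernel

theorem HasLayerDeriv.neg {F : Type*} [NormedAddCommGroup F] [NormedSpace ℝ F]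
    {U U₁ U₂ : ℝ → ℝ → F} (hU : HasLayerDeriv U U₁ U₂) :
    HasLayerDeriv (fun t y => -U t y) (fun t y => -U₁ t y) (fun t y => -U₂ t y) where
  cont := hU.cont.neg
  initial y hy := by rw [hU.initial y hy, neg_zero]
  decay t ht := by simpa using (hU.decay t ht).neg
  time t ht y hy := (hU.time t ht y hy).fun_neg
  space t ht y hy := (hU.space t ht y hy).fun_neg
  cont_time := hU.cont_time.neg
  cont_space := hU.cont_space.neg
  memLp_time T hT := (hU.memLp_time T hT).neg
  memLp_space T hT := (hU.memLp_space T hT).neg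

theorem HasTimeDeriv.neg {g g' : ℝ → ℝ} (h : HasTimeDeriv g g') :
    HasTimeDeriv (fun t => -g t) (fun t => -g' t) where
  cont := h.cont.neg
  initial := by rw [h.initial, neg_zero]
  deriv t ht := (h.deriv t ht).fun_neg
  cont_deriv := h.cont_deriv.neg
  integrable T hT := (h.integrable T hT).neg

/-- A `C¹` function on the half line is the integral of any continuous extension of its
derivative. -/
theorem eq_add_integral_of_contDiffOn {f g : ℝ → ℝ} (hf : ContDiffOn ℝ 1 f (Ici 0))
    (hg : Continuous g) (hfg : ∀ t ≥ 0, g t = derivWithin f (Ici 0) t) {t : ℝ} (ht : 0 ≤ t) :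
    f t = f 0 + ∫ s in (0 : ℝ)..t, g s := by
  rw [intervalIntegral.integral_eq_sub_of_hasDerivAt_of_le ht (f := f)
    (hf.continuousOn.mono Icc_subset_Ici_self) (fun x hx => ?_) (hg.intervalIntegrable 0 t)]
  · ring
  · have h1 : HasDerivWithinAt f (derivWithin f (Ici 0) x) (Ici 0) x :=
      (hf.differentiableOn one_ne_zero x hx.1.le).hasDerivWithinAt
    rw [← hfg x hx.1.le] at h1
    exact h1.hasDerivAt (Ici_mem_nhds hx.1)

/-- Continuous functions on the whole line that represent the derivatives of a `C³` function on
the half line which vanishes to second order at the origin. -/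
theorem exists_iterated_primitive {u : ℝ → ℝ} (hu : ContDiffOn ℝ 3 u (Ici 0)) (hu0 : u 0 = 0)
    (hu1 : derivWithin u (Ici 0) 0 = 0) :
    ∃ u₁ u₂ u₃ : ℝ → ℝ, Continuous u₃ ∧ (∀ t, u₂ t = u₂ 0 + ∫ s in (0 : ℝ)..t, u₃ s) ∧
      (∀ t, u₁ t = ∫ s in (0 : ℝ)..t, u₂ s) ∧ ∀ t ≥ 0, u t = ∫ s in (0 : ℝ)..t, u₁ s := by
  have huniq : UniqueDiffOn ℝ (Ici (0 : ℝ)) := uniqueDiffOn_Ici 0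
  have hd : ∀ {n : ℕ} {f : ℝ → ℝ}, ContDiffOn ℝ (n + 1 : ℕ) f (Ici 0) →
      ContDiffOn ℝ n (derivWithin f (Ici 0)) (Ici 0) := fun {n f} hf =>
    hf.derivWithin huniq (by norm_cast)
  set w₁ := derivWithin u (Ici 0) with hw₁
  set w₂ := derivWithin w₁ (Ici 0) with hw₂
  set w₃ := derivWithin w₂ (Ici 0) with hw₃
  have c₁ : ContDiffOn ℝ (2 : ℕ) w₁ (Ici 0) := hd (n := 2) hu
  have c₂ : ContDiffOn ℝ (1 : ℕ) w₂ (Ici 0) := hd (n := 1) c₁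
  have c₃ : ContDiffOn ℝ (0 : ℕ) w₃ (Ici 0) := hd (n := 0) c₂
  have hprim : ∀ {g : ℝ → ℝ} (a : ℝ), Continuous g → Continuous fun t => a + ∫ s in (0 : ℝ)..t, g s :=
    fun a hg => continuous_const.add
      (intervalIntegral.continuous_primitive (fun a b => hg.intervalIntegrable a b) 0)
  -- The third derivative is frozen for negative times, so that all densities become continuous on
  -- the whole line, as the potential lemmas require.
  set u₃ : ℝ → ℝ := fun t => w₃ (max t 0) with hu₃
  have k₃ : Continuous u₃ :=
    c₃.continuousOn.comp_continuous (by fun_prop) fun t => mem_Ici.2 (le_max_right _ _)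
  set u₂ : ℝ → ℝ := fun t => w₂ 0 + ∫ s in (0 : ℝ)..t, u₃ s with hu₂
  have e₂ : ∀ t ≥ 0, u₂ t = w₂ t := fun t ht =>
    (eq_add_integral_of_contDiffOn c₂ k₃ (fun s hs => by rw [hu₃, ← hw₃]; simp [max_eq_left hs])
      ht).symm
  have k₂ : Continuous u₂ := hprim _ k₃
  set u₁ : ℝ → ℝ := fun t => w₁ 0 + ∫ s in (0 : ℝ)..t, u₂ s with hu₁
  have e₁ : ∀ t ≥ 0, u₁ t = w₁ t := fun t ht =>
    (eq_add_integral_of_contDiffOn (c₁.of_le (by norm_num)) k₂ e₂ ht).symm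
  have k₁ : Continuous u₁ := hprim _ k₂
  refine ⟨u₁, u₂, u₃, k₃, fun t => by simp [hu₂], fun t => by simp [hu₁, hu1], fun t ht => ?_⟩
  rw [eq_add_integral_of_contDiffOn (hu.of_le (by norm_num)) k₁ e₁ ht, hu0, zero_add]

/-- The solution `D₀` of the heat equation on the half line with boundary value `u` and initial
value zero, its iterated space derivatives `D₁, …, D₅`, and the functions `Fⱼ = y Dⱼ`. -/
theorem exists_heat_hierarchy {u : ℝ → ℝ} (hu : ContDiffOn ℝ 3 u (Ici 0)) (hu0 : u 0 = 0)
    (hu1 : derivWithin u (Ici 0) 0 = 0) :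
    ∃ D₀ D₁ D₂ D₃ D₄ D₅ F₃ F₄ F₅ F₆ : ℝ → ℝ → ℝ,
      HasLayerDeriv D₀ D₂ D₁ ∧ HasLayerDeriv D₁ D₃ D₂ ∧ HasLayerDeriv D₂ D₄ D₃ ∧
      HasLayerDeriv D₃ D₅ D₄ ∧ HasLayerDeriv F₃ F₅ (fun t y => D₃ t y + F₄ t y) ∧
      HasLayerDeriv F₄ F₆ (fun t y => D₄ t y + F₅ t y) ∧
      (∀ t ≥ 0, D₀ t 0 = u t) ∧ (∀ t, F₃ t 0 = 0) ∧
      HasTimeDeriv (fun t => D₁ t 0) (fun t => D₃ t 0) ∧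
      HasTimeDeriv (fun t => D₂ t 0) (fun t => D₄ t 0) ∧
      HasTimeDeriv (fun t => D₃ t 0) (fun t => D₅ t 0) := by
  obtain ⟨u₁, u₂, u₃, k₃, h₂, h₁, h₀⟩ := exists_iterated_primitive hu hu0 hu1
  have d₂ : ∀ t, HasDerivAt u₂ (u₃ t) t := fun t => by
    rw [funext h₂]
    exact (intervalIntegral.integral_hasDerivAt_right (k₃.intervalIntegrable 0 t)
      k₃.aestronglyMeasurable.stronglyMeasurableAtFilter k₃.continuousAt).const_add _
  have k₂ : Continuous u₂ := continuous_iff_continuousAt.2 fun t => (d₂ t).continuousAt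
  have d₁ : ∀ t, HasDerivAt u₁ (u₂ t) t := fun t => by
    rw [funext h₁]
    exact intervalIntegral.integral_hasDerivAt_right (k₂.intervalIntegrable 0 t)
      k₂.aestronglyMeasurable.stronglyMeasurableAtFilter k₂.continuousAt
  have k₁ : Continuous u₁ := continuous_iff_continuousAt.2 fun t => (d₁ t).continuousAt
  have z₁ : u₁ 0 = 0 := by rw [h₁]; simp
  have h₁' : ∀ t, u₁ t = u₁ 0 + ∫ s in (0 : ℝ)..t, u₂ s := fun t => by rw [z₁, zero_add, h₁]
  -- `u'(0) = 0` removes the kernel term at this level; one level higher `a = u''(0)` may be nonzero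
  -- and the term stays.
  have hz : ∀ k, layerDeriv k u₂ (u₁ 0) = layerPotential k u₂ := fun k => by
    funext t y; simp [layerDeriv, z₁]
  have hz' : ∀ k t y, layerDeriv k u₂ (u₁ 0) t y = layerPotential k u₂ t y := fun k t y => by
    rw [hz]
  set a := u₂ 0 with ha
  have hsub : (Ioi (0 : ℝ) ×ˢ Ioi (0 : ℝ)) ⊆ Ici 0 ×ˢ Ici 0 :=
    prod_mono Ioi_subset_Ici_self Ioi_subset_Ici_self
  have hsub' : (Ioi (0 : ℝ) ×ˢ Ioi (0 : ℝ)) ⊆ Ioi 0 ×ˢ Ici 0 :=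
    prod_mono_right Ioi_subset_Ici_self
  have gE := goodKernel_heatE
  have gG := goodKernel_heatG
  have gYG := goodKernel_heatYG
  have gYH := goodKernel_heatYH
  -- Two forms of `y D₄`: the left one is a potential of a good kernel, hence continuous down to `t
  -- = 0` and differentiable in time; the right one can be differentiated in `y`.
  have eF : ∀ t > 0, ∀ y > 0,
      layerPotential heatYH u₂ t y = y * layerDeriv heatE u₃ a t y := fun t ht y hy => by
    rw [layerPotential_heatYH, layerPotential_heatH d₂ k₃ ht hy, layerDeriv]
  have eYG : ∀ t y, layerDeriv heatYG u₃ a t y = y * layerDeriv heatG u₃ a t y := fun t y => by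
    rw [layerDeriv, layerDeriv, layerPotential_heatYG, heatYG]; ring
  have dE : ∀ t > 0, ∀ y > 0, HasDerivAt (layerDeriv heatE u₃ a t)
      (-layerDeriv heatG u₃ a t y) y := fun t ht y hy =>
    ((hasDerivAt_layerPotential_heatE k₃ ht.le hy).add
      ((hasDerivAt_heatE_space ht y).const_mul a)).congr_deriv (by rw [layerDeriv]; ring)
  have dG : ∀ t > 0, ∀ y > 0, HasDerivAt (layerPotential heatG u₂ t)
      (-layerDeriv heatE u₃ a t y) y := fun t ht y hy =>
    hasDerivAt_layerPotential_heatG d₂ k₃ ht hy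
  have L₀ : HasLayerDeriv (layerPotential heatE u₁) (layerPotential heatE u₂)
      (fun t y => -layerPotential heatG u₁ t y) := by
    rw [← hz]
    exact gE.hasLayerDeriv k₁ k₂ h₁'
      (fun t ht y hy => hasDerivAt_layerPotential_heatE k₁ ht.le hy)
      ((gG.continuousOn_layerPotential k₁).mono hsub).neg
      fun T hT => (gG.memLp_layerPotential k₁ hT).neg
  have L₁ : HasLayerDeriv (layerPotential heatG u₁) (layerPotential heatG u₂)
      (fun t y => -layerPotential heatE u₂ t y) := by
    rw [← hz]
    refine gG.hasLayerDeriv k₁ k₂ h₁' (fun t ht y hy => ?_)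
      ((gE.continuousOn_layerPotential k₂).mono hsub).neg
      fun T hT => (gE.memLp_layerPotential k₂ hT).neg
    have := hasDerivAt_layerPotential_heatG d₁ k₂ ht hy
    rwa [z₁, zero_mul, add_zero] at this
  have L₂ : HasLayerDeriv (layerPotential heatE u₂) (layerDeriv heatE u₃ a)
      (fun t y => -layerPotential heatG u₂ t y) :=
    gE.hasLayerDeriv k₂ k₃ h₂
      (fun t ht y hy => hasDerivAt_layerPotential_heatE k₂ ht.le hy)
      ((gG.continuousOn_layerPotential k₂).mono hsub).neg
      fun T hT => (gG.memLp_layerPotential k₂ hT).neg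
  have L₃ : HasLayerDeriv (layerPotential heatG u₂) (layerDeriv heatG u₃ a)
      (fun t y => -layerDeriv heatE u₃ a t y) :=
    gG.hasLayerDeriv k₂ k₃ h₂ dG
      ((gE.continuousOn_layerDeriv k₃ a).mono hsub').neg
      fun T hT => (gE.memLp_layerDeriv k₃ a hT).neg
  have M₃ : HasLayerDeriv (layerPotential heatYG u₂) (layerDeriv heatYG u₃ a)
      (fun t y => layerPotential heatG u₂ t y - layerPotential heatYH u₂ t y) := by
    refine gYG.hasLayerDeriv k₂ k₃ h₂ (fun t ht y hy => ?_)
      (((gG.continuousOn_layerPotential k₂).sub (gYH.continuousOn_layerPotential k₂)).mono hsub)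
      fun T hT => (gG.memLp_layerPotential k₂ hT).sub (gYH.memLp_layerPotential k₂ hT)
    rw [funext (layerPotential_heatYG u₂ t), eF t ht y hy]
    refine ((hasDerivAt_id y).mul (dG t ht y hy)).congr_deriv ?_
    simp only [id]
    ring
  have M₄ : HasLayerDeriv (layerPotential heatYH u₂) (layerDeriv heatYH u₃ a)
      (fun t y => layerDeriv heatE u₃ a t y - layerDeriv heatYG u₃ a t y) := by
    refine gYH.hasLayerDeriv k₂ k₃ h₂ (fun t ht y hy => ?_)
      (((gE.continuousOn_layerDeriv k₃ a).sub (gYG.continuousOn_layerDeriv k₃ a)).mono hsub')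
      fun T hT => (gE.memLp_layerDeriv k₃ a hT).sub (gYG.memLp_layerDeriv k₃ a hT)
    refine (((hasDerivAt_id y).mul (dE t ht y hy)).congr_deriv ?_).congr_of_eventuallyEq ?_
    · rw [eYG]
      simp only [id]
      ring
    · filter_upwards [Ioi_mem_nhds hy] with x hx
      exact eF t ht x hx
  -- Since `heatE` is the time primitive of the double layer kernel, convolving it with `u'` gives
  -- the Dirichlet solution with data `u`. The odd `Dⱼ` carry a minus sign because the space
  -- derivative of `heatE` is `-heatG`.
  refine ⟨layerPotential heatE u₁, fun t y => -layerPotential heatG u₁ t y,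
    layerPotential heatE u₂, fun t y => -layerPotential heatG u₂ t y,
    layerDeriv heatE u₃ a, fun t y => -layerDeriv heatG u₃ a t y,
    fun t y => -layerPotential heatYG u₂ t y, layerPotential heatYH u₂,
    fun t y => -layerDeriv heatYG u₃ a t y, layerDeriv heatYH u₃ a,
    L₀, ?_, L₂, ?_, ?_, ?_, ?_, ?_, ?_, gE.hasTimeDeriv k₂ k₃ h₂ le_rfl,
    (gG.hasTimeDeriv k₂ k₃ h₂ le_rfl).neg⟩
  · simpa only [neg_neg] using L₁.neg
  · simpa only [neg_neg] using L₃.neg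
  · convert! M₃.neg using 3
    ring
  · convert! M₄ using 3
  · intro t ht
    rw [h₀ t ht, layerPotential]
    simp only [heatE_zero_right, one_mul]
    rw [intervalIntegral.integral_comp_sub_left (fun s => u₁ s) t]
    simp
  · intro t
    simp [layerPotential_heatYG]
  · have := (gG.hasTimeDeriv k₁ k₂ h₁' le_rfl).neg
    simpa only [hz'] using this

/-! ### The moment matrices -/

section Matrices

variable {m : ℕ}

theorem Ac_mulVec (x : Fin (m + 1) ⊕ Fin (m + 1) → ℝ) :
    Ac m *ᵥ x = Sum.elim (Mc m *ᵥ (x ∘ Sum.inr)) ((Mc m)ᵀ *ᵥ (x ∘ Sum.inl)) := by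
  simp [Ac, Matrix.fromBlocks_mulVec]

theorem Qc_mulVec (x : Fin (m + 1) ⊕ Fin (m + 1) → ℝ) (i : Fin (m + 1) ⊕ Fin (m + 1)) :
    (Qc m *ᵥ x) i = if i = Sum.inl 0 then 0 else x i := by
  simp [Qc, Matrix.mulVec_diagonal]

theorem Bc_mulVec (χ : ℝ) (S : Matrix (Fin (m + 1)) (Fin (m + 1)) ℝ)
    (x : Fin (m + 1) ⊕ Fin (m + 1) → ℝ) :
    Bc χ S *ᵥ x = chiHat χ • (S *ᵥ (x ∘ Sum.inl)) + Mc m *ᵥ (x ∘ Sum.inr) := by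
  rw [Bc, Matrix.fromCols_mulVec, Matrix.smul_mulVec]

theorem chiHat_pos {χ : ℝ} (h0 : 0 < χ) (h1 : χ ≤ 1) : 0 < chiHat χ := by
  have : 0 < 2 - χ := by linarith
  unfold chiHat
  positivity

/-- Lower triangular with positive diagonal. Hence `A_c` is invertible, and at the wall the odd
moments are determined by the even moments and the boundary data. -/
theorem isUnit_det_Mc (m : ℕ) : IsUnit (Mc m).det := by
  have h : (Mc m).BlockTriangular OrderDual.toDual := by
    intro i j hij
    have hij : i < j := hij
    have h1 : j ≠ i := hij.ne'
    have h2 : ¬ (j : ℕ) + 1 = (i : ℕ) := by have : (i : ℕ) < j := hij; omega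
    simp [Mc, h1, h2]
  rw [Matrix.det_of_isLowerTriangular _ h, isUnit_iff_ne_zero, Finset.prod_ne_zero_iff]
  intro i _
  simp only [Mc, Matrix.of_apply, if_true]
  positivity

theorem Mc_mulVec_zero (x : Fin (m + 1) → ℝ) : (Mc m *ᵥ x) 0 = x 0 := by
  rw [Matrix.mulVec, dotProduct, Finset.sum_eq_single 0]
  · simp [Mc]
  · intro j _ hj
    simp [Mc, hj]
  · simp

theorem Ac_transpose (m : ℕ) : (Ac m)ᵀ = Ac m := by
  simp [Ac, Matrix.fromBlocks_transpose]

theorem Qc_transpose (m : ℕ) : (Qc m)ᵀ = Qc m := Matrix.diagonal_transpose _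

/-- The first row of `M_c` is `(1, 0, …, 0)`: only the stress drives the velocity. This makes the
viscous hierarchy close to scalar heat equations. -/
theorem Ac_mulVec_inl_zero (x : Fin (m + 1) ⊕ Fin (m + 1) → ℝ) :
    (Ac m *ᵥ x) (Sum.inl 0) = x (Sum.inr 0) := by
  rw [Ac_mulVec]
  exact Mc_mulVec_zero _

theorem Ac_mulVec_eq_zero {x : Fin (m + 1) ⊕ Fin (m + 1) → ℝ} (h : Ac m *ᵥ x = 0) : x = 0 := by
  rw [Ac_mulVec] at h
  have h1 : Mc m *ᵥ (x ∘ Sum.inr) = 0 := by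
    funext i; exact congrFun h (Sum.inl i)
  have h2 : (Mc m)ᵀ *ᵥ (x ∘ Sum.inl) = 0 := by
    funext i; exact congrFun h (Sum.inr i)
  have hM := (isUnit_det_Mc m).ne_zero
  have h3 := Matrix.eq_zero_of_mulVec_eq_zero hM h1
  have h4 := Matrix.eq_zero_of_mulVec_eq_zero (by rwa [Matrix.det_transpose]) h2
  funext i
  rcases i with i | i
  · exact congrFun h4 i
  · exact congrFun h3 i

/-- The unit vector of the velocity component. -/
noncomputable def velocityVec (m : ℕ) : Fin (m + 1) ⊕ Fin (m + 1) → ℝ := Pi.single (Sum.inl 0) 1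

theorem Ac_mulVec_velocityVec (m : ℕ) :
    Ac m *ᵥ velocityVec m = Pi.single (Sum.inr 0) 1 := by
  rw [velocityVec, Matrix.mulVec_single_one]
  funext i
  rcases i with i | i
  · simp [Ac]
  · by_cases hi : i = 0
    · subst hi; simp [Ac, Mc]
    · simp [Ac, Mc, hi]

theorem Qc_mulVec_velocityVec (m : ℕ) : Qc m *ᵥ velocityVec m = 0 := by
  funext i
  rw [Qc_mulVec]
  split_ifs with h
  · rfl
  · simp [velocityVec, h]

theorem eq_Qc_mulVec_add (x : Fin (m + 1) ⊕ Fin (m + 1) → ℝ) :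
    x = Qc m *ᵥ x + x (Sum.inl 0) • velocityVec m := by
  funext i
  rw [Pi.add_apply, Qc_mulVec]
  split_ifs with h
  · subst h; simp [velocityVec]
  · simp [velocityVec, h]

theorem Qc_mulVec_of_inl_zero {x : Fin (m + 1) ⊕ Fin (m + 1) → ℝ} (h : x (Sum.inl 0) = 0) :
    Qc m *ᵥ x = x := by
  conv_rhs => rw [eq_Qc_mulVec_add x, h, zero_smul, add_zero]

theorem dotProduct_Qc_mulVec (x : Fin (m + 1) ⊕ Fin (m + 1) → ℝ) :
    x ⬝ᵥ Qc m *ᵥ x = (Qc m *ᵥ x) ⬝ᵥ (Qc m *ᵥ x) := by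
  unfold dotProduct
  refine Finset.sum_congr rfl fun i _ => ?_
  rw [Qc_mulVec]
  split_ifs <;> ring

/-! ### Decaying modes of the Knudsen layer -/

/-- Modes `exp (-γ z) k` with `γ A_c k = Q_c k`, `γ > 0`, together with the velocity, attain every
boundary value. -/
theorem exists_modes {χ : ℝ} (h0 : 0 < χ) (h1 : χ ≤ 1) {S : Matrix (Fin (m + 1)) (Fin (m + 1)) ℝ}
    (hS : S.PosDef) (r : Fin (m + 1) → ℝ) :
    ∃ (v : ℝ) (γ : Fin (m + 1) → ℝ) (k : Fin (m + 1) → Fin (m + 1) ⊕ Fin (m + 1) → ℝ),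
      (∀ i, 0 < γ i) ∧ (∀ i, γ i • (Ac m *ᵥ k i) = Qc m *ᵥ k i) ∧
      Bc χ S *ᵥ (v • velocityVec m + ∑ i, k i) = r := by
  set M := Mc m with hM
  set N := M⁻¹ with hN
  have hMN : M * N = 1 := Matrix.mul_nonsing_inv _ (isUnit_det_Mc m)
  have hNM : N * M = 1 := Matrix.nonsing_inv_mul _ (isUnit_det_Mc m)
  have hMNt : Mᵀ * Nᵀ = 1 := by rw [← Matrix.transpose_mul, hNM, Matrix.transpose_one]
  set P : Matrix (Fin (m + 1)) (Fin (m + 1)) ℝ := Matrix.diagonal fun i => if i = 0 then 0 else 1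
    with hP
  have hPpsd : P.PosSemidef := Matrix.PosSemidef.diagonal fun i => by
    simp only [Pi.zero_apply]; split_ifs <;> norm_num
  -- For `k = (a, b)` the mode equation reads `γ M b = P a`, `b = γ Mᵀ a`. With `x = Mᵀ a` it
  -- becomes `N P Nᵀ x = γ² x`, so decay rates are square roots of eigenvalues of a positive
  -- semidefinite matrix.
  have hC : (N * P * Nᵀ).PosSemidef := by
    have := hPpsd.mul_mul_conjTranspose_same N
    rwa [Matrix.conjTranspose_eq_transpose_of_trivial] at this
  set C := N * P * Nᵀ with hCdef
  set x : Fin (m + 1) → Fin (m + 1) → ℝ := fun i => (hC.1.eigenvectorBasis i).ofLp with hx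
  set μ : Fin (m + 1) → ℝ := hC.1.eigenvalues with hμ
  have hμ0 : ∀ i, 0 ≤ μ i := hC.eigenvalues_nonneg
  have hCx : ∀ i, C *ᵥ x i = μ i • x i := fun i => hC.1.mulVec_eigenvectorBasis i
  have hPN : ∀ i, P *ᵥ (Nᵀ *ᵥ x i) = μ i • (M *ᵥ x i) := by
    intro i
    have h2 : M *ᵥ (C *ᵥ x i) = M *ᵥ (μ i • x i) := by rw [hCx]
    rwa [hCdef, Matrix.mulVec_mulVec, ← Matrix.mul_assoc, ← Matrix.mul_assoc, hMN, Matrix.one_mul,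
      Matrix.mulVec_smul, ← Matrix.mulVec_mulVec] at h2
  have horth : ∀ a : Fin (m + 1) → ℝ, ∀ b : Fin (m + 1) → ℝ,
      (∑ i, a i • x i) ⬝ᵥ (∑ i, b i • x i) = ∑ i, a i * b i := by
    intro a b
    have h2 := hC.1.eigenvectorBasis.orthonormal.inner_sum a b Finset.univ
    rw [EuclideanSpace.inner_eq_star_dotProduct] at h2
    simp only [WithLp.ofLp_sum, WithLp.ofLp_smul, star_trivial] at h2
    rw [dotProduct_comm]
    simpa using h2
  set κ : Fin (m + 1) → Fin (m + 1) ⊕ Fin (m + 1) → ℝ := fun i =>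
    Sum.elim (Nᵀ *ᵥ x i) (√(μ i) • x i) with hκ
  have hmode : ∀ i, √(μ i) • (Ac m *ᵥ κ i) = Qc m *ᵥ κ i := by
    intro i
    have hs := Real.mul_self_sqrt (hμ0 i)
    have hinl : (κ i) ∘ Sum.inl = Nᵀ *ᵥ x i := rfl
    have hinr : (κ i) ∘ Sum.inr = √(μ i) • x i := rfl
    rw [Ac_mulVec, hinl, hinr, Matrix.mulVec_mulVec, ← hM, hMNt, Matrix.one_mulVec,
      Matrix.mulVec_smul]
    funext j
    rw [Qc_mulVec]
    rcases j with j | j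
    · have h2 := congrFun (hPN i) j
      rw [hP, Matrix.mulVec_diagonal] at h2
      simp only [Pi.smul_apply, Sum.elim_inl, smul_eq_mul, Sum.inl.injEq, hκ] at h2 ⊢
      rw [← mul_assoc, hs, ← h2]
      split_ifs <;> simp
    · simp [hκ]
  -- Null eigenvectors yield no decaying mode; they give multiples of the velocity, which supply the
  -- missing boundary direction.
  have hzero : ∀ i, μ i = 0 → κ i = (κ i (Sum.inl 0)) • velocityVec m := by
    intro i hi
    have h2 := hmode i
    rw [hi, Real.sqrt_zero, zero_smul] at h2
    conv_lhs => rw [eq_Qc_mulVec_add (κ i), ← h2, zero_add]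
  set L : (Fin (m + 1) → ℝ) →ₗ[ℝ] (Fin (m + 1) → ℝ) :=
    (Bc χ S).mulVecLin ∘ₗ Fintype.linearCombination ℝ κ with hL
  have hLa : ∀ a, L a = Bc χ S *ᵥ (∑ i, a i • κ i) := fun a => by
    simp [hL, Fintype.linearCombination_apply, Matrix.mulVec_sum, Matrix.mulVec_smul]
  -- The system is square, so injectivity suffices. Testing `B k = 0` with the even part `w` turns
  -- the odd part into `∑ aᵢ² √μᵢ ≥ 0` by orthonormality, and positivity of `S` forces `w = 0`.
  have hinj : Function.Injective L := by
    rw [← LinearMap.ker_eq_bot, LinearMap.ker_eq_bot']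
    intro a ha
    rw [hLa, Bc_mulVec] at ha
    have hinl : (∑ i, a i • κ i) ∘ Sum.inl = Nᵀ *ᵥ (∑ i, a i • x i) := by
      funext j
      simp [hκ, Matrix.mulVec_sum, Matrix.mulVec_smul, Finset.sum_apply]
    have hinr : (∑ i, a i • κ i) ∘ Sum.inr = ∑ i, (a i * √(μ i)) • x i := by
      funext j
      simp [hκ, Finset.sum_apply, mul_assoc]
    rw [hinl, hinr] at ha
    set X := ∑ i, a i • x i with hX
    set w := Nᵀ *ᵥ X with hw
    have hMw : Mᵀ *ᵥ w = X := by
      rw [hw, Matrix.mulVec_mulVec, hMNt, Matrix.one_mulVec]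
    have h2 : chiHat χ * (w ⬝ᵥ S *ᵥ w) + ∑ i, a i * (a i * √(μ i)) = 0 := by
      have h3 : w ⬝ᵥ (chiHat χ • S *ᵥ w + M *ᵥ ∑ i, (a i * √(μ i)) • x i) = 0 := by
        rw [ha, dotProduct_zero]
      rwa [dotProduct_add, dotProduct_smul, smul_eq_mul, Matrix.dotProduct_mulVec w M,
        ← Matrix.mulVec_transpose, hMw, horth] at h3
    have h4 : 0 ≤ ∑ i, a i * (a i * √(μ i)) := Finset.sum_nonneg fun i _ => by
      rw [← mul_assoc]; exact mul_nonneg (mul_self_nonneg _) (Real.sqrt_nonneg _)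
    have hw0 : w = 0 := by
      by_contra hne
      have h5 := hS.dotProduct_mulVec_pos hne
      rw [star_trivial] at h5
      have := mul_pos (chiHat_pos h0 h1) h5
      linarith
    have hX0 : X = 0 := by rw [← hMw, hw0, Matrix.mulVec_zero]
    have h6 := horth a a
    rw [← hX, hX0, dotProduct_zero] at h6
    funext i
    have h7 := (Finset.sum_eq_zero_iff_of_nonneg (fun i _ => mul_self_nonneg (a i))).1 h6.symm i
      (Finset.mem_univ i)
    exact mul_self_eq_zero.1 h7
  obtain ⟨a, ha⟩ := (LinearMap.injective_iff_surjective.1 hinj) r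
  rw [hLa] at ha
  -- Null modes are collected in `v`; their slots keep the zero vector, with the arbitrary positive
  -- rate `1`.
  refine ⟨∑ i, if μ i = 0 then a i * κ i (Sum.inl 0) else 0,
    fun i => if μ i = 0 then 1 else √(μ i), fun i => if μ i = 0 then 0 else a i • κ i,
    fun i => ?_, fun i => ?_, ?_⟩
  · by_cases h : μ i = 0
    · simp [h]
    · simp only [h, if_false]
      exact Real.sqrt_pos.2 (lt_of_le_of_ne (hμ0 i) (Ne.symm h))
  · by_cases h : μ i = 0
    · simp [h]
    · simp only [h, if_false]
      rw [Matrix.mulVec_smul, smul_comm, hmode, Matrix.mulVec_smul]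
  · rw [← ha]
    congr 1
    rw [Finset.sum_smul, ← Finset.sum_add_distrib]
    refine Finset.sum_congr rfl fun i _ => ?_
    by_cases h : μ i = 0
    · simp only [h, if_true, add_zero]
      conv_rhs => rw [hzero i h]
      rw [smul_smul]
    · simp [h]

/-- The resonant inhomogeneous problem for one mode. -/
theorem exists_resonant_solution {γ : ℝ} (hγ : 0 < γ) (k : Fin (m + 1) ⊕ Fin (m + 1) → ℝ) :
    ∃ p q : Fin (m + 1) ⊕ Fin (m + 1) → ℝ, γ • (Ac m *ᵥ p) = Qc m *ᵥ p ∧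
      Ac m *ᵥ p + (Qc m *ᵥ q - γ • (Ac m *ᵥ q)) = k := by
  set Z := Qc m - γ • Ac m with hZ
  have hZx : ∀ x, Z *ᵥ x = Qc m *ᵥ x - γ • (Ac m *ᵥ x) := fun x => by
    rw [hZ, Matrix.sub_mulVec, Matrix.smul_mulVec]
  have hZt : Zᵀ = Z := by
    rw [hZ, Matrix.transpose_sub, Matrix.transpose_smul, Ac_transpose, Qc_transpose]
  set f : (State m × State m) →ₗ[ℝ] State m :=
    (Matrix.toEuclideanLin (Ac m)) ∘ₗ LinearMap.fst ℝ _ _ +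
      (Matrix.toEuclideanLin Z) ∘ₗ LinearMap.snd ℝ _ _ with hf
  -- The pairs `(p, q)` with `Z p = 0`: the ansatz `(z p + q) exp (-γ z)` cancels its `z exp (-γ z)`
  -- term exactly for these.
  set U : Submodule ℝ (State m × State m) :=
    (LinearMap.ker (Matrix.toEuclideanLin Z)).prod ⊤ with hU
  -- A vector `w` orthogonal to the image lies in `ker Z` by symmetry and, taking `p = w`, satisfies
  -- `w · A w = 0`. Then `|Q w|² = γ w · A w = 0`, so `A w = 0` and `w = 0`.
  have htop : U.map f = ⊤ := by
    rw [← Submodule.orthogonal_eq_bot_iff, Submodule.eq_bot_iff]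
    intro w hw
    have hin : ∀ a b : State m, inner ℝ a b = b.ofLp ⬝ᵥ a.ofLp := fun a b => by
      rw [EuclideanSpace.inner_eq_star_dotProduct, star_trivial]
    have h1 : ∀ p q : State m, Z *ᵥ p.ofLp = 0 →
        w.ofLp ⬝ᵥ (Ac m *ᵥ p.ofLp + Z *ᵥ q.ofLp) = 0 := by
      intro p q hp
      have h2 := (Submodule.mem_orthogonal _ _).1 hw (f (p, q))
        (Submodule.mem_map_of_mem (by
          refine ⟨?_, trivial⟩
          rw [SetLike.mem_coe, LinearMap.mem_ker]
          ext i
          simpa using congrFun hp i))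
      rw [hin] at h2
      simpa [hf] using h2
    have h3 : Z *ᵥ w.ofLp = 0 := by
      have h4 := h1 0 (WithLp.toLp 2 (Z *ᵥ w.ofLp)) (by simp)
      simp only [WithLp.ofLp_zero, Matrix.mulVec_zero, zero_add] at h4
      rw [Matrix.dotProduct_mulVec, ← Matrix.mulVec_transpose, hZt] at h4
      exact dotProduct_self_eq_zero.1 h4
    have h5 := h1 w 0 h3
    simp only [WithLp.ofLp_zero, Matrix.mulVec_zero, add_zero] at h5
    rw [hZx, sub_eq_zero] at h3
    have h6 : (Qc m *ᵥ w.ofLp) ⬝ᵥ (Qc m *ᵥ w.ofLp) = 0 := by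
      rw [← dotProduct_Qc_mulVec, h3, dotProduct_smul, h5, smul_zero]
    have h7 := dotProduct_self_eq_zero.1 h6
    rw [h7] at h3
    have h8 : Ac m *ᵥ w.ofLp = 0 := (smul_eq_zero.1 h3.symm).resolve_left hγ.ne'
    have h9 := Ac_mulVec_eq_zero h8
    ext i
    exact congrFun h9 i
  have hk : WithLp.toLp 2 k ∈ U.map f := by rw [htop]; trivial
  obtain ⟨⟨p, q⟩, ⟨hp, -⟩, hpq⟩ := hk
  refine ⟨p.ofLp, q.ofLp, ?_, ?_⟩
  · rw [SetLike.mem_coe, LinearMap.mem_ker] at hp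
    have h2 : Z *ᵥ p.ofLp = 0 := by
      funext i
      simpa using congrFun (congrArg WithLp.ofLp hp) i
    rw [hZx, sub_eq_zero] at h2
    exact h2.symm
  · have h2 := congrArg WithLp.ofLp hpq
    rw [← hZx]
    simpa [hf] using h2

end Matrices

/-! ### Knudsen layer profiles -/

/-- `κ` is a `C¹` profile with derivative `κ'` that vanishes at infinity and is square
integrable on the half line. -/
structure HasProfileDeriv {F : Type*} [NormedAddCommGroup F] [NormedSpace ℝ F]
    (κ κ' : ℝ → F) : Prop where
  deriv : ∀ z, HasDerivAt κ (κ' z) z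
  cont_deriv : Continuous κ'
  decay : Tendsto κ atTop (𝓝 0)
  memLp : MemLp κ 2 (volume.restrict (Ioi 0))

namespace HasProfileDeriv

section

variable {F : Type*} [NormedAddCommGroup F] [NormedSpace ℝ F] {κ κ' ρ ρ' : ℝ → F}

theorem add (h : HasProfileDeriv κ κ') (h' : HasProfileDeriv ρ ρ') :
    HasProfileDeriv (fun z => κ z + ρ z) (fun z => κ' z + ρ' z) where
  deriv z := (h.deriv z).add (h'.deriv z)
  cont_deriv := h.cont_deriv.add h'.cont_deriv
  decay := by simpa using h.decay.add h'.decay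
  memLp := h.memLp.add h'.memLp

theorem zero : HasProfileDeriv (fun _ => 0 : ℝ → F) (fun _ => 0) where
  deriv z := hasDerivAt_const z 0
  cont_deriv := continuous_const
  decay := tendsto_const_nhds
  memLp := MemLp.zero

theorem sum {ι : Type*} (s : Finset ι) {κ κ' : ι → ℝ → F} (h : ∀ i, HasProfileDeriv (κ i) (κ' i)) :
    HasProfileDeriv (fun z => ∑ i ∈ s, κ i z) (fun z => ∑ i ∈ s, κ' i z) := by
  classical
  induction s using Finset.induction_on with
  | empty => simpa using zero
  | insert i s hi ih =>
    simp only [Finset.sum_insert hi]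
    exact (h i).add ih

theorem smul_const {κ κ' : ℝ → ℝ} (h : HasProfileDeriv κ κ') (p : F) :
    HasProfileDeriv (fun z => κ z • p) (fun z => κ' z • p) where
  deriv z := (h.deriv z).smul_const p
  cont_deriv := h.cont_deriv.smul continuous_const
  decay := by simpa using h.decay.smul_const p
  memLp := (ContinuousLinearMap.toSpanSingleton ℝ p).comp_memLp' h.memLp

end

theorem exp_neg {γ : ℝ} (hγ : 0 < γ) :
    HasProfileDeriv (fun z => Real.exp (-γ * z)) (fun z => Real.exp (-γ * z) * (-γ)) where
  deriv z := by simpa using ((hasDerivAt_id z).const_mul (-γ)).exp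
  cont_deriv := by fun_prop
  decay := Real.tendsto_exp_atBot.comp (tendsto_id.const_mul_atTop_of_neg (by linarith))
  memLp := by
    rw [memLp_two_iff_integrable_sq (by fun_prop)]
    have h := exp_neg_integrableOn_Ioi 0 (b := 2 * γ) (by positivity)
    refine h.congr (Eventually.of_forall fun z => ?_)
    simp only
    rw [sq, ← Real.exp_add]
    congr 1
    ring

/-- The factor `z` is traded for half of the decay rate. -/
theorem mul_exp_neg_bound {γ : ℝ} (hγ : 0 < γ) (z : ℝ) :
    z * Real.exp (-γ * z) ≤ 2 / γ * Real.exp (-(γ / 2) * z) := by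
  have h1 := mul_exp_neg_le_one (x := γ / 2 * z)
  have h2 : Real.exp (-γ * z) = Real.exp (-(γ / 2 * z)) * Real.exp (-(γ / 2) * z) := by
    rw [← Real.exp_add]; congr 1; ring
  rw [h2]
  calc z * (Real.exp (-(γ / 2 * z)) * Real.exp (-(γ / 2) * z))
      = 2 / γ * (γ / 2 * z * Real.exp (-(γ / 2 * z))) * Real.exp (-(γ / 2) * z) := by
        field_simp
    _ ≤ 2 / γ * 1 * Real.exp (-(γ / 2) * z) := by gcongr
    _ = _ := by ring

theorem mul_exp_neg {γ : ℝ} (hγ : 0 < γ) :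
    HasProfileDeriv (fun z => z * Real.exp (-γ * z))
      (fun z => Real.exp (-γ * z) + z * (Real.exp (-γ * z) * (-γ))) where
  deriv z := by simpa using (hasDerivAt_id z).fun_mul ((exp_neg hγ).deriv z)
  cont_deriv := by fun_prop
  decay := by
    have h := ((exp_neg (half_pos hγ)).decay).const_mul (2 / γ)
    rw [mul_zero] at h
    refine squeeze_zero' ?_ (Eventually.of_forall (mul_exp_neg_bound hγ)) h
    filter_upwards [eventually_ge_atTop 0] with z hz
    positivity
  memLp := by
    refine (((exp_neg (half_pos hγ)).memLp).const_mul (2 / γ)).mono (by fun_prop) ?_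
    filter_upwards [ae_restrict_mem measurableSet_Ioi] with z hz
    have hz : 0 < z := hz
    rw [Real.norm_of_nonneg (by positivity), Real.norm_of_nonneg (by positivity)]
    exact mul_exp_neg_bound hγ z

end HasProfileDeriv

section Layer

variable {m : ℕ}

theorem isLayerFunction_smul {g g' : ℝ → ℝ} {κ κ' : ℝ → State m} (hg : HasTimeDeriv g g')
    (hκ : HasProfileDeriv κ κ') : IsLayerFunction (fun t z => g t • κ z) where
  continuousOn := by
    have hc : Continuous κ := continuous_iff_continuousAt.2 fun z => (hκ.deriv z).continuousAt
    exact (hg.cont.comp continuousOn_fst fun p hp => hp.1).smul (by fun_prop)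
  contDiffOn := by
    have hc : Continuous κ := continuous_iff_continuousAt.2 fun z => (hκ.deriv z).continuousAt
    have hc' := hκ.cont_deriv
    have hgc : ContinuousOn g (Ioi 0) := hg.cont.mono Ioi_subset_Ici_self
    refine contDiffOn_one_of_hasDerivAt (f := fun t z => g t • κ z) (f₁ := fun t z => g' t • κ z)
      (f₂ := fun t z => g t • κ' z)
      (isOpen_Ioi.prod isOpen_Ioi) (fun p hp => (hg.deriv p.1 hp.1).smul_const _)
      (fun p hp => (hκ.deriv p.2).fun_const_smul _) ?_ ?_
    · exact (hg.cont_deriv.comp continuousOn_fst fun p hp => hp.1).smul (by fun_prop)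
    · exact (hgc.comp continuousOn_fst fun p hp => hp.1).smul (by fun_prop)
  initial y _ := by simp [hg.initial]
  decay t _ := by simpa using hκ.decay.const_smul (g t)

theorem dTime_smul {g g' : ℝ → ℝ} (hg : HasTimeDeriv g g') (κ : ℝ → State m) {t : ℝ} (ht : 0 < t)
    (z : ℝ) : dTime (fun t z => g t • κ z) t z = g' t • κ z :=
  ((hg.deriv t ht).smul_const _).deriv

theorem dSpace_smul (g : ℝ → ℝ) {κ κ' : ℝ → State m} (hκ : HasProfileDeriv κ κ') (t z : ℝ) :
    dSpace (fun t z => g t • κ z) t z = g t • κ' z :=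
  ((hκ.deriv z).fun_const_smul _).deriv

theorem lintegral_dTime_smul_lt_top {g g' : ℝ → ℝ} {κ κ' : ℝ → State m} (hg : HasTimeDeriv g g')
    (hκ : HasProfileDeriv κ κ') {T : ℝ} (hT : 0 < T) :
    ∫⁻ t in Ioo 0 T, eLpNorm (fun z => dTime (fun t z => g t • κ z) t z) 2
      (volume.restrict (Ioi 0)) < ⊤ := by
  have h1 : ∫⁻ t in Ioo 0 T, eLpNorm (fun z => dTime (fun t z => g t • κ z) t z) 2
      (volume.restrict (Ioi 0)) =
      ∫⁻ t in Ioo 0 T, ‖g' t‖ₑ * eLpNorm κ 2 (volume.restrict (Ioi 0)) := by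
    refine setLIntegral_congr_fun measurableSet_Ioo fun t ht => ?_
    simp only [dTime_smul hg κ ht.1]
    exact eLpNorm_const_smul (g' t) κ 2 (volume.restrict (Ioi 0))
  rw [h1, lintegral_mul_const' _ _ hκ.memLp.2.ne]
  exact ENNReal.mul_lt_top (hg.integrable T hT).2 hκ.memLp.2

/-- `κ` is the homogeneous layer that corrects the boundary value, and `ρ` the response to `κ` as a
source, mode by mode. Nothing is imposed on `ρ 0`, since the boundary condition is not matched at
order `ε^{3/2}`. -/
theorem exists_knudsen_profile {χ : ℝ} (h0 : 0 < χ) (h1 : χ ≤ 1)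
    {S : Matrix (Fin (m + 1)) (Fin (m + 1)) ℝ} (hS : S.PosDef) (r : Fin (m + 1) → ℝ) :
    ∃ (v : ℝ) (κ κ' ρ ρ' : ℝ → State m), HasProfileDeriv κ κ' ∧ HasProfileDeriv ρ ρ' ∧
      (∀ z, Ac m *ᵥ (κ' z).ofLp + Qc m *ᵥ (κ z).ofLp = 0) ∧
      (∀ z, (κ z).ofLp + Ac m *ᵥ (ρ' z).ofLp + Qc m *ᵥ (ρ z).ofLp = 0) ∧
      Bc χ S *ᵥ (v • velocityVec m + (κ 0).ofLp) = r := by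
  obtain ⟨v, γ, k, hγ, hk, hr⟩ := exists_modes h0 h1 hS r
  choose p q hp hq using fun i => exists_resonant_solution (hγ i) (-k i)
  refine ⟨v, _, _, _, _,
    HasProfileDeriv.sum Finset.univ fun i =>
      (HasProfileDeriv.exp_neg (hγ i)).smul_const (WithLp.toLp 2 (k i)),
    HasProfileDeriv.sum Finset.univ fun i =>
      ((HasProfileDeriv.mul_exp_neg (hγ i)).smul_const (WithLp.toLp 2 (p i))).add
        ((HasProfileDeriv.exp_neg (hγ i)).smul_const (WithLp.toLp 2 (q i))),
    fun z => ?_, fun z => ?_, ?_⟩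
  · simp only [WithLp.ofLp_sum, WithLp.ofLp_smul, Matrix.mulVec_sum, Matrix.mulVec_smul]
    rw [← Finset.sum_add_distrib]
    refine Finset.sum_eq_zero fun i _ => ?_
    rw [← hk i]
    module
  · simp only [WithLp.ofLp_sum, WithLp.ofLp_smul, WithLp.ofLp_add, Matrix.mulVec_sum,
      Matrix.mulVec_smul, Matrix.mulVec_add]
    rw [← Finset.sum_add_distrib, ← Finset.sum_add_distrib]
    refine Finset.sum_eq_zero fun i _ => ?_
    have h2 := hq i
    rw [← neg_eq_iff_eq_neg] at h2
    rw [← hp i, ← h2]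
    module
  · simpa using hr

end Layer

/-! ### Existence of the boundary layer coefficients -/

/-- Every coefficient is sought as scalar functions of the heat hierarchy times constant vectors in
the viscous layer, or times fixed profiles in the Knudsen layer. The layer equations then reduce to
linear algebra for the vectors `p₁`, `p₂`, `s` and the scalars `c`, `c₂`, `δ`. -/
theorem exists_layerExpansion {m : ℕ} {χ : ℝ} (h0 : 0 < χ) (h1 : χ ≤ 1)
    {S : Matrix (Fin (m + 1)) (Fin (m + 1)) ℝ} (hS : S.PosDef) {uw : ℝ → ℝ}
    (hu : ContDiffOn ℝ 3 uw (Ici 0)) (hu0 : uw 0 = 0) (hu1 : derivWithin uw (Ici 0) 0 = 0) :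
    ∃ V K : Fin 4 → ℝ → ℝ → State m, IsLayerExpansion χ S uw V K := by
  obtain ⟨D₀, D₁, D₂, D₃, D₄, D₅, F₃, F₄, F₅, F₆, L₀, L₁, L₂, L₃, M₃, M₄, hD₀, hF₃, T₁, T₂, T₃⟩ :=
    exists_heat_hierarchy hu hu0 hu1
  set A := Ac m with hA
  set Q := Qc m with hQ
  set e := velocityVec m with he
  set f := A *ᵥ e with hf
  have hfs : f = Pi.single (Sum.inr 0) 1 := Ac_mulVec_velocityVec m
  have hQf : Q *ᵥ f = f := Qc_mulVec_of_inl_zero (by rw [hfs]; simp)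
  have hQe : Q *ᵥ e = 0 := Qc_mulVec_velocityVec m
  have hQQ : ∀ x, Q *ᵥ (Q *ᵥ x) = Q *ᵥ x := fun x =>
    Qc_mulVec_of_inl_zero (by rw [hQ, Qc_mulVec, if_pos rfl])
  have hAz : ∀ x, (A *ᵥ x) (Sum.inl 0) = x (Sum.inr 0) := Ac_mulVec_inl_zero
  have hQz : ∀ x, (Q *ᵥ x) (Sum.inl 0) = 0 := fun x => by rw [hQ, Qc_mulVec, if_pos rfl]
  have hQr : ∀ x, (Q *ᵥ x) (Sum.inr 0) = x (Sum.inr 0) := fun x => by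
    rw [hQ, Qc_mulVec, if_neg (by simp)]
  have hez : e (Sum.inl 0) = 1 := by simp [he, velocityVec]
  have her : e (Sum.inr 0) = 0 := by simp [he, velocityVec]
  have hfz : f (Sum.inl 0) = 0 := by rw [hfs]; simp
  have hfr : f (Sum.inr 0) = 1 := by rw [hfs]; simp
  have hAfr : (A *ᵥ f) (Sum.inr 0) = 0 := by
    rw [hfs, hA, Matrix.mulVec_single_one]; simp [Ac]
  -- The part `-f` of `V₁` is forced; only the velocity slip `c` and the Knudsen profile are free,
  -- and they cancel `B f` at the wall.
  obtain ⟨c, κ₁, κ₁', κ₃, κ₃', P₁, P₃, E₁, E₃, B₁⟩ := exists_knudsen_profile h0 h1 hS (Bc χ S *ᵥ f)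
  set p₁ := c • e - f with hp₁
  set w := Q *ᵥ (A *ᵥ p₁) with hw
  obtain ⟨c₂, κ₂, κ₂', -, -, P₂, -, E₂, -, B₂⟩ := exists_knudsen_profile h0 h1 hS (Bc χ S *ᵥ w)
  set p₂ := c₂ • e - w with hp₂
  -- `(∂ₜ - ∂_y²)(y D₃) = -2 D₄`, hence the factor `1 / 2`: this multiple balances the `D₄` source
  -- in the velocity equation of `V₂`.
  set δ := (c₂ - (p₁ + A *ᵥ p₂) (Sum.inr 0)) / 2 with hδ
  set s := p₁ + A *ᵥ p₂ + δ • f with hs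
  have hAp₁ : A *ᵥ p₁ = c • f - A *ᵥ f := by rw [hp₁, Matrix.mulVec_sub, Matrix.mulVec_smul]
  have hwr : w (Sum.inr 0) = c := by
    rw [hw, hQr, hAp₁, Pi.sub_apply, Pi.smul_apply, hfr, hAfr]; simp
  -- Solvability at order `ε^{1/2}`: the velocity `c D₁` of `V₁` and the stress `-c D₂` of `V₂` are
  -- compatible through the heat equation.
  have hsz : s (Sum.inl 0) = 0 := by
    simp only [hs, hp₁, hp₂, Pi.add_apply, Pi.sub_apply, Pi.smul_apply, hAz, hez, hfz, her, hwr]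
    simp
  have hQs : Q *ᵥ s = s := Qc_mulVec_of_inl_zero hsz
  have hsr : s (Sum.inr 0) = c₂ - δ := by
    have : s (Sum.inr 0) = (p₁ + A *ᵥ p₂) (Sum.inr 0) + δ * f (Sum.inr 0) := rfl
    rw [this, hfr, hδ]; ring
  -- Solvability at order zero: `p₁` has stress `-1`, so the first component of `e + A p₁` vanishes.
  have hbase : e + A *ᵥ p₁ - w = 0 := by
    have h2 := eq_Qc_mulVec_add (A *ᵥ p₁)
    rw [hAz, ← hQ, ← hw, ← he] at h2
    have h3 : p₁ (Sum.inr 0) = -1 := by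
      simp [hp₁, her, hfr]
    rw [h3] at h2
    rw [h2]
    module
  let lp : (Fin (m + 1) ⊕ Fin (m + 1) → ℝ) → State m := WithLp.toLp 2
  let V : Fin 4 → ℝ → ℝ → State m :=
    ![fun t y => D₀ t y • lp e, fun t y => D₁ t y • lp p₁,
      fun t y => D₂ t y • lp p₂ + F₃ t y • lp (δ • e),
      fun t y => D₃ t y • lp (-s) + F₄ t y • lp (-(δ • f))]
  -- `K₀ = 0` because `V₀` alone meets the boundary data. Consequently `K₂` has no source, and only
  -- `K₃` is driven, by `∂ₜ K₁`.
  let K : Fin 4 → ℝ → ℝ → State m :=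
    ![fun _ _ => (0 : ℝ) • (0 : State m), fun t z => D₁ t 0 • κ₁ z, fun t z => D₂ t 0 • κ₂ z,
      fun t z => D₃ t 0 • κ₃ z]
  have hV₀ := L₀.smul_const (lp e)
  have hV₁ := L₁.smul_const (lp p₁)
  have hV₂ := (L₂.smul_const (lp p₂)).add (M₃.smul_const (lp (δ • e)))
  have hV₃ := (L₃.smul_const (lp (-s))).add (M₄.smul_const (lp (-(δ • f))))
  have Tz : HasTimeDeriv (fun _ => 0) (fun _ => 0) :=
    ⟨continuousOn_const, rfl, fun t _ => hasDerivAt_const t 0, continuousOn_const,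
      fun T _ => integrableOn_zero⟩
  have Pz : HasProfileDeriv (fun _ => 0 : ℝ → State m) (fun _ => 0) := HasProfileDeriv.zero
  refine ⟨V, K, ⟨?_, ?_, ?_, ?_, ?_, ?_, ?_, ?_, ?_⟩, ⟨?_, ?_, ?_, ?_, ?_, ?_⟩, ?_, ?_, ?_⟩
  · intro j
    fin_cases j
    exacts [hV₀.isLayerFunction, hV₁.isLayerFunction, hV₂.isLayerFunction, hV₃.isLayerFunction]
  · intro j T hT
    fin_cases j
    exacts [hV₀.memLp_dTime hT, hV₁.memLp_dTime hT, hV₂.memLp_dTime hT, hV₃.memLp_dTime hT]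
  · intro j T hT
    fin_cases j
    exacts [hV₀.memLp_dSpace hT, hV₁.memLp_dSpace hT, hV₂.memLp_dSpace hT, hV₃.memLp_dSpace hT]
  · intro t _ y _
    change Q *ᵥ (D₀ t y • e) = 0
    rw [Matrix.mulVec_smul, hQe, smul_zero]
  · intro t ht y hy
    change A *ᵥ (dSpace (fun t y => D₀ t y • lp e) t y).ofLp + Q *ᵥ (D₁ t y • p₁) = 0
    rw [hV₀.dSpace_eq ht hy]
    change A *ᵥ (D₁ t y • e) + Q *ᵥ (D₁ t y • p₁) = 0
    rw [hp₁, Matrix.mulVec_smul, Matrix.mulVec_smul, Matrix.mulVec_sub, Matrix.mulVec_smul, hQe,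
      hQf, ← hf]
    module
  · intro t ht y hy
    change (dTime (fun t y => D₀ t y • lp e) t y).ofLp +
      A *ᵥ (dSpace (fun t y => D₁ t y • lp p₁) t y).ofLp +
      Q *ᵥ (D₂ t y • p₂ + F₃ t y • (δ • e)) = 0
    rw [hV₀.dTime_eq ht hy, hV₁.dSpace_eq ht hy]
    change D₂ t y • e + A *ᵥ (D₂ t y • p₁) + _ = 0
    have h2 : Q *ᵥ p₂ = -w := by
      rw [hp₂, Matrix.mulVec_sub, Matrix.mulVec_smul, hQe, hw, hQQ, smul_zero, zero_sub]
    rw [Matrix.mulVec_add, Matrix.mulVec_smul, Matrix.mulVec_smul, Matrix.mulVec_smul,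
      Matrix.mulVec_smul, hQe, h2]
    have h3 : D₂ t y • (e + A *ᵥ p₁ - w) = 0 := by rw [hbase, smul_zero]
    refine Eq.trans ?_ h3
    module
  · intro t ht y hy
    change (dTime (fun t y => D₁ t y • lp p₁) t y).ofLp +
      A *ᵥ (dSpace (fun t y => D₂ t y • lp p₂ + F₃ t y • lp (δ • e)) t y).ofLp +
      Q *ᵥ (D₃ t y • (-s) + F₄ t y • (-(δ • f))) = 0
    rw [hV₁.dTime_eq ht hy, hV₂.dSpace_eq ht hy]
    change D₃ t y • p₁ + A *ᵥ (D₃ t y • p₂ + (D₃ t y + F₄ t y) • (δ • e)) + _ = 0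
    simp only [Matrix.mulVec_add, Matrix.mulVec_smul, Matrix.mulVec_neg, hQf, hQs, ← hf]
    rw [hs]
    module
  · intro t ht y hy
    change ((dTime (fun t y => D₂ t y • lp p₂ + F₃ t y • lp (δ • e)) t y).ofLp +
      A *ᵥ (dSpace (fun t y => D₃ t y • lp (-s) + F₄ t y • lp (-(δ • f))) t y).ofLp) (Sum.inl 0) = 0
    rw [hV₂.dTime_eq ht hy, hV₃.dSpace_eq ht hy, Pi.add_apply, hAz]
    change D₄ t y * p₂ (Sum.inl 0) + F₅ t y * (δ * e (Sum.inl 0)) +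
      (D₄ t y * (-s (Sum.inr 0)) + (D₄ t y + F₅ t y) * (-(δ * f (Sum.inr 0)))) = 0
    have h2 : p₂ (Sum.inl 0) = c₂ := by
      rw [hp₂, Pi.sub_apply, Pi.smul_apply, hez, hw, hQz]; simp
    rw [h2, hez, hsr, hfr]
    ring
  · intro t _ y _
    change D₃ t y * (-s (Sum.inl 0)) + F₄ t y * (-(δ * f (Sum.inl 0))) = 0
    rw [hsz, hfz]
    ring
  · intro j
    fin_cases j
    exacts [isLayerFunction_smul Tz Pz, isLayerFunction_smul T₁ P₁, isLayerFunction_smul T₂ P₂,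
      isLayerFunction_smul T₃ P₃]
  · intro j T hT
    fin_cases j
    exacts [lintegral_dTime_smul_lt_top Tz Pz hT, lintegral_dTime_smul_lt_top T₁ P₁ hT,
      lintegral_dTime_smul_lt_top T₂ P₂ hT, lintegral_dTime_smul_lt_top T₃ P₃ hT]
  · intro t _ z _
    change A *ᵥ (dSpace (fun _ _ => (0 : ℝ) • (0 : State m)) t z).ofLp +
      Q *ᵥ ((0 : ℝ) • (0 : State m)).ofLp = 0
    rw [dSpace_smul (fun _ => 0) Pz]
    simp
  · intro t _ z _
    change A *ᵥ (dSpace (fun t z => D₁ t 0 • κ₁ z) t z).ofLp + Q *ᵥ (D₁ t 0 • (κ₁ z).ofLp) = 0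
    rw [dSpace_smul (fun t => D₁ t 0) P₁, WithLp.ofLp_smul, Matrix.mulVec_smul,
      Matrix.mulVec_smul, ← smul_add, E₁, smul_zero]
  · intro t ht z _
    change (dTime (fun _ _ => (0 : ℝ) • (0 : State m)) t z).ofLp +
      A *ᵥ (dSpace (fun t z => D₂ t 0 • κ₂ z) t z).ofLp + Q *ᵥ (D₂ t 0 • (κ₂ z).ofLp) = 0
    rw [dSpace_smul (fun t => D₂ t 0) P₂, dTime_smul Tz _ ht, WithLp.ofLp_smul, WithLp.ofLp_smul,
      zero_smul, zero_add, Matrix.mulVec_smul, Matrix.mulVec_smul, ← smul_add, E₂, smul_zero]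
  · intro t ht z _
    change (dTime (fun t z => D₁ t 0 • κ₁ z) t z).ofLp +
      A *ᵥ (dSpace (fun t z => D₃ t 0 • κ₃ z) t z).ofLp + Q *ᵥ (D₃ t 0 • (κ₃ z).ofLp) = 0
    rw [dSpace_smul (fun t => D₃ t 0) P₃, dTime_smul T₁ _ ht, WithLp.ofLp_smul, WithLp.ofLp_smul,
      Matrix.mulVec_smul, Matrix.mulVec_smul, ← smul_add, ← smul_add, E₃, smul_zero]
  · intro t ht
    change Bc χ S *ᵥ (D₀ t 0 • e + (0 : ℝ) • (0 : State m).ofLp) = bc χ S uw t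
    rw [zero_smul, add_zero, hD₀ t ht, Bc_mulVec, bc]
    have h2 : (uw t • e) ∘ Sum.inl = Pi.single 0 (uw t) := by
      funext i
      by_cases hi : i = 0
      · subst hi; simp [he, velocityVec]
      · simp [he, velocityVec, hi]
    have h3 : (uw t • e) ∘ Sum.inr = 0 := by
      funext i
      simp [he, velocityVec]
    rw [h2, h3, Matrix.mulVec_zero, add_zero]
  · intro t _
    change Bc χ S *ᵥ (D₁ t 0 • p₁ + D₁ t 0 • (κ₁ 0).ofLp) = 0
    have h2 : p₁ + (κ₁ 0).ofLp = (c • e + (κ₁ 0).ofLp) - f := by rw [hp₁]; abel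
    rw [← smul_add, Matrix.mulVec_smul, h2, Matrix.mulVec_sub, B₁, sub_self, smul_zero]
  · intro t _
    change Bc χ S *ᵥ (D₂ t 0 • p₂ + F₃ t 0 • (δ • e) + D₂ t 0 • (κ₂ 0).ofLp) = 0
    have h2 : p₂ + (κ₂ 0).ofLp = (c₂ • e + (κ₂ 0).ofLp) - w := by rw [hp₂]; abel
    rw [hF₃, zero_smul, add_zero, ← smul_add, Matrix.mulVec_smul, h2, Matrix.mulVec_sub, B₂,
      sub_self, smul_zero]

/-! ### Weighted energy inequality for symmetric hyperbolic systems -/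

/-- A cutoff that travels outwards, backwards in time, with speed `Λ`. -/
noncomputable def travelCutoff (Λ T R t x : ℝ) : ℝ := Real.smoothTransition (R + Λ * (T - t) - x)

section Cutoff

variable {Λ T R : ℝ}

theorem travelCutoff_nonneg (t x : ℝ) : 0 ≤ travelCutoff Λ T R t x :=
  Real.smoothTransition.nonneg _

theorem travelCutoff_le_one (t x : ℝ) : travelCutoff Λ T R t x ≤ 1 :=
  Real.smoothTransition.le_one _

theorem continuous_travelCutoff : Continuous fun p : ℝ × ℝ => travelCutoff Λ T R p.1 p.2 :=
  Real.smoothTransition.continuous.comp (by fun_prop)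

theorem travelCutoff_eq_one (hΛ : 0 ≤ Λ) {t x : ℝ} (ht : t ≤ T) (hx : x ≤ R - 1) :
    travelCutoff Λ T R t x = 1 :=
  Real.smoothTransition.one_of_one_le (by nlinarith)

theorem travelCutoff_eq_zero (hΛ : 0 ≤ Λ) {t : ℝ} (ht : 0 ≤ t) :
    travelCutoff Λ T R t (R + Λ * T) = 0 :=
  Real.smoothTransition.zero_of_nonpos (by nlinarith)

theorem differentiable_smoothTransition : Differentiable ℝ Real.smoothTransition :=
  (Real.smoothTransition.contDiff (n := 1)).differentiable (by simp)

theorem hasDerivAt_travelCutoff_time (t x : ℝ) :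
    HasDerivAt (fun t => travelCutoff Λ T R t x)
      (-Λ * deriv Real.smoothTransition (R + Λ * (T - t) - x)) t := by
  have h1 : HasDerivAt (fun t => R + Λ * (T - t) - x) (Λ * (-1)) t := by
    simpa using ((((hasDerivAt_id t).const_sub T).const_mul Λ).const_add R).sub_const x
  refine ((differentiable_smoothTransition _).hasDerivAt.comp t h1).congr_deriv ?_
  ring

theorem hasDerivAt_travelCutoff_space (t x : ℝ) :
    HasDerivAt (fun x => travelCutoff Λ T R t x)
      (-deriv Real.smoothTransition (R + Λ * (T - t) - x)) x := by
  have h1 : HasDerivAt (fun x => R + Λ * (T - t) - x) (-1) x := by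
    simpa using (hasDerivAt_id x).const_sub (R + Λ * (T - t))
  refine ((differentiable_smoothTransition _).hasDerivAt.comp x h1).congr_deriv ?_
  ring

end Cutoff

section Energy

variable {H : Type*} [NormedAddCommGroup H] [InnerProductSpace ℝ H] {A : H →L[ℝ] H} {Λ T R : ℝ}
  {E r : ℝ → ℝ → H}

/-- Divergence theorem for the cut-off energy density and its flux on `[0, t] × [0, R + Λ T]`. The
cutoff retreats at speed `Λ ≥ ‖A‖`, so the terms from its derivatives have a favourable sign; it
vanishes at the outer end and equals one at the wall. -/
theorem weighted_energy_le (hA : ∀ x y, inner ℝ (A x) y = inner ℝ x (A y))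
    (hΛ : ∀ x, ‖A x‖ ≤ Λ * ‖x‖) (hΛ0 : 0 ≤ Λ) (hR : 1 ≤ R)
    (hcont : ContinuousOn (fun p : ℝ × ℝ => E p.1 p.2) (Icc 0 T ×ˢ Ici 0))
    (hdiff : ContDiffOn ℝ 1 (fun p : ℝ × ℝ => E p.1 p.2) (Ioo 0 T ×ˢ Ioi 0))
    (hinit : ∀ x ∈ Ici (0 : ℝ), E 0 x = 0)
    (heq : ∀ t ∈ Ioo 0 T, ∀ x ∈ Ioi (0 : ℝ),
      deriv (fun s => E s x) t + A (deriv (fun y => E t y) x) = r t x)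
    (hr : ∀ L, IntegrableOn (fun p : ℝ × ℝ => inner ℝ (r p.1 p.2) (E p.1 p.2))
      (Ioo 0 T ×ˢ Ioo 0 L)) {t : ℝ} (ht : t ∈ Icc 0 T) :
    1 / 2 * ∫ x in (0 : ℝ)..(R + Λ * T), travelCutoff Λ T R t x * ‖E t x‖ ^ 2 ≤
      (∫ s in (0 : ℝ)..t, 1 / 2 * inner ℝ (A (E s 0)) (E s 0)) +
        ∫ p in Ioo 0 t ×ˢ Ioo 0 (R + Λ * T),
          travelCutoff Λ T R p.1 p.2 * inner ℝ (r p.1 p.2) (E p.1 p.2) := by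
  have hT : 0 ≤ T := ht.1.trans ht.2
  set L := R + Λ * T with hL
  have hL0 : 0 ≤ L := by positivity
  set φ := travelCutoff Λ T R with hφ
  set σ : ℝ → ℝ → ℝ := fun t x => deriv Real.smoothTransition (R + Λ * (T - t) - x) with hσ
  have hσ0 : ∀ t x, 0 ≤ σ t x := fun t x => Real.smoothTransition.monotone.deriv_nonneg
  have hσc : Continuous fun p : ℝ × ℝ => σ p.1 p.2 :=
    ((Real.smoothTransition.contDiff (n := 1)).continuous_deriv (by simp)).comp (by fun_prop)
  have hφc : Continuous fun p : ℝ × ℝ => φ p.1 p.2 := continuous_travelCutoff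
  set F : ℝ × ℝ → ℝ := fun p => 1 / 2 * (φ p.1 p.2 * inner ℝ (E p.1 p.2) (E p.1 p.2)) with hF
  set G : ℝ × ℝ → ℝ := fun p => 1 / 2 * (φ p.1 p.2 * inner ℝ (A (E p.1 p.2)) (E p.1 p.2)) with hG
  have hsub : Icc ((0 : ℝ), (0 : ℝ)) (t, L) ⊆ Icc 0 T ×ˢ Ici 0 := fun p hp =>
    ⟨⟨hp.1.1, hp.2.1.trans ht.2⟩, hp.1.2⟩
  have hc : ContinuousOn (fun p : ℝ × ℝ => E p.1 p.2) (Icc (0, 0) (t, L)) := hcont.mono hsub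
  have hAc : ContinuousOn (fun p : ℝ × ℝ => A (E p.1 p.2)) (Icc (0, 0) (t, L)) :=
    A.continuous.comp_continuousOn hc
  have hFc : ContinuousOn F (Icc (0, 0) (t, L)) :=
    continuousOn_const.mul (hφc.continuousOn.mul (hc.inner hc))
  have hGc : ContinuousOn G (Icc (0, 0) (t, L)) :=
    continuousOn_const.mul (hφc.continuousOn.mul (hAc.inner hc))
  have hopen : IsOpen (Ioo 0 T ×ˢ Ioi 0 : Set (ℝ × ℝ)) := isOpen_Ioo.prod isOpen_Ioi
  have hin : ∀ p ∈ Ioo (0 : ℝ) t ×ˢ Ioo (0 : ℝ) L, p ∈ (Ioo 0 T ×ˢ Ioi 0 : Set (ℝ × ℝ)) :=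
    fun p hp => ⟨⟨hp.1.1, hp.1.2.trans_le ht.2⟩, hp.2.1⟩
  have hEd : ∀ p ∈ Ioo (0 : ℝ) t ×ˢ Ioo (0 : ℝ) L,
      DifferentiableAt ℝ (fun p : ℝ × ℝ => E p.1 p.2) p := fun p hp =>
    (hdiff.differentiableOn (by simp)).differentiableAt (hopen.mem_nhds (hin p hp))
  have hφd : Differentiable ℝ fun p : ℝ × ℝ => φ p.1 p.2 :=
    differentiable_smoothTransition.comp (by fun_prop)
  have hFd : ∀ p ∈ Ioo (0 : ℝ) t ×ˢ Ioo (0 : ℝ) L, DifferentiableAt ℝ F p := fun p hp =>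
    ((hφd p).mul ((hEd p hp).inner ℝ (hEd p hp))).const_mul _
  have hGd : ∀ p ∈ Ioo (0 : ℝ) t ×ˢ Ioo (0 : ℝ) L, DifferentiableAt ℝ G p := fun p hp =>
    ((hφd p).mul ((A.differentiableAt.comp p (hEd p hp)).inner ℝ (hEd p hp))).const_mul _
  have hline : ∀ p : ℝ × ℝ, HasDerivAt (fun s => (s, p.2)) ((1 : ℝ), (0 : ℝ)) p.1 ∧
      HasDerivAt (fun x => (p.1, x)) ((0 : ℝ), (1 : ℝ)) p.2 := fun p =>
    ⟨(hasDerivAt_id p.1).prodMk (hasDerivAt_const _ _),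
      (hasDerivAt_const _ _).prodMk (hasDerivAt_id p.2)⟩
  have hdiv : ∀ p ∈ Ioo (0 : ℝ) t ×ˢ Ioo (0 : ℝ) L,
      fderiv ℝ F p (1, 0) + fderiv ℝ G p (0, 1) =
        φ p.1 p.2 * inner ℝ (r p.1 p.2) (E p.1 p.2) -
          1 / 2 * (σ p.1 p.2 * (Λ * inner ℝ (E p.1 p.2) (E p.1 p.2) +
            inner ℝ (A (E p.1 p.2)) (E p.1 p.2))) := by
    rintro ⟨s, x⟩ hp
    have hEt : HasDerivAt (fun s => E s x) (deriv (fun s => E s x) s) s := by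
      have h := (hEd _ hp).hasFDerivAt.comp_hasDerivAt s (hline (s, x)).1
      exact h.differentiableAt.hasDerivAt
    have hEx : HasDerivAt (fun x => E s x) (deriv (fun x => E s x) x) x := by
      have h := (hEd _ hp).hasFDerivAt.comp_hasDerivAt x (hline (s, x)).2
      exact h.differentiableAt.hasDerivAt
    have hF1 := ((hFd _ hp).hasFDerivAt.comp_hasDerivAt s (hline (s, x)).1).unique
      (((hasDerivAt_travelCutoff_time (Λ := Λ) (T := T) (R := R) s x).fun_mul
        (hEt.inner ℝ hEt)).const_mul (1 / 2 : ℝ))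
    have hG1 := ((hGd _ hp).hasFDerivAt.comp_hasDerivAt x (hline (s, x)).2).unique
      (((hasDerivAt_travelCutoff_space (Λ := Λ) (T := T) (R := R) s x).fun_mul
        ((A.hasFDerivAt.comp_hasDerivAt x hEx).inner ℝ hEx)).const_mul (1 / 2 : ℝ))
    rw [hF1, hG1, ← heq s ⟨(hin _ hp).1.1, (hin _ hp).1.2⟩ x (hin _ hp).2, inner_add_left]
    simp only [Function.comp_def]
    rw [real_inner_comm (deriv (fun s => E s x) s) (E s x), hA (E s x) (deriv (fun x => E s x) x),
      real_inner_comm (A (deriv (fun x => E s x) x)) (E s x)]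
    simp only [hφ, hσ]
    ring
  have hIcc : (Icc ((0 : ℝ), (0 : ℝ)) (t, L)) = Icc 0 t ×ˢ Icc 0 L := by
    rw [Icc_prod_Icc]
  have hae : (Ioo (0 : ℝ) t ×ˢ Ioo (0 : ℝ) L : Set (ℝ × ℝ)) =ᵐ[volume] Icc (0, 0) (t, L) := by
    rw [hIcc]
    exact Measure.set_prod_ae_eq Ioo_ae_eq_Icc Ioo_ae_eq_Icc
  have hms : MeasurableSet (Ioo (0 : ℝ) t ×ˢ Ioo (0 : ℝ) L) :=
    measurableSet_Ioo.prod measurableSet_Ioo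
  have hI1 : IntegrableOn (fun p : ℝ × ℝ => φ p.1 p.2 * inner ℝ (r p.1 p.2) (E p.1 p.2))
      (Ioo (0 : ℝ) t ×ˢ Ioo (0 : ℝ) L) := by
    have h := (hr L).mono_set (prod_mono_left (Ioo_subset_Ioo_right ht.2) :
      (Ioo (0 : ℝ) t ×ˢ Ioo (0 : ℝ) L) ⊆ Ioo 0 T ×ˢ Ioo 0 L)
    refine h.bdd_mul (c := 1) hφc.aestronglyMeasurable (Eventually.of_forall fun p => ?_)
    rw [Real.norm_of_nonneg (travelCutoff_nonneg _ _)]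
    exact travelCutoff_le_one _ _
  have hI2 : IntegrableOn (fun p : ℝ × ℝ => 1 / 2 * (σ p.1 p.2 * (Λ * inner ℝ (E p.1 p.2) (E p.1 p.2)
      + inner ℝ (A (E p.1 p.2)) (E p.1 p.2)))) (Ioo (0 : ℝ) t ×ˢ Ioo (0 : ℝ) L) := by
    have h : ContinuousOn (fun p : ℝ × ℝ => 1 / 2 * (σ p.1 p.2 * (Λ * inner ℝ (E p.1 p.2) (E p.1 p.2)
      + inner ℝ (A (E p.1 p.2)) (E p.1 p.2)))) (Icc (0, 0) (t, L)) :=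
      continuousOn_const.mul (hσc.continuousOn.mul
        ((continuousOn_const.mul (hc.inner hc)).add (hAc.inner hc)))
    refine (h.integrableOn_compact isCompact_Icc).mono_set ?_
    rw [hIcc]
    exact prod_mono Ioo_subset_Icc_self Ioo_subset_Icc_self
  have hI : IntegrableOn (fun p => fderiv ℝ F p (1, 0) + fderiv ℝ G p (0, 1))
      (Ioo (0 : ℝ) t ×ˢ Ioo (0 : ℝ) L) :=
    (hI1.sub hI2).congr_fun (fun p hp => (hdiv p hp).symm) hms
  have key := integral_divergence_prod_Icc_of_hasFDerivAt_of_le F G (fderiv ℝ F) (fderiv ℝ G)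
    (0, 0) (t, L) ⟨ht.1, hL0⟩ hFc hGc (fun p hp => (hFd p hp).hasFDerivAt)
    (fun p hp => (hGd p hp).hasFDerivAt) (hI.congr_set_ae hae.symm)
  rw [← setIntegral_congr_set hae, setIntegral_congr_fun hms hdiv] at key
  have e1 : ∫ s in (0 : ℝ)..t, G (s, L) = 0 := by
    refine (intervalIntegral.integral_congr fun s hs => ?_).trans intervalIntegral.integral_zero
    rw [uIcc_of_le ht.1] at hs
    simp only [hG, hφ, hL]
    rw [travelCutoff_eq_zero hΛ0 hs.1]
    ring
  have e2 : ∫ s in (0 : ℝ)..t, G (s, 0) = ∫ s in (0 : ℝ)..t, 1 / 2 * inner ℝ (A (E s 0)) (E s 0) := by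
    refine intervalIntegral.integral_congr fun s hs => ?_
    rw [uIcc_of_le ht.1] at hs
    simp only [hG, hφ]
    rw [travelCutoff_eq_one hΛ0 (hs.2.trans ht.2) (by linarith), one_mul]
  have e3 : ∫ x in (0 : ℝ)..L, F (0, x) = 0 := by
    refine (intervalIntegral.integral_congr fun x hx => ?_).trans intervalIntegral.integral_zero
    rw [uIcc_of_le hL0] at hx
    simp only [hF]
    rw [hinit x hx.1, inner_zero_left]
    ring
  have e4 : ∫ x in (0 : ℝ)..L, F (t, x) = 1 / 2 * ∫ x in (0 : ℝ)..L, φ t x * ‖E t x‖ ^ 2 := by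
    rw [← intervalIntegral.integral_const_mul]
    simp only [hF, real_inner_self_eq_norm_sq]
  simp only at key
  rw [e1, e2, e3, e4] at key
  have hle : ∫ p in Ioo (0 : ℝ) t ×ˢ Ioo (0 : ℝ) L,
      (φ p.1 p.2 * inner ℝ (r p.1 p.2) (E p.1 p.2) -
        1 / 2 * (σ p.1 p.2 * (Λ * inner ℝ (E p.1 p.2) (E p.1 p.2) +
            inner ℝ (A (E p.1 p.2)) (E p.1 p.2)))) ≤
      -- The discarded term is nonnegative, since `|A E · E| ≤ Λ |E|²` and the cutoff profile is
      -- monotone.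
      ∫ p in Ioo (0 : ℝ) t ×ˢ Ioo (0 : ℝ) L, φ p.1 p.2 * inner ℝ (r p.1 p.2) (E p.1 p.2) := by
    refine integral_mono (hI1.sub hI2) hI1 fun p => ?_
    have h1 : 0 ≤ Λ * inner ℝ (E p.1 p.2) (E p.1 p.2) + inner ℝ (A (E p.1 p.2)) (E p.1 p.2) := by
      have h2 := abs_real_inner_le_norm (A (E p.1 p.2)) (E p.1 p.2)
      have h3 := hΛ (E p.1 p.2)
      have h4 := neg_abs_le (inner ℝ (A (E p.1 p.2)) (E p.1 p.2))
      rw [real_inner_self_eq_norm_sq]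
      nlinarith [norm_nonneg (E p.1 p.2)]
    have := mul_nonneg (hσ0 p.1 p.2) h1
    simp only [sub_le_self_iff]
    linarith
  linarith

end Energy

/-! ### Square norms, pairings and absorption of the source -/

theorem eLpNorm_two_sq {α F : Type*} [MeasurableSpace α] [NormedAddCommGroup F] (f : α → F)
    (μ : Measure α) : eLpNorm f 2 μ ^ 2 = ∫⁻ x, ‖f x‖ₑ ^ 2 ∂μ := by
  rw [eLpNorm_eq_lintegral_rpow_enorm_toReal (by norm_num) (by norm_num), ← ENNReal.rpow_natCast,
    ← ENNReal.rpow_mul]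
  norm_num

theorem eLpNorm_two_le {α F : Type*} [MeasurableSpace α] [NormedAddCommGroup F] {f : α → F}
    {μ : Measure α} {c : ℝ} (hc : 0 ≤ c) (h : ∫⁻ x, ‖f x‖ₑ ^ 2 ∂μ ≤ ENNReal.ofReal c) :
    eLpNorm f 2 μ ≤ ENNReal.ofReal √c := by
  rw [← eLpNorm_two_sq] at h
  rw [← ENNReal.pow_le_pow_left_iff two_ne_zero,
    ← ENNReal.ofReal_pow (Real.sqrt_nonneg c), Real.sq_sqrt hc]
  exact h

theorem lintegral_enorm_mul_le {α : Type*} [MeasurableSpace α] {μ : Measure α} {f g : α → ℝ}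
    (hf : AEStronglyMeasurable f μ) (hg : AEStronglyMeasurable g μ) :
    ∫⁻ x, ‖f x * g x‖ₑ ∂μ ≤ eLpNorm f 2 μ * eLpNorm g 2 μ := by
  have h := eLpNorm_smul_le_mul_eLpNorm (p := 2) (q := 2) (r := 1) hg hf
  rw [eLpNorm_one_eq_lintegral_enorm] at h
  exact h

/-- The pairing of `L¹` in time with values in `L²` against `L^∞` in time with values in `L²`, by
Cauchy–Schwarz on each time slice. -/
theorem lintegral_prod_enorm_mul_le {T L : ℝ} {f g : ℝ → ℝ → ℝ} {c : ℝ≥0∞} (hc' : c ≠ ⊤)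
    (hf : ContinuousOn (fun p : ℝ × ℝ => f p.1 p.2) (Ioo 0 T ×ˢ Ioi 0))
    (hg : ContinuousOn (fun p : ℝ × ℝ => g p.1 p.2) (Ioo 0 T ×ˢ Ioi 0))
    (hc : ∀ t ∈ Ioo 0 T, eLpNorm (g t) 2 (volume.restrict (Ioo 0 L)) ≤ c) :
    ∫⁻ p in Ioo 0 T ×ˢ Ioo 0 L, ‖f p.1 p.2 * g p.1 p.2‖ₑ ≤
      (∫⁻ t in Ioo 0 T, eLpNorm (f t) 2 (volume.restrict (Ioi 0))) * c := by
  have hs : (Ioo 0 T ×ˢ Ioo 0 L : Set (ℝ × ℝ)) ⊆ Ioo 0 T ×ˢ Ioi 0 :=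
    prod_mono_right Ioo_subset_Ioi_self
  have hm : AEMeasurable (fun p : ℝ × ℝ => ‖f p.1 p.2 * g p.1 p.2‖ₑ)
      (((volume : Measure ℝ).restrict (Ioo 0 T)).prod ((volume : Measure ℝ).restrict (Ioo 0 L))) := by
    rw [Measure.prod_restrict]
    exact (((hf.mono hs).mul (hg.mono hs)).aestronglyMeasurable
      (measurableSet_Ioo.prod measurableSet_Ioo)).enorm
  have hsl : ∀ {k : ℝ → ℝ → ℝ}, ContinuousOn (fun p : ℝ × ℝ => k p.1 p.2) (Ioo 0 T ×ˢ Ioi 0) →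
      ∀ t ∈ Ioo 0 T, AEStronglyMeasurable (k t) (volume.restrict (Ioo 0 L)) := fun {k} hk t ht =>
    (hk.comp (f := fun x => (t, x)) (by fun_prop)
      fun x hx => ⟨ht, Ioo_subset_Ioi_self hx⟩).aestronglyMeasurable measurableSet_Ioo
  rw [Measure.volume_eq_prod, ← Measure.prod_restrict, lintegral_prod _ hm]
  calc ∫⁻ t in Ioo 0 T, ∫⁻ x in Ioo 0 L, ‖f t x * g t x‖ₑ
      ≤ ∫⁻ t in Ioo 0 T, eLpNorm (f t) 2 (volume.restrict (Ioi 0)) * c := by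
        refine setLIntegral_mono' measurableSet_Ioo fun t ht => ?_
        refine (lintegral_enorm_mul_le (hsl hf t ht) (hsl hg t ht)).trans ?_
        gcongr
        · exact Ioo_subset_Ioi_self
        · exact hc t ht
    _ = _ := lintegral_mul_const' _ _ hc'

/-- Integrability need not be known: otherwise the integral is zero by convention and the bound is
trivial. -/
theorem integral_le_of_lintegral_le {α : Type*} [MeasurableSpace α] {μ : Measure α} {f : α → ℝ}
    {c : ℝ} (hc : 0 ≤ c) (h : ∫⁻ x, ENNReal.ofReal (f x) ∂μ ≤ ENNReal.ofReal c) :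
    ∫ x, f x ∂μ ≤ c := by
  by_cases hf : Integrable f μ
  · rw [integral_eq_lintegral_pos_part_sub_lintegral_neg_part hf]
    have h1 := ENNReal.toReal_mono ENNReal.ofReal_ne_top h
    rw [ENNReal.toReal_ofReal hc] at h1
    have h2 : 0 ≤ (∫⁻ x, ENNReal.ofReal (-f x) ∂μ).toReal := ENNReal.toReal_nonneg
    linarith
  · rwa [integral_undef hf]

section Energy

variable {H : Type*} [NormedAddCommGroup H] [InnerProductSpace ℝ H] {A : H →L[ℝ] H} {Λ T : ℝ}
  {E r : ℝ → ℝ → H} {a b : ℝ → ℝ → ℝ} {α κ c₁ β : ℝ}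

/-- The energy estimate on the moving domain, with the part `b ‖E‖` of the source absorbed. -/
theorem weighted_energy_bound {R : ℝ} (hA : ∀ x y, inner ℝ (A x) y = inner ℝ x (A y))
    (hΛ : ∀ x, ‖A x‖ ≤ Λ * ‖x‖) (hΛ0 : 0 ≤ Λ) (hR : 1 ≤ R) (hT : 0 ≤ T)
    (hcont : ContinuousOn (fun p : ℝ × ℝ => E p.1 p.2) (Icc 0 T ×ˢ Ici 0))
    (hdiff : ContDiffOn ℝ 1 (fun p : ℝ × ℝ => E p.1 p.2) (Ioo 0 T ×ˢ Ioi 0))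
    (hinit : ∀ x ∈ Ici (0 : ℝ), E 0 x = 0)
    (heq : ∀ t ∈ Ioo 0 T, ∀ x ∈ Ioi (0 : ℝ),
      deriv (fun s => E s x) t + A (deriv (fun y => E t y) x) = r t x)
    (hr : ∀ L, IntegrableOn (fun p : ℝ × ℝ => inner ℝ (r p.1 p.2) (E p.1 p.2))
      (Ioo 0 T ×ˢ Ioo 0 L))
    (hac : ContinuousOn (fun p : ℝ × ℝ => a p.1 p.2) (Ioo 0 T ×ˢ Ioi 0))
    (hbc : ContinuousOn (fun p : ℝ × ℝ => b p.1 p.2) (Ioo 0 T ×ˢ Ioi 0))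
    (ha0 : ∀ t x, 0 ≤ a t x) (hb0 : ∀ t x, 0 ≤ b t x)
    (hsrc : ∀ t ∈ Ioo 0 T, ∀ x ∈ Ioi (0 : ℝ),
      inner ℝ (r t x) (E t x) ≤ a t x + b t x * ‖E t x‖)
    (hα : 0 ≤ α) (hκ : 0 ≤ κ)
    (ha : ∫⁻ p in Ioo 0 T ×ˢ Ioi 0, ENNReal.ofReal (a p.1 p.2) ≤ ENNReal.ofReal α)
    (hb : ∫⁻ t in Ioo 0 T, eLpNorm (b t) 2 (volume.restrict (Ioi 0)) ≤ ENNReal.ofReal κ)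
    (hc₁ : 0 ≤ c₁) (hβ : 0 ≤ β)
    (hbdry : ∀ s ∈ Icc 0 T,
      1 / 2 * inner ℝ (A (E s 0)) (E s 0) ≤ -(c₁ * ‖E s 0‖ ^ 2) + β) :
    (∀ t ∈ Icc 0 T, ∫ x in (0 : ℝ)..(R + Λ * T), travelCutoff Λ T R t x * ‖E t x‖ ^ 2 ≤
      4 * (β * T + α + κ ^ 2)) ∧
    c₁ * ∫ s in (0 : ℝ)..T, ‖E s 0‖ ^ 2 ≤ 2 * (β * T + α + κ ^ 2) := by
  set L := R + Λ * T with hL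
  have hL0 : 0 ≤ L := by positivity
  set φ := travelCutoff Λ T R with hφ
  have hφc : Continuous fun p : ℝ × ℝ => φ p.1 p.2 := continuous_travelCutoff
  have hφ0 : ∀ t x, 0 ≤ φ t x := travelCutoff_nonneg
  have hφ1 : ∀ t x, φ t x ≤ 1 := travelCutoff_le_one
  set y : ℝ → ℝ := fun t => ∫ x in (0 : ℝ)..L, φ t x * ‖E t x‖ ^ 2 with hy
  have hyc : ∀ t ∈ Icc 0 T, ContinuousOn (fun x => φ t x * ‖E t x‖ ^ 2) (Icc 0 L) := by
    intro t ht
    have h1 : ContinuousOn (fun x => E t x) (Icc 0 L) :=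
      hcont.comp (f := fun x => (t, x)) (by fun_prop) fun x hx => ⟨ht, hx.1⟩
    have h2 : Continuous fun x => φ t x := hφc.comp (by fun_prop : Continuous fun x : ℝ => (t, x))
    exact h2.continuousOn.mul (h1.norm.pow 2)
  have hy0 : ∀ t, 0 ≤ y t := fun t =>
    intervalIntegral.integral_nonneg hL0 fun x _ => mul_nonneg (hφ0 t x) (sq_nonneg _)
  obtain ⟨B, hB⟩ := (isCompact_Icc.prod isCompact_Icc :
    IsCompact (Icc 0 T ×ˢ Icc 0 L)).exists_bound_of_continuousOn
      (hcont.mono (prod_mono_right Icc_subset_Ici_self))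
  have hyB : ∀ t ∈ Icc 0 T, y t ≤ B ^ 2 * L := by
    intro t ht
    have h1 : y t ≤ ∫ _ in (0 : ℝ)..L, B ^ 2 := by
      refine intervalIntegral.integral_mono_on hL0 ?_ intervalIntegrable_const fun x hx => ?_
      · exact ContinuousOn.intervalIntegrable (by rw [uIcc_of_le hL0]; exact hyc t ht)
      · have h2 := hB (t, x) ⟨ht, hx⟩
        calc φ t x * ‖E t x‖ ^ 2 ≤ 1 * ‖E t x‖ ^ 2 := by gcongr; exact hφ1 t x
          _ = ‖E t x‖ ^ 2 := one_mul _
          _ ≤ B ^ 2 := by gcongr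
    rwa [intervalIntegral.integral_const, sub_zero, smul_eq_mul, mul_comm] at h1
  -- Compactness only makes this supremum finite, so that it can be absorbed; the bound `B` does not
  -- enter the final constant.
  set Y : ℝ := ⨆ t : Icc 0 T, y t with hY
  have hbdd : BddAbove (range fun t : Icc 0 T => y t) :=
    ⟨B ^ 2 * L, by rintro _ ⟨t, rfl⟩; exact hyB t t.2⟩
  have hyY : ∀ t ∈ Icc 0 T, y t ≤ Y := fun t ht => le_ciSup hbdd ⟨t, ht⟩
  have hY0 : 0 ≤ Y := (hy0 0).trans (hyY 0 ⟨le_rfl, hT⟩)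
  have hEc : ContinuousOn (fun p : ℝ × ℝ => E p.1 p.2) (Ioo 0 T ×ˢ Ioi 0) :=
    hcont.mono (prod_mono Ioo_subset_Icc_self Ioi_subset_Ici_self)
  -- As `φ ≤ √φ` on `[0, 1]`, the source pairs with `√φ |E|`, whose squared `L²` norm is exactly the
  -- weighted energy.
  set g : ℝ → ℝ → ℝ := fun t x => √(φ t x) * ‖E t x‖ with hg
  have hgc : ContinuousOn (fun p : ℝ × ℝ => g p.1 p.2) (Ioo 0 T ×ˢ Ioi 0) :=
    (Real.continuous_sqrt.comp hφc).continuousOn.mul hEc.norm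
  have hgY : ∀ t ∈ Ioo 0 T, eLpNorm (g t) 2 (volume.restrict (Ioo 0 L)) ≤ ENNReal.ofReal √Y := by
    intro t ht
    refine eLpNorm_two_le hY0 ?_
    have h1 : ∫⁻ x in Ioo 0 L, ‖g t x‖ₑ ^ 2 =
        ∫⁻ x in Ioo 0 L, ENNReal.ofReal (φ t x * ‖E t x‖ ^ 2) := by
      refine lintegral_congr fun x => ?_
      rw [Real.enorm_of_nonneg (mul_nonneg (Real.sqrt_nonneg _) (norm_nonneg _)),
        ← ENNReal.ofReal_pow (mul_nonneg (Real.sqrt_nonneg _) (norm_nonneg _)), mul_pow,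
        Real.sq_sqrt (hφ0 t x)]
    rw [h1, ← ofReal_integral_eq_lintegral_ofReal]
    · refine ENNReal.ofReal_le_ofReal ?_
      have : ∫ x in (0 : ℝ)..L, φ t x * ‖E t x‖ ^ 2 ≤ Y := hyY t ⟨ht.1.le, ht.2.le⟩
      rwa [intervalIntegral.integral_of_le hL0, integral_Ioc_eq_integral_Ioo] at this
    · exact ((hyc t ⟨ht.1.le, ht.2.le⟩).integrableOn_Icc).mono_set Ioo_subset_Icc_self
    · exact Eventually.of_forall fun x => mul_nonneg (hφ0 t x) (sq_nonneg _)
  have hsource : ∀ t ∈ Icc 0 T, ∫ p in Ioo 0 t ×ˢ Ioo 0 L,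
      φ p.1 p.2 * inner ℝ (r p.1 p.2) (E p.1 p.2) ≤ α + κ * √Y := by
    intro t ht
    have hst : (Ioo 0 t ×ˢ Ioo 0 L : Set (ℝ × ℝ)) ⊆ Ioo 0 T ×ˢ Ioo 0 L :=
      prod_mono_left (Ioo_subset_Ioo_right ht.2)
    have hs : (Ioo 0 T ×ˢ Ioo 0 L : Set (ℝ × ℝ)) ⊆ Ioo 0 T ×ˢ Ioi 0 :=
      prod_mono_right Ioo_subset_Ioi_self
    refine integral_le_of_lintegral_le (by positivity) ?_
    calc ∫⁻ p in Ioo 0 t ×ˢ Ioo 0 L,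
          ENNReal.ofReal (φ p.1 p.2 * inner ℝ (r p.1 p.2) (E p.1 p.2))
        ≤ ∫⁻ p in Ioo 0 t ×ˢ Ioo 0 L,
          (ENNReal.ofReal (a p.1 p.2) + ‖b p.1 p.2 * g p.1 p.2‖ₑ) := by
          refine setLIntegral_mono' (measurableSet_Ioo.prod measurableSet_Ioo) fun p hp => ?_
          have hp' := hs (hst hp)
          have h1 := hsrc p.1 hp'.1 p.2 hp'.2
          have hg0 : 0 ≤ g p.1 p.2 := mul_nonneg (Real.sqrt_nonneg _) (norm_nonneg _)
          rw [Real.enorm_of_nonneg (mul_nonneg (hb0 _ _) hg0),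
            ← ENNReal.ofReal_add (ha0 _ _) (mul_nonneg (hb0 _ _) hg0)]
          refine ENNReal.ofReal_le_ofReal ?_
          have h2 := hφ0 p.1 p.2
          have h3 := hφ1 p.1 p.2
          have h4 : φ p.1 p.2 ≤ √(φ p.1 p.2) := Real.le_sqrt_of_sq_le (by nlinarith)
          have h5 := ha0 p.1 p.2
          have h6 := hb0 p.1 p.2
          calc φ p.1 p.2 * inner ℝ (r p.1 p.2) (E p.1 p.2)
              ≤ φ p.1 p.2 * (a p.1 p.2 + b p.1 p.2 * ‖E p.1 p.2‖) := by gcongr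
            _ = φ p.1 p.2 * a p.1 p.2 + b p.1 p.2 * (φ p.1 p.2 * ‖E p.1 p.2‖) := by ring
            _ ≤ 1 * a p.1 p.2 + b p.1 p.2 * (√(φ p.1 p.2) * ‖E p.1 p.2‖) := by gcongr
            _ = _ := by rw [one_mul]
      _ ≤ ∫⁻ p in Ioo 0 T ×ˢ Ioo 0 L,
          (ENNReal.ofReal (a p.1 p.2) + ‖b p.1 p.2 * g p.1 p.2‖ₑ) := lintegral_mono_set hst
      _ = (∫⁻ p in Ioo 0 T ×ˢ Ioo 0 L, ENNReal.ofReal (a p.1 p.2)) +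
          ∫⁻ p in Ioo 0 T ×ˢ Ioo 0 L, ‖b p.1 p.2 * g p.1 p.2‖ₑ := by
          refine lintegral_add_left' ?_ _
          exact ((hac.mono hs).aestronglyMeasurable
            (measurableSet_Ioo.prod measurableSet_Ioo)).aemeasurable.ennreal_ofReal
      _ ≤ ENNReal.ofReal α + ENNReal.ofReal κ * ENNReal.ofReal √Y := by
          gcongr
          · exact (lintegral_mono_set hs).trans ha
          · refine (lintegral_prod_enorm_mul_le ENNReal.ofReal_ne_top hbc hgc hgY).trans ?_
            gcongr
      _ = ENNReal.ofReal (α + κ * √Y) := by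
          rw [ENNReal.ofReal_add hα (by positivity), ENNReal.ofReal_mul hκ]
  have hEb : ContinuousOn (fun s => E s 0) (Icc 0 T) :=
    hcont.comp (f := fun s => (s, (0 : ℝ))) (by fun_prop) fun s hs => ⟨hs, self_mem_Ici⟩
  have hmain : ∀ t ∈ Icc 0 T, 1 / 2 * y t + c₁ * ∫ s in (0 : ℝ)..t, ‖E s 0‖ ^ 2 ≤
      β * T + α + κ * √Y := by
    intro t ht
    have h1 := weighted_energy_le hA hΛ hΛ0 hR hcont hdiff hinit heq hr ht
    have hts : uIcc 0 t ⊆ Icc 0 T := by rw [uIcc_of_le ht.1]; exact Icc_subset_Icc_right ht.2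
    have hi1 : IntervalIntegrable (fun s => ‖E s 0‖ ^ 2) volume 0 t :=
      ((hEb.mono hts).norm.pow 2).intervalIntegrable
    have h2 : ∫ s in (0 : ℝ)..t, 1 / 2 * inner ℝ (A (E s 0)) (E s 0) ≤
        ∫ s in (0 : ℝ)..t, (-c₁ * ‖E s 0‖ ^ 2 + β) := by
      refine intervalIntegral.integral_mono_on ht.1 ?_
        ((hi1.const_mul _).add intervalIntegrable_const) fun s hs => ?_
      · exact ContinuousOn.intervalIntegrable (continuousOn_const.mul
          ((A.continuous.comp_continuousOn (hEb.mono hts)).inner (hEb.mono hts)))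
      · have := hbdry s ⟨hs.1, hs.2.trans ht.2⟩
        linarith
    rw [intervalIntegral.integral_add (hi1.const_mul _) intervalIntegrable_const,
      intervalIntegral.integral_const_mul (-c₁), intervalIntegral.integral_const, sub_zero,
      smul_eq_mul] at h2
    have h3 := hsource t ht
    have h4 : t * β ≤ β * T := by rw [mul_comm]; gcongr; exact ht.2
    have h5 : (1 / 2 * y t) = 1 / 2 * ∫ x in (0 : ℝ)..(R + Λ * T),
      travelCutoff Λ T R t x * ‖E t x‖ ^ 2 := rfl
    linarith
  -- Young's inequality with weight `1 / 4`: after doubling, half of `Y` is left to absorb.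
  have hsqY : κ * √Y ≤ Y / 4 + κ ^ 2 := by
    nlinarith [sq_nonneg (√Y / 2 - κ), Real.sq_sqrt hY0]
  have hY4 : Y ≤ 4 * (β * T + α + κ ^ 2) := by
    have : Y ≤ 2 * (β * T + α + κ * √Y) := by
      have : Nonempty (Icc 0 T) := ⟨⟨0, le_rfl, hT⟩⟩
      refine ciSup_le fun t => ?_
      have h1 := hmain t t.2
      have h2 : 0 ≤ c₁ * ∫ s in (0 : ℝ)..t, ‖E s 0‖ ^ 2 :=
        mul_nonneg hc₁ (intervalIntegral.integral_nonneg t.2.1 fun s _ => sq_nonneg _)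
      linarith
    linarith
  refine ⟨fun t ht => (hyY t ht).trans hY4, ?_⟩
  have h1 := hmain T ⟨hT, le_rfl⟩
  have h2 := hy0 T
  linarith

/-- The energy estimate on the half line. -/
theorem energy_estimate (hA : ∀ x y, inner ℝ (A x) y = inner ℝ x (A y)) (hT : 0 ≤ T)
    (hcont : ContinuousOn (fun p : ℝ × ℝ => E p.1 p.2) (Icc 0 T ×ˢ Ici 0))
    (hdiff : ContDiffOn ℝ 1 (fun p : ℝ × ℝ => E p.1 p.2) (Ioo 0 T ×ˢ Ioi 0))
    (hinit : ∀ x ∈ Ici (0 : ℝ), E 0 x = 0)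
    (heq : ∀ t ∈ Ioo 0 T, ∀ x ∈ Ioi (0 : ℝ),
      deriv (fun s => E s x) t + A (deriv (fun y => E t y) x) = r t x)
    (hr : ∀ L, IntegrableOn (fun p : ℝ × ℝ => inner ℝ (r p.1 p.2) (E p.1 p.2))
      (Ioo 0 T ×ˢ Ioo 0 L))
    (hac : ContinuousOn (fun p : ℝ × ℝ => a p.1 p.2) (Ioo 0 T ×ˢ Ioi 0))
    (hbc : ContinuousOn (fun p : ℝ × ℝ => b p.1 p.2) (Ioo 0 T ×ˢ Ioi 0))
    (ha0 : ∀ t x, 0 ≤ a t x) (hb0 : ∀ t x, 0 ≤ b t x)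
    (hsrc : ∀ t ∈ Ioo 0 T, ∀ x ∈ Ioi (0 : ℝ),
      inner ℝ (r t x) (E t x) ≤ a t x + b t x * ‖E t x‖)
    (hα : 0 ≤ α) (hκ : 0 ≤ κ)
    (ha : ∫⁻ p in Ioo 0 T ×ˢ Ioi 0, ENNReal.ofReal (a p.1 p.2) ≤ ENNReal.ofReal α)
    (hb : ∫⁻ t in Ioo 0 T, eLpNorm (b t) 2 (volume.restrict (Ioi 0)) ≤ ENNReal.ofReal κ)
    (hc₁ : 0 < c₁) (hβ : 0 ≤ β)
    (hbdry : ∀ s ∈ Icc 0 T,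
      1 / 2 * inner ℝ (A (E s 0)) (E s 0) ≤ -(c₁ * ‖E s 0‖ ^ 2) + β) :
    (∀ t ∈ Icc 0 T, eLpNorm (E t) 2 (volume.restrict (Ioi 0)) ≤
      ENNReal.ofReal √(4 * (β * T + α + κ ^ 2))) ∧
    eLpNorm (fun s => E s 0) 2 (volume.restrict (Ioc 0 T)) ≤
      ENNReal.ofReal √(2 * (β * T + α + κ ^ 2) / c₁) := by
  have hN : 0 ≤ β * T + α + κ ^ 2 := by positivity
  have key := fun R (hR : 1 ≤ R) => weighted_energy_bound (Λ := ‖A‖) (R := R) hA A.le_opNorm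
    (norm_nonneg A) hR hT hcont hdiff hinit heq hr hac hbc ha0 hb0 hsrc hα hκ ha hb hc₁.le hβ hbdry
  constructor
  · intro t ht
    refine eLpNorm_two_le (by positivity) ?_
    have hU : Ioi (0 : ℝ) = ⋃ n : ℕ, Ioo (0 : ℝ) n := by
      ext x
      simp only [mem_Ioi, mem_iUnion, mem_Ioo]
      exact ⟨fun hx => (exists_nat_gt x).imp fun n hn => ⟨hx, hn⟩, fun ⟨n, hn⟩ => hn.1⟩
    have hmono : Monotone fun n : ℕ => Ioo (0 : ℝ) n := fun i j hij =>
      Ioo_subset_Ioo_right (by exact_mod_cast hij)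
    rw [hU, setLIntegral_iUnion_of_directed _ (hmono.directed_le)]
    refine iSup_le fun n => ?_
    have hn0 : (0 : ℝ) ≤ n := Nat.cast_nonneg n
    -- `R = n + 1` makes the cutoff equal to one on `(0, n)`; the bound does not depend on `n`, and
    -- monotone convergence gives the half line.
    set L : ℝ := (n + 1 : ℝ) + ‖A‖ * T with hL
    have hL0 : 0 ≤ L := by positivity
    have hnL : (n : ℝ) ≤ L := by
      have : 0 ≤ ‖A‖ * T := by positivity
      linarith
    have hEt : ContinuousOn (fun x => E t x) (Icc 0 L) :=
      hcont.comp (f := fun x => (t, x)) (by fun_prop) fun x hx => ⟨ht, hx.1⟩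
    have hφc : Continuous fun x => travelCutoff ‖A‖ T (n + 1) t x :=
      continuous_travelCutoff.comp (by fun_prop : Continuous fun x : ℝ => (t, x))
    calc ∫⁻ x in Ioo 0 (n : ℝ), ‖E t x‖ₑ ^ 2
        = ∫⁻ x in Ioo 0 (n : ℝ), ENNReal.ofReal (travelCutoff ‖A‖ T (n + 1) t x * ‖E t x‖ ^ 2) := by
          refine setLIntegral_congr_fun measurableSet_Ioo fun x hx => ?_
          rw [travelCutoff_eq_one (norm_nonneg A) ht.2 (by linarith [hx.2]), one_mul,
            ENNReal.ofReal_pow (norm_nonneg _), ofReal_norm]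
      _ ≤ ∫⁻ x in Ioc 0 L, ENNReal.ofReal (travelCutoff ‖A‖ T (n + 1) t x * ‖E t x‖ ^ 2) :=
          lintegral_mono_set fun x hx => ⟨hx.1, hx.2.le.trans hnL⟩
      _ = ENNReal.ofReal (∫ x in (0 : ℝ)..L, travelCutoff ‖A‖ T (n + 1) t x * ‖E t x‖ ^ 2) := by
          rw [intervalIntegral.integral_of_le hL0, ofReal_integral_eq_lintegral_ofReal]
          · exact ((hφc.continuousOn.mul (hEt.norm.pow 2)).integrableOn_Icc).mono_set
              Ioc_subset_Icc_self
          · exact Eventually.of_forall fun x => mul_nonneg (travelCutoff_nonneg _ _) (sq_nonneg _)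
      _ ≤ _ := ENNReal.ofReal_le_ofReal ((key (n + 1) (by linarith)).1 t ht)
  · refine eLpNorm_two_le (by positivity) ?_
    have hEb : ContinuousOn (fun s => E s 0) (Icc 0 T) :=
      hcont.comp (f := fun s => (s, (0 : ℝ))) (by fun_prop) fun s hs => ⟨hs, self_mem_Ici⟩
    calc ∫⁻ s in Ioc 0 T, ‖E s 0‖ₑ ^ 2 = ∫⁻ s in Ioc 0 T, ENNReal.ofReal (‖E s 0‖ ^ 2) := by
          refine lintegral_congr fun s => ?_
          rw [ENNReal.ofReal_pow (norm_nonneg _), ofReal_norm]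
      _ = ENNReal.ofReal (∫ s in (0 : ℝ)..T, ‖E s 0‖ ^ 2) := by
          rw [intervalIntegral.integral_of_le hT, ofReal_integral_eq_lintegral_ofReal]
          · exact ((hEb.norm.pow 2).integrableOn_Icc).mono_set Ioc_subset_Icc_self
          · exact Eventually.of_forall fun s => sq_nonneg _
      _ ≤ _ := by
          refine ENNReal.ofReal_le_ofReal ?_
          rw [le_div_iff₀ hc₁, mul_comm]
          exact (key 1 le_rfl).2

end Energy

/-! ### Dissipativity of the boundary condition -/

section Boundary

variable {n : Type*} [Fintype n] [DecidableEq n]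

/-- A positive definite matrix is bounded below. -/
theorem exists_pos_mul_norm_sq_le [Nonempty n] {S : Matrix n n ℝ} (hS : S.PosDef) :
    ∃ s > 0, ∀ x : EuclideanSpace ℝ n, s * ‖x‖ ^ 2 ≤ x.ofLp ⬝ᵥ S *ᵥ x.ofLp := by
  set q : EuclideanSpace ℝ n → ℝ := fun x => x.ofLp ⬝ᵥ S *ᵥ x.ofLp with hq
  have hqc : Continuous q := by
    have : q = fun x => inner ℝ x (Matrix.toEuclideanCLM (𝕜 := ℝ) S x) := by
      funext x; exact (Matrix.inner_toEuclideanCLM S x x).symm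
    rw [this]
    fun_prop
  have hpos : ∀ x : EuclideanSpace ℝ n, x ≠ 0 → 0 < q x := by
    intro x hx
    have h := hS.dotProduct_mulVec_pos (x := x.ofLp) (by simpa using hx)
    simpa using h
  obtain ⟨x₀, hx₀, hmin⟩ := (isCompact_sphere (0 : EuclideanSpace ℝ n) 1).exists_isMinOn
    (NormedSpace.sphere_nonempty.2 zero_le_one) hqc.continuousOn
  refine ⟨q x₀, hpos x₀ (ne_zero_of_mem_unit_sphere ⟨x₀, hx₀⟩), fun x => ?_⟩
  rcases eq_or_ne x 0 with rfl | hx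
  · simp
  · have hn : ‖x‖ ≠ 0 := norm_ne_zero_iff.2 hx
    have h1 : q x₀ ≤ q (‖x‖⁻¹ • x) :=
      hmin (by rw [mem_sphere_zero_iff_norm, norm_smul, norm_inv, norm_norm, inv_mul_cancel₀ hn])
    have h2 : q (‖x‖⁻¹ • x) = ‖x‖⁻¹ ^ 2 * q x := by
      simp only [hq, WithLp.ofLp_smul, Matrix.mulVec_smul, dotProduct_smul, smul_dotProduct,
        smul_eq_mul]
      ring
    rw [h2] at h1
    calc q x₀ * ‖x‖ ^ 2 ≤ ‖x‖⁻¹ ^ 2 * q x * ‖x‖ ^ 2 := by gcongr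
      _ = q x := by field_simp

/-- The matrix `B` as an operator on the Euclidean space of states. -/
noncomputable def boundaryOp {m : ℕ} (χ : ℝ) (S : Matrix (Fin (m + 1)) (Fin (m + 1)) ℝ)
    (x : State m) : EuclideanSpace ℝ (Fin (m + 1)) := WithLp.toLp 2 (Bc χ S *ᵥ x.ofLp)

theorem continuous_boundaryOp {m : ℕ} (χ : ℝ) (S : Matrix (Fin (m + 1)) (Fin (m + 1)) ℝ) :
    Continuous (boundaryOp χ S) := by
  unfold boundaryOp
  refine (PiLp.continuous_toLp 2 _).comp ?_
  exact (Continuous.matrix_mulVec continuous_const (PiLp.continuous_ofLp 2 _))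

/-- The boundary condition is strictly dissipative. -/
theorem exists_boundary_dissipation {m : ℕ} {χ : ℝ} (h0 : 0 < χ) (h1 : χ ≤ 1)
    {S : Matrix (Fin (m + 1)) (Fin (m + 1)) ℝ} (hS : S.PosDef) :
    ∃ c > 0, ∃ C ≥ 0, ∀ x : State m,
      1 / 2 * inner ℝ (Matrix.toEuclideanCLM (𝕜 := ℝ) (Ac m) x) x ≤
        -(c * ‖x‖ ^ 2) + C * ‖boundaryOp χ S x‖ ^ 2 := by
  obtain ⟨s, hs, hsS⟩ := exists_pos_mul_norm_sq_le hS
  set k := chiHat χ with hk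
  have hk0 : 0 < k := chiHat_pos h0 h1
  set P := Matrix.toEuclideanCLM (𝕜 := ℝ) (Mc m)⁻¹ with hP
  set R := Matrix.toEuclideanCLM (𝕜 := ℝ) ((Mc m)⁻¹ * S) with hR
  set N : ℝ := 1 + 2 * ‖P‖ ^ 2 + 2 * (k * ‖R‖) ^ 2 with hN
  have hN0 : 0 < N := by positivity
  -- With `g = B x` and `x = (e, o)`, the form is at most `-k s |e|² + |e| |g|`. Young's inequality
  -- spends half of `k s |e|²`, and `|x|² ≤ N (|e|² + |g|²)` spreads the rest over all moments.
  refine ⟨k * s / 2 / N, by positivity, k * s / 2 + 1 / (2 * (k * s)), by positivity, fun x => ?_⟩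
  set e : EuclideanSpace ℝ (Fin (m + 1)) := WithLp.toLp 2 (x.ofLp ∘ Sum.inl) with he
  set o : EuclideanSpace ℝ (Fin (m + 1)) := WithLp.toLp 2 (x.ofLp ∘ Sum.inr) with ho
  set g := boundaryOp χ S x with hg
  have hx : ‖x‖ ^ 2 = ‖e‖ ^ 2 + ‖o‖ ^ 2 := by
    simp [EuclideanSpace.real_norm_sq_eq, Fintype.sum_sum_type, he, ho]
  have hgo : Mc m *ᵥ o.ofLp = g.ofLp - k • (S *ᵥ e.ofLp) := by
    have : g.ofLp = k • (S *ᵥ e.ofLp) + Mc m *ᵥ o.ofLp := Bc_mulVec χ S x.ofLp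
    rw [this, add_sub_cancel_left]
  have hoo : o = P g - k • R e := by
    apply WithLp.ofLp_injective 2
    rw [WithLp.ofLp_sub, WithLp.ofLp_smul, hP, hR, Matrix.ofLp_toEuclideanCLM,
      Matrix.ofLp_toEuclideanCLM, ← Matrix.mulVec_mulVec, ← Matrix.mulVec_smul,
      ← Matrix.mulVec_sub, ← hgo, Matrix.mulVec_mulVec, Matrix.nonsing_inv_mul _ (isUnit_det_Mc m),
      Matrix.one_mulVec]
  have hon : ‖o‖ ^ 2 ≤ 2 * ‖P‖ ^ 2 * ‖g‖ ^ 2 + 2 * (k * ‖R‖) ^ 2 * ‖e‖ ^ 2 := by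
    have h2 : ‖o‖ ≤ ‖P‖ * ‖g‖ + k * ‖R‖ * ‖e‖ := by
      rw [hoo]
      refine (norm_sub_le _ _).trans (add_le_add (P.le_opNorm g) ?_)
      rw [norm_smul, Real.norm_of_nonneg hk0.le, mul_assoc]
      exact mul_le_mul_of_nonneg_left (R.le_opNorm e) hk0.le
    calc ‖o‖ ^ 2 ≤ (‖P‖ * ‖g‖ + k * ‖R‖ * ‖e‖) ^ 2 := by gcongr
      _ ≤ _ := by nlinarith [sq_nonneg (‖P‖ * ‖g‖ - k * ‖R‖ * ‖e‖)]
  -- Half of `A x · x` is `e · M o`, and the boundary operator gives `M o = g - k S e`.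
  have hform : 1 / 2 * inner ℝ (Matrix.toEuclideanCLM (𝕜 := ℝ) (Ac m) x) x =
      inner ℝ e g - k * (e.ofLp ⬝ᵥ S *ᵥ e.ofLp) := by
    have h3 : inner ℝ (Matrix.toEuclideanCLM (𝕜 := ℝ) (Ac m) x) x =
        2 * (e.ofLp ⬝ᵥ Mc m *ᵥ o.ofLp) := by
      rw [real_inner_comm, Matrix.inner_toEuclideanCLM, Ac_mulVec]
      have h4 : x.ofLp ⬝ᵥ Sum.elim (Mc m *ᵥ o.ofLp) ((Mc m)ᵀ *ᵥ e.ofLp) =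
          e.ofLp ⬝ᵥ Mc m *ᵥ o.ofLp + o.ofLp ⬝ᵥ (Mc m)ᵀ *ᵥ e.ofLp := by
        simp [dotProduct, Fintype.sum_sum_type, he, ho]
      refine h4.trans ?_
      rw [Matrix.mulVec_transpose, dotProduct_comm o.ofLp, ← Matrix.dotProduct_mulVec]
      ring
    have h5 : inner ℝ e g = e.ofLp ⬝ᵥ g.ofLp := by
      rw [EuclideanSpace.inner_eq_star_dotProduct, dotProduct_comm]
      simp
    rw [h3, hgo, h5, dotProduct_sub, dotProduct_smul, smul_eq_mul]
    ring
  rw [hform]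
  have h6 : inner ℝ e g ≤ ‖e‖ * ‖g‖ := real_inner_le_norm e g
  have h7 : k * s * ‖e‖ ^ 2 ≤ k * (e.ofLp ⬝ᵥ S *ᵥ e.ofLp) := by
    rw [mul_assoc]; exact mul_le_mul_of_nonneg_left (hsS e) hk0.le
  have hks : 0 < k * s := by positivity
  have h8 : ‖e‖ * ‖g‖ ≤ k * s / 2 * ‖e‖ ^ 2 + 1 / (2 * (k * s)) * ‖g‖ ^ 2 := by
    have : k * s / 2 * ‖e‖ ^ 2 + 1 / (2 * (k * s)) * ‖g‖ ^ 2 - ‖e‖ * ‖g‖ =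
        (k * s * ‖e‖ - ‖g‖) ^ 2 / (2 * (k * s)) := by field_simp; ring
    have h9 : 0 ≤ (k * s * ‖e‖ - ‖g‖) ^ 2 / (2 * (k * s)) := by positivity
    linarith
  have h9 : ‖x‖ ^ 2 / N ≤ ‖e‖ ^ 2 + ‖g‖ ^ 2 := by
    rw [div_le_iff₀ hN0, hx, hN]
    nlinarith [sq_nonneg ‖P‖, sq_nonneg (k * ‖R‖), sq_nonneg ‖e‖, sq_nonneg ‖g‖,
      mul_nonneg (sq_nonneg ‖P‖) (sq_nonneg ‖e‖), mul_nonneg (sq_nonneg (k * ‖R‖)) (sq_nonneg ‖g‖)]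
  have h10 : k * s / 2 / N * ‖x‖ ^ 2 ≤ k * s / 2 * (‖e‖ ^ 2 + ‖g‖ ^ 2) := by
    calc k * s / 2 / N * ‖x‖ ^ 2 = k * s / 2 * (‖x‖ ^ 2 / N) := by ring
      _ ≤ _ := by gcongr
  nlinarith

end Boundary

/-! ### Rescaling and time slices of square norms -/

section Scaling

/-- Rescaling the space variable in the `L²` norm on the half line. -/
theorem eLpNorm_comp_div {F : Type*} [NormedAddCommGroup F] (f : ℝ → F) {δ : ℝ} (hδ : 0 < δ) :
    eLpNorm (fun x => f (x / δ)) 2 (volume.restrict (Ioi 0)) =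
      ENNReal.ofReal √δ * eLpNorm f 2 (volume.restrict (Ioi 0)) := by
  have hemb : MeasurableEmbedding fun x : ℝ => δ⁻¹ * x :=
    (Homeomorph.mulLeft₀ δ⁻¹ (inv_ne_zero hδ.ne')).measurableEmbedding
  have hpre : (fun x : ℝ => δ⁻¹ * x) ⁻¹' Ioi 0 = Ioi 0 := by
    ext x
    simp [hδ]
  have hmap : Measure.map (fun x : ℝ => δ⁻¹ * x) (volume.restrict (Ioi 0)) =
      ENNReal.ofReal δ • volume.restrict (Ioi 0) := by
    have h := hemb.restrict_map volume (Ioi 0)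
    rw [hpre, Real.map_volume_mul_left (inv_ne_zero hδ.ne'), inv_inv, abs_of_pos hδ] at h
    rw [← h, Measure.restrict_smul]
  have h := hemb.eLpNorm_map_measure (g := f) (p := 2) (μ := volume.restrict (Ioi 0))
  rw [hmap, eLpNorm_smul_measure_of_ne_top (by norm_num)] at h
  have h2 : (fun x => f (x / δ)) = f ∘ fun x => δ⁻¹ * x := by
    funext x
    rw [Function.comp_apply, div_eq_inv_mul]
  rw [h2, ← h, smul_eq_mul]
  congr 1
  rw [ENNReal.ofReal_rpow_of_pos hδ, Real.sqrt_eq_rpow]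
  norm_num

end Scaling

section Slices

variable {F : Type*} [NormedAddCommGroup F] {T : ℝ} {f : ℝ → ℝ → F}

theorem aemeasurable_enorm_sq_prod
    (hf : ContinuousOn (fun p : ℝ × ℝ => f p.1 p.2) (Ioo 0 T ×ˢ Ioi 0)) :
    AEMeasurable (fun p : ℝ × ℝ => ‖f p.1 p.2‖ₑ ^ 2)
      (((volume : Measure ℝ).restrict (Ioo 0 T)).prod ((volume : Measure ℝ).restrict (Ioi 0))) := by
  rw [Measure.prod_restrict]
  exact ((continuous_enorm.comp_continuousOn hf).aemeasurable
    (measurableSet_Ioo.prod measurableSet_Ioi)).pow_const 2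

theorem lintegral_enorm_sq_prod
    (hf : ContinuousOn (fun p : ℝ × ℝ => f p.1 p.2) (Ioo 0 T ×ˢ Ioi 0)) :
    ∫⁻ p in Ioo 0 T ×ˢ Ioi 0, ‖f p.1 p.2‖ₑ ^ 2 =
      ∫⁻ t in Ioo 0 T, eLpNorm (f t) 2 (volume.restrict (Ioi 0)) ^ 2 := by
  rw [Measure.volume_eq_prod, ← Measure.prod_restrict,
    lintegral_prod _ (aemeasurable_enorm_sq_prod hf)]
  simp only [eLpNorm_two_sq]

theorem aemeasurable_eLpNorm_slice
    (hf : ContinuousOn (fun p : ℝ × ℝ => f p.1 p.2) (Ioo 0 T ×ˢ Ioi 0)) :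
    AEMeasurable (fun t => eLpNorm (f t) 2 (volume.restrict (Ioi 0)))
      (volume.restrict (Ioo 0 T)) := by
  have h : (fun t => eLpNorm (f t) 2 (volume.restrict (Ioi 0))) =
      fun t => (∫⁻ x in Ioi 0, ‖f t x‖ₑ ^ 2) ^ (1 / 2 : ℝ) := by
    funext t
    rw [← eLpNorm_two_sq, ← ENNReal.rpow_natCast, ← ENNReal.rpow_mul]
    norm_num
  rw [h]
  exact (aemeasurable_enorm_sq_prod hf).lintegral_prod_right'.pow_const _

/-- On a bounded time interval `L²` in time implies `L¹` in time, by `a ≤ 1 + a²`. -/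
theorem lintegral_eLpNorm_lt_top_of_memLp
    (hf : ContinuousOn (fun p : ℝ × ℝ => f p.1 p.2) (Ioo 0 T ×ˢ Ioi 0))
    (h : MemLp (fun p : ℝ × ℝ => f p.1 p.2) 2 (volume.restrict (Ioo 0 T ×ˢ Ioi 0))) :
    ∫⁻ t in Ioo 0 T, eLpNorm (f t) 2 (volume.restrict (Ioi 0)) < ⊤ := by
  have h1 : ∫⁻ t in Ioo 0 T, eLpNorm (f t) 2 (volume.restrict (Ioi 0)) ^ 2 < ⊤ := by
    rw [← lintegral_enorm_sq_prod hf, ← eLpNorm_two_sq (fun p : ℝ × ℝ => f p.1 p.2)]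
    exact ENNReal.pow_lt_top h.2
  calc ∫⁻ t in Ioo 0 T, eLpNorm (f t) 2 (volume.restrict (Ioi 0))
      ≤ ∫⁻ t in Ioo 0 T, (1 + eLpNorm (f t) 2 (volume.restrict (Ioi 0)) ^ 2) := by
        refine lintegral_mono fun t => ?_
        rcases le_total (eLpNorm (f t) 2 (volume.restrict (Ioi 0))) 1 with h2 | h2
        · exact h2.trans le_self_add
        · exact (le_self_pow h2 two_ne_zero).trans le_add_self
    _ < ⊤ := by
        rw [lintegral_add_left measurable_const]
        refine ENNReal.add_lt_top.2 ⟨?_, h1⟩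
        simp

/-- Cauchy–Schwarz against the constant one on `(0, L)`. The divergence theorem needs this
integrability of the source. -/
theorem integrableOn_prod_of_lintegral_eLpNorm
    (hf : ContinuousOn (fun p : ℝ × ℝ => f p.1 p.2) (Ioo 0 T ×ˢ Ioi 0))
    (h : ∫⁻ t in Ioo 0 T, eLpNorm (f t) 2 (volume.restrict (Ioi 0)) < ⊤) (L : ℝ) :
    IntegrableOn (fun p : ℝ × ℝ => f p.1 p.2) (Ioo 0 T ×ˢ Ioo 0 L) := by
  have hs : (Ioo 0 T ×ˢ Ioo 0 L : Set (ℝ × ℝ)) ⊆ Ioo 0 T ×ˢ Ioi 0 :=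
    prod_mono_right Ioo_subset_Ioi_self
  refine ⟨(hf.mono hs).aestronglyMeasurable (measurableSet_Ioo.prod measurableSet_Ioo), ?_⟩
  have h1 : MemLp (fun _ : ℝ => (1 : ℝ)) 2 (volume.restrict (Ioo 0 L)) := memLp_const 1
  have h2 := lintegral_prod_enorm_mul_le (L := L) (f := fun t x => ‖f t x‖) (g := fun _ _ => 1)
    h1.2.ne hf.norm continuousOn_const fun t _ => le_rfl
  simp only [mul_one, enorm_norm, eLpNorm_norm] at h2
  exact h2.trans_lt (ENNReal.mul_lt_top h h1.2)

end Slices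

/-! ### Partial derivatives and rescaled layer functions -/

section Partials

variable {F : Type*} [NormedAddCommGroup F] [NormedSpace ℝ F] {s : Set (ℝ × ℝ)} {f : ℝ → ℝ → F}

theorem hasDerivAt_fst_of_contDiffOn (hs : IsOpen s)
    (hf : ContDiffOn ℝ 1 (fun p : ℝ × ℝ => f p.1 p.2) s) {t x : ℝ} (h : (t, x) ∈ s) :
    HasDerivAt (fun r => f r x) (fderiv ℝ (fun p : ℝ × ℝ => f p.1 p.2) (t, x) (1, 0)) t := by
  have h1 := ((hf.contDiffAt (hs.mem_nhds h)).differentiableAt one_ne_zero).hasFDerivAt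
  exact h1.comp_hasDerivAt (f := fun r => (r, x)) t ((hasDerivAt_id t).prodMk (hasDerivAt_const t x))

theorem hasDerivAt_snd_of_contDiffOn (hs : IsOpen s)
    (hf : ContDiffOn ℝ 1 (fun p : ℝ × ℝ => f p.1 p.2) s) {t x : ℝ} (h : (t, x) ∈ s) :
    HasDerivAt (fun y => f t y) (fderiv ℝ (fun p : ℝ × ℝ => f p.1 p.2) (t, x) (0, 1)) x := by
  have h1 := ((hf.contDiffAt (hs.mem_nhds h)).differentiableAt one_ne_zero).hasFDerivAt
  exact h1.comp_hasDerivAt (f := fun y => (t, y)) x ((hasDerivAt_const x t).prodMk (hasDerivAt_id x))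

theorem continuousOn_fderiv_apply (hs : IsOpen s)
    (hf : ContDiffOn ℝ 1 (fun p : ℝ × ℝ => f p.1 p.2) s) (v : ℝ × ℝ) :
    ContinuousOn (fun q => fderiv ℝ (fun p : ℝ × ℝ => f p.1 p.2) q v) s :=
  (hf.continuousOn_fderiv_of_isOpen hs le_rfl).clm_apply continuousOn_const

end Partials

namespace IsLayerFunction

variable {m : ℕ} {U : ℝ → ℝ → State m}

theorem hasDerivAt_time (hU : IsLayerFunction U) {t y : ℝ} (ht : 0 < t) (hy : 0 < y) :
    HasDerivAt (fun s => U s y) (dTime U t y) t :=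
  (hasDerivAt_fst_of_contDiffOn (isOpen_Ioi.prod isOpen_Ioi) hU.contDiffOn
    ⟨ht, hy⟩).differentiableAt.hasDerivAt

theorem hasDerivAt_space (hU : IsLayerFunction U) {t y : ℝ} (ht : 0 < t) (hy : 0 < y) :
    HasDerivAt (fun y => U t y) (dSpace U t y) y :=
  (hasDerivAt_snd_of_contDiffOn (isOpen_Ioi.prod isOpen_Ioi) hU.contDiffOn
    ⟨ht, hy⟩).differentiableAt.hasDerivAt

theorem continuousOn_dTime (hU : IsLayerFunction U) :
    ContinuousOn (fun p : ℝ × ℝ => dTime U p.1 p.2) (Ioi 0 ×ˢ Ioi 0) :=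
  (continuousOn_fderiv_apply (isOpen_Ioi.prod isOpen_Ioi) hU.contDiffOn (1, 0)).congr fun _ hp =>
    (hasDerivAt_fst_of_contDiffOn (isOpen_Ioi.prod isOpen_Ioi) hU.contDiffOn hp).deriv

theorem continuousOn_dSpace (hU : IsLayerFunction U) :
    ContinuousOn (fun p : ℝ × ℝ => dSpace U p.1 p.2) (Ioi 0 ×ˢ Ioi 0) :=
  (continuousOn_fderiv_apply (isOpen_Ioi.prod isOpen_Ioi) hU.contDiffOn (0, 1)).congr fun _ hp =>
    (hasDerivAt_snd_of_contDiffOn (isOpen_Ioi.prod isOpen_Ioi) hU.contDiffOn hp).deriv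

/-- The layer function with the space variable rescaled is again a layer function. -/
theorem comp_div (hU : IsLayerFunction U) {δ : ℝ} (hδ : 0 < δ) :
    IsLayerFunction fun t x => U t (x / δ) where
  continuousOn := hU.continuousOn.comp (f := fun p : ℝ × ℝ => (p.1, p.2 / δ)) (by fun_prop)
    fun p hp => ⟨hp.1, div_nonneg hp.2 hδ.le⟩
  contDiffOn := hU.contDiffOn.comp (f := fun p : ℝ × ℝ => (p.1, p.2 / δ))
    (contDiff_fst.prodMk (contDiff_snd.div_const δ)).contDiffOn fun p hp => ⟨hp.1, div_pos hp.2 hδ⟩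
  initial x hx := hU.initial _ (div_nonneg hx hδ.le)
  decay t ht := (hU.decay t ht).comp (tendsto_id.atTop_div_const hδ)

theorem hasDerivAt_space_comp_div (hU : IsLayerFunction U) {δ t x : ℝ} (hδ : 0 < δ) (ht : 0 < t)
    (hx : 0 < x) : HasDerivAt (fun x => U t (x / δ)) (δ⁻¹ • dSpace U t (x / δ)) x := by
  have h := (hU.hasDerivAt_space ht (div_pos hx hδ)).scomp x ((hasDerivAt_id x).div_const δ)
  simpa [Function.comp_def] using h

theorem smul (hU : IsLayerFunction U) (c : ℝ) : IsLayerFunction fun t x => c • U t x where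
  continuousOn := hU.continuousOn.const_smul c
  contDiffOn := hU.contDiffOn.const_smul c
  initial x hx := by rw [hU.initial x hx, smul_zero]
  decay t ht := by simpa using (hU.decay t ht).const_smul c

theorem add {U' : ℝ → ℝ → State m} (hU : IsLayerFunction U) (hU' : IsLayerFunction U') :
    IsLayerFunction fun t x => U t x + U' t x where
  continuousOn := hU.continuousOn.add hU'.continuousOn
  contDiffOn := hU.contDiffOn.add hU'.contDiffOn
  initial x hx := by rw [hU.initial x hx, hU'.initial x hx, add_zero]
  decay t ht := by simpa using (hU.decay t ht).add (hU'.decay t ht)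

end IsLayerFunction

/-! ### The residual of the approximation -/

section Approximation

variable {m : ℕ} {V K : Fin 4 → ℝ → ℝ → State m}

/-- With `ε = η²` all scales and amplitudes become integer powers of `η`, so the cancellation of
orders is polynomial algebra. -/
theorem Wapp_sq {η : ℝ} (hη : 0 < η) (t x : ℝ) :
    Wapp V K (η ^ 2) t x =
      (V 0 t (x / η) + η • V 1 t (x / η) + η ^ 2 • V 2 t (x / η) + η ^ 3 • V 3 t (x / η)) +
      (K 0 t (x / η ^ 2) + η • K 1 t (x / η ^ 2) + η ^ 2 • K 2 t (x / η ^ 2) +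
        η ^ 3 • K 3 t (x / η ^ 2)) := by
  simp [Wapp, outerApp, viscousApp, knudsenApp, Fin.sum_univ_four, Real.sqrt_sq hη.le]

/-- The approximate solution is itself a layer function. -/
theorem isLayerFunction_Wapp (hV : ∀ j, IsLayerFunction (V j)) (hK : ∀ j, IsLayerFunction (K j))
    {η : ℝ} (hη : 0 < η) : IsLayerFunction (Wapp V K (η ^ 2)) := by
  have h : Wapp V K (η ^ 2) = _ := funext fun t => funext fun x => Wapp_sq hη t x
  rw [h]
  have hv := fun j => (hV j).comp_div hη
  have hk := fun j => (hK j).comp_div (pow_pos hη 2)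
  exact (((hv 0).add ((hv 1).smul η)).add ((hv 2).smul (η ^ 2))).add ((hv 3).smul (η ^ 3)) |>.add
    ((((hk 0).add ((hk 1).smul η)).add ((hk 2).smul (η ^ 2))).add ((hk 3).smul (η ^ 3)))

/-- The part of the residual of order `ε` that lives on the viscous scale. -/
noncomputable def viscousResidual (V : Fin 4 → ℝ → ℝ → State m) (t y : ℝ) : State m :=
  dTime (V 2) t y + Matrix.toEuclideanCLM (𝕜 := ℝ) (Ac m) (dSpace (V 3) t y)

/-- The part of the residual that is controlled by time derivatives of the coefficients. -/
noncomputable def timeResidual (V K : Fin 4 → ℝ → ℝ → State m) (η t x : ℝ) : State m :=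
  η ^ 3 • dTime (V 3) t (x / η) + η ^ 2 • dTime (K 2) t (x / η ^ 2) +
    η ^ 3 • dTime (K 3) t (x / η ^ 2)

/-- The residual of the approximate solution in the system. -/
theorem Wapp_residual (hV : IsViscousLayer V) (hK : IsKnudsenLayer K) {η t x : ℝ} (hη : 0 < η)
    (ht : 0 < t) (hx : 0 < x) :
    dTime (Wapp V K (η ^ 2)) t x +
        Matrix.toEuclideanCLM (𝕜 := ℝ) (Ac m) (dSpace (Wapp V K (η ^ 2)) t x) +
        (1 / η ^ 2) • Matrix.toEuclideanCLM (𝕜 := ℝ) (Qc m) (Wapp V K (η ^ 2) t x) =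
      η ^ 2 • viscousResidual V t (x / η) + timeResidual V K η t x := by
  have hη2 : 0 < η ^ 2 := by positivity
  have hy : 0 < x / η := by positivity
  have hz : 0 < x / η ^ 2 := by positivity
  have hW : Wapp V K (η ^ 2) = _ := funext fun t => funext fun x => Wapp_sq hη t x
  have vt := fun j => (hV.layer j).hasDerivAt_time ht hy
  have kt := fun j => (hK.layer j).hasDerivAt_time ht hz
  have vx := fun j => (hV.layer j).hasDerivAt_space_comp_div hη ht hx
  have kx := fun j => (hK.layer j).hasDerivAt_space_comp_div hη2 ht hx
  have h1 := (((((vt 0).add ((vt 1).const_smul η)).add ((vt 2).const_smul (η ^ 2))).add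
    ((vt 3).const_smul (η ^ 3))).add ((((kt 0).add ((kt 1).const_smul η)).add
    ((kt 2).const_smul (η ^ 2))).add ((kt 3).const_smul (η ^ 3)))).deriv
  have h2 := (((((vx 0).add ((vx 1).const_smul η)).add ((vx 2).const_smul (η ^ 2))).add
    ((vx 3).const_smul (η ^ 3))).add ((((kx 0).add ((kx 1).const_smul η)).add
    ((kx 2).const_smul (η ^ 2))).add ((kx 3).const_smul (η ^ 3)))).deriv
  have e1 := (congrArg (fun U => dTime U t x) hW).trans h1
  have e2 := (congrArg (fun U => dSpace U t x) hW).trans h2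
  beta_reduce at e1 e2
  rw [e1, e2, Wapp_sq hη, viscousResidual, timeResidual]
  set A := Matrix.toEuclideanCLM (𝕜 := ℝ) (Ac m)
  set Q := Matrix.toEuclideanCLM (𝕜 := ℝ) (Qc m)
  have a0 : Q (V 0 t (x / η)) = 0 := congrArg (WithLp.toLp 2) (hV.order_neg_one t ht _ hy)
  have a1 : A (dSpace (V 0) t (x / η)) + Q (V 1 t (x / η)) = 0 :=
    congrArg (WithLp.toLp 2) (hV.order_neg_half t ht _ hy)
  have a2 : dTime (V 0) t (x / η) + A (dSpace (V 1) t (x / η)) + Q (V 2 t (x / η)) = 0 :=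
    congrArg (WithLp.toLp 2) (hV.order_zero t ht _ hy)
  have a3 : dTime (V 1) t (x / η) + A (dSpace (V 2) t (x / η)) + Q (V 3 t (x / η)) = 0 :=
    congrArg (WithLp.toLp 2) (hV.order_half t ht _ hy)
  have b0 : A (dSpace (K 0) t (x / η ^ 2)) + Q (K 0 t (x / η ^ 2)) = 0 :=
    congrArg (WithLp.toLp 2) (hK.order_neg_one t ht _ hz)
  have b1 : A (dSpace (K 1) t (x / η ^ 2)) + Q (K 1 t (x / η ^ 2)) = 0 :=
    congrArg (WithLp.toLp 2) (hK.order_neg_half t ht _ hz)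
  have b2 : dTime (K 0) t (x / η ^ 2) + A (dSpace (K 2) t (x / η ^ 2)) + Q (K 2 t (x / η ^ 2)) = 0 :=
    congrArg (WithLp.toLp 2) (hK.order_zero t ht _ hz)
  have b3 : dTime (K 1) t (x / η ^ 2) + A (dSpace (K 3) t (x / η ^ 2)) + Q (K 3 t (x / η ^ 2)) = 0 :=
    congrArg (WithLp.toLp 2) (hK.order_half t ht _ hz)
  simp only [map_add, map_smul]
  rw [a0]
  -- Each equation enters with the power of `η` of its order: a space derivative costs `η⁻¹` on the
  -- viscous scale and `η⁻²` on the Knudsen scale.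
  linear_combination (norm := skip) η⁻¹ • a1 + a2 + η • a3 + (η⁻¹ ^ 2) • b0 + η⁻¹ • b1 + b2 + η • b3
  match_scalars <;> field_simp <;> ring

end Approximation

/-! ### Size of the residual -/

section Source

variable {m : ℕ} {V K : Fin 4 → ℝ → ℝ → State m} {T η : ℝ}

theorem continuousOn_comp_space_div {F : Type*} [TopologicalSpace F] {f : ℝ → ℝ → F}
    (hf : ContinuousOn (fun p : ℝ × ℝ => f p.1 p.2) (Ioi 0 ×ˢ Ioi 0)) {δ : ℝ} (hδ : 0 < δ) :
    ContinuousOn (fun p : ℝ × ℝ => f p.1 (p.2 / δ)) (Ioo 0 T ×ˢ Ioi 0) :=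
  hf.comp (f := fun p : ℝ × ℝ => (p.1, p.2 / δ)) (by fun_prop)
    fun _ hp => ⟨hp.1.1, div_pos hp.2 hδ⟩

theorem continuousOn_viscousResidual (hV : IsViscousLayer V) :
    ContinuousOn (fun p : ℝ × ℝ => viscousResidual V p.1 p.2) (Ioi 0 ×ˢ Ioi 0) :=
  (hV.layer 2).continuousOn_dTime.add
    ((Matrix.toEuclideanCLM (𝕜 := ℝ) (Ac m)).continuous.comp_continuousOn
      (hV.layer 3).continuousOn_dSpace)

theorem memLp_viscousResidual (hV : IsViscousLayer V) (hT : 0 < T) :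
    MemLp (fun p : ℝ × ℝ => viscousResidual V p.1 p.2) 2
      (volume.restrict (Ioo 0 T ×ˢ Ioi 0)) :=
  (hV.memLp_dTime 2 T hT).add
    ((Matrix.toEuclideanCLM (𝕜 := ℝ) (Ac m)).comp_memLp' (hV.memLp_dSpace 3 T hT))

theorem subset_quadrant (T : ℝ) : (Ioo 0 T ×ˢ Ioi 0 : Set (ℝ × ℝ)) ⊆ Ioi 0 ×ˢ Ioi 0 :=
  prod_mono_left Ioo_subset_Ioi_self

/-- Rescaling the space variable in mixed `L¹L²` norms. -/
theorem lintegral_eLpNorm_comp_div {F : Type*} [NormedAddCommGroup F] (f : ℝ → ℝ → F) {δ : ℝ}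
    (hδ : 0 < δ) :
    ∫⁻ t in Ioo 0 T, eLpNorm (fun x => f t (x / δ)) 2 (volume.restrict (Ioi 0)) =
      ENNReal.ofReal √δ * ∫⁻ t in Ioo 0 T, eLpNorm (f t) 2 (volume.restrict (Ioi 0)) := by
  simp only [eLpNorm_comp_div _ hδ]
  exact lintegral_const_mul' _ _ ENNReal.ofReal_ne_top

/-- A pointwise bound for the time derivatives in the residual. -/
noncomputable def timeSource (V K : Fin 4 → ℝ → ℝ → State m) (η t x : ℝ) : ℝ :=
  η ^ 3 * ‖dTime (V 3) t (x / η)‖ + η ^ 2 * ‖dTime (K 2) t (x / η ^ 2)‖ +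
    η ^ 3 * ‖dTime (K 3) t (x / η ^ 2)‖

theorem timeSource_nonneg (hη : 0 < η) (t x : ℝ) : 0 ≤ timeSource V K η t x := by
  unfold timeSource
  positivity

theorem norm_timeResidual_le (hη : 0 < η) (t x : ℝ) :
    ‖timeResidual V K η t x‖ ≤ timeSource V K η t x := by
  refine (norm_add₃_le).trans ?_
  simp only [norm_smul, norm_pow, Real.norm_of_nonneg hη.le]
  exact le_rfl

theorem continuousOn_timeSource (hV : IsViscousLayer V) (hK : IsKnudsenLayer K) (hη : 0 < η) :
    ContinuousOn (fun p : ℝ × ℝ => timeSource V K η p.1 p.2) (Ioo 0 T ×ˢ Ioi 0) := by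
  have h1 := (continuousOn_comp_space_div (T := T) (hV.layer 3).continuousOn_dTime hη).norm
  have h2 := (continuousOn_comp_space_div (T := T) (hK.layer 2).continuousOn_dTime
    (pow_pos hη 2)).norm
  have h3 := (continuousOn_comp_space_div (T := T) (hK.layer 3).continuousOn_dTime
    (pow_pos hη 2)).norm
  exact ((continuousOn_const.mul h1).add (continuousOn_const.mul h2)).add
    (continuousOn_const.mul h3)

/-- The time derivatives in the residual are of order `ε^{3/2}`. -/
theorem exists_lintegral_timeSource_le (hV : IsViscousLayer V) (hK : IsKnudsenLayer K)
    (hT : 0 < T) : ∃ k ≥ 0, ∀ η, 0 < η → η ≤ 1 →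
      ∫⁻ t in Ioo 0 T, eLpNorm (timeSource V K η t) 2 (volume.restrict (Ioi 0)) ≤
        ENNReal.ofReal (η ^ 3 * k) := by
  set N : (ℝ → ℝ → State m) → ℝ≥0∞ := fun f =>
    ∫⁻ t in Ioo 0 T, eLpNorm (f t) 2 (volume.restrict (Ioi 0)) with hN
  have hVN : N (dTime (V 3)) < ⊤ := lintegral_eLpNorm_lt_top_of_memLp
    ((hV.layer 3).continuousOn_dTime.mono (subset_quadrant T)) (hV.memLp_dTime 3 T hT)
  have hK2 : N (dTime (K 2)) < ⊤ := hK.integrable_dTime 2 T hT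
  have hK3 : N (dTime (K 3)) < ⊤ := hK.integrable_dTime 3 T hT
  have hne : N (dTime (V 3)) + N (dTime (K 2)) + N (dTime (K 3)) ≠ ⊤ :=
    (ENNReal.add_lt_top.2 ⟨ENNReal.add_lt_top.2 ⟨hVN, hK2⟩, hK3⟩).ne
  refine ⟨(N (dTime (V 3)) + N (dTime (K 2)) + N (dTime (K 3))).toReal, ENNReal.toReal_nonneg,
    fun η hη hη1 => ?_⟩
  have hη2 : 0 < η ^ 2 := by positivity
  have c1 := continuousOn_comp_space_div (T := T) (hV.layer 3).continuousOn_dTime hη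
  have c2 := continuousOn_comp_space_div (T := T) (hK.layer 2).continuousOn_dTime hη2
  have c3 := continuousOn_comp_space_div (T := T) (hK.layer 3).continuousOn_dTime hη2
  have hsl : ∀ (f : ℝ → ℝ → State m) (c : ℝ),
      ContinuousOn (fun p : ℝ × ℝ => f p.1 p.2) (Ioo 0 T ×ˢ Ioi 0) → ∀ t ∈ Ioo 0 T,
      AEStronglyMeasurable (fun x => c * ‖f t x‖) (volume.restrict (Ioi 0)) :=
    fun f c hf t ht => (continuousOn_const.mul (hf.comp (f := fun x => (t, x)) (by fun_prop)
      fun x hx => ⟨ht, hx⟩).norm).aestronglyMeasurable measurableSet_Ioi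
  have hcm : ∀ (c : ℝ) (f : ℝ → State m), 0 ≤ c →
      eLpNorm (fun x => c * ‖f x‖) 2 (volume.restrict (Ioi 0)) =
        ENNReal.ofReal c * eLpNorm f 2 (volume.restrict (Ioi 0)) := by
    intro c f hc
    have h := eLpNorm_const_smul c (fun x => ‖f x‖) 2 (volume.restrict (Ioi 0))
    rw [eLpNorm_norm, Real.enorm_of_nonneg hc] at h
    exact h
  have hsum : ∀ t ∈ Ioo 0 T, eLpNorm (timeSource V K η t) 2 (volume.restrict (Ioi 0)) ≤
      ENNReal.ofReal (η ^ 3) *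
          eLpNorm (fun x => dTime (V 3) t (x / η)) 2 (volume.restrict (Ioi 0)) +
        ENNReal.ofReal (η ^ 2) *
          eLpNorm (fun x => dTime (K 2) t (x / η ^ 2)) 2 (volume.restrict (Ioi 0)) +
        ENNReal.ofReal (η ^ 3) *
          eLpNorm (fun x => dTime (K 3) t (x / η ^ 2)) 2 (volume.restrict (Ioi 0)) := by
    intro t ht
    rw [← hcm _ _ (by positivity), ← hcm _ _ (by positivity), ← hcm _ _ (by positivity)]
    have hf : timeSource V K η t = ((fun x => η ^ 3 * ‖dTime (V 3) t (x / η)‖) +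
        fun x => η ^ 2 * ‖dTime (K 2) t (x / η ^ 2)‖) +
        fun x => η ^ 3 * ‖dTime (K 3) t (x / η ^ 2)‖ := rfl
    rw [hf]
    have m1 := hsl (fun t x => dTime (V 3) t (x / η)) (η ^ 3) c1 t ht
    have m2 := hsl (fun t x => dTime (K 2) t (x / η ^ 2)) (η ^ 2) c2 t ht
    have m3 := hsl (fun t x => dTime (K 3) t (x / η ^ 2)) (η ^ 3) c3 t ht
    exact (eLpNorm_add_le (m1.add m2) m3 one_le_two).trans
      (add_le_add_left (eLpNorm_add_le m1 m2 one_le_two) _)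
  calc ∫⁻ t in Ioo 0 T, eLpNorm (timeSource V K η t) 2 (volume.restrict (Ioi 0))
      ≤ ENNReal.ofReal (η ^ 3) * (ENNReal.ofReal √η * N (dTime (V 3))) +
        ENNReal.ofReal (η ^ 2) * (ENNReal.ofReal √(η ^ 2) * N (dTime (K 2))) +
        ENNReal.ofReal (η ^ 3) * (ENNReal.ofReal √(η ^ 2) * N (dTime (K 3))) := by
        refine (setLIntegral_mono' measurableSet_Ioo hsum).trans_eq ?_
        rw [lintegral_add_right' _ ((aemeasurable_eLpNorm_slice
            (f := fun t x => dTime (K 3) t (x / η ^ 2)) c3).const_mul _),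
          lintegral_add_right' _ ((aemeasurable_eLpNorm_slice
            (f := fun t x => dTime (K 2) t (x / η ^ 2)) c2).const_mul _),
          lintegral_const_mul' _ _ ENNReal.ofReal_ne_top,
          lintegral_const_mul' _ _ ENNReal.ofReal_ne_top,
          lintegral_const_mul' _ _ ENNReal.ofReal_ne_top, lintegral_eLpNorm_comp_div _ hη,
          lintegral_eLpNorm_comp_div _ hη2, lintegral_eLpNorm_comp_div _ hη2]
    _ ≤ ENNReal.ofReal (η ^ 3) * (1 * N (dTime (V 3))) +
        ENNReal.ofReal (η ^ 3) * N (dTime (K 2)) +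
        ENNReal.ofReal (η ^ 3) * (1 * N (dTime (K 3))) := by
        -- The rescaling gain is discarded for the two terms already of order `η³`; for `∂ₜ K₂` it
        -- is essential, as `√(η²) = η` turns `η²` into `η³`.
        refine add_le_add (add_le_add ?_ (le_of_eq ?_)) ?_
        · gcongr
          exact ENNReal.ofReal_le_one.2 (Real.sqrt_le_one.2 hη1)
        · rw [Real.sqrt_sq hη.le, ← mul_assoc, ← ENNReal.ofReal_mul hη2.le, ← pow_succ]
        · gcongr
          exact ENNReal.ofReal_le_one.2 (Real.sqrt_le_one.2 (pow_le_one₀ hη.le hη1))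
    _ = _ := by
        rw [ENNReal.ofReal_mul (by positivity), ENNReal.ofReal_toReal hne, one_mul, one_mul,
          mul_add, mul_add]

/-- The residual on the viscous scale, squared, is of order `ε³`. -/
theorem exists_lintegral_viscousResidual_le (hV : IsViscousLayer V) (hT : 0 < T) :
    ∃ k ≥ 0, ∀ η, 0 < η → η ≤ 1 →
      ∫⁻ p in Ioo 0 T ×ˢ Ioi 0,
        ENNReal.ofReal (η ^ 6 / 4 * ‖viscousResidual V p.1 (p.2 / η)‖ ^ 2) ≤
          ENNReal.ofReal (η ^ 6 * k) := by
  have hL2 : ∫⁻ t in Ioo 0 T, eLpNorm (viscousResidual V t) 2 (volume.restrict (Ioi 0)) ^ 2 ≠ ⊤ := by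
    rw [← lintegral_enorm_sq_prod ((continuousOn_viscousResidual hV).mono (subset_quadrant T)),
      ← eLpNorm_two_sq (fun p : ℝ × ℝ => viscousResidual V p.1 p.2)]
    exact (ENNReal.pow_lt_top (memLp_viscousResidual hV hT).2).ne
  refine ⟨_, ENNReal.toReal_nonneg (a := ∫⁻ t in Ioo 0 T,
    eLpNorm (viscousResidual V t) 2 (volume.restrict (Ioi 0)) ^ 2), fun η hη hη1 => ?_⟩
  have h1 : ∀ v : State m, ENNReal.ofReal (η ^ 6 / 4 * ‖v‖ ^ 2) =
      ENNReal.ofReal (η ^ 6 / 4) * ‖v‖ₑ ^ 2 := fun v => by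
    rw [ENNReal.ofReal_mul (by positivity), ENNReal.ofReal_pow (norm_nonneg v), ofReal_norm]
  simp only [h1]
  rw [lintegral_const_mul' _ _ ENNReal.ofReal_ne_top, lintegral_enorm_sq_prod
    (f := fun t x => viscousResidual V t (x / η))
    (continuousOn_comp_space_div (continuousOn_viscousResidual hV) hη),
    ENNReal.ofReal_mul (by positivity), ENNReal.ofReal_toReal hL2]
  refine mul_le_mul' (ENNReal.ofReal_le_ofReal (by linarith [pow_pos hη 6])) ?_
  refine lintegral_mono fun t => ?_
  -- Here the gain `√η` from rescaling is not needed and is bounded by one.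
  rw [eLpNorm_comp_div _ hη]
  gcongr
  calc ENNReal.ofReal √η * eLpNorm (viscousResidual V t) 2 (volume.restrict (Ioi 0))
      ≤ 1 * eLpNorm (viscousResidual V t) 2 (volume.restrict (Ioi 0)) := by
        gcongr
        exact ENNReal.ofReal_le_one.2 (Real.sqrt_le_one.2 hη1)
    _ = _ := one_mul _

theorem integrableOn_residual (hV : IsViscousLayer V) (hK : IsKnudsenLayer K) (hT : 0 < T)
    (hη : 0 < η) (L : ℝ) :
    IntegrableOn (fun p : ℝ × ℝ =>
      η ^ 2 • viscousResidual V p.1 (p.2 / η) + timeResidual V K η p.1 p.2)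
      (Ioo 0 T ×ˢ Ioo 0 L) := by
  have hη2 : 0 < η ^ 2 := by positivity
  have key : ∀ {f : ℝ → ℝ → State m} {δ : ℝ},
      ContinuousOn (fun p : ℝ × ℝ => f p.1 p.2) (Ioi 0 ×ˢ Ioi 0) → 0 < δ →
      ∫⁻ t in Ioo 0 T, eLpNorm (f t) 2 (volume.restrict (Ioi 0)) < ⊤ →
      IntegrableOn (fun p : ℝ × ℝ => f p.1 (p.2 / δ)) (Ioo 0 T ×ˢ Ioo 0 L) :=
    fun {f} {δ} hf hδ h => integrableOn_prod_of_lintegral_eLpNorm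
      (f := fun t x => f t (x / δ)) (continuousOn_comp_space_div hf hδ)
      (by rw [lintegral_eLpNorm_comp_div _ hδ]; exact ENNReal.mul_lt_top ENNReal.ofReal_lt_top h) L
  have i0 := key (continuousOn_viscousResidual hV) hη (lintegral_eLpNorm_lt_top_of_memLp
    ((continuousOn_viscousResidual hV).mono (subset_quadrant T)) (memLp_viscousResidual hV hT))
  have i1 := key (hV.layer 3).continuousOn_dTime hη (lintegral_eLpNorm_lt_top_of_memLp
    ((hV.layer 3).continuousOn_dTime.mono (subset_quadrant T)) (hV.memLp_dTime 3 T hT))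
  have i2 := key (hK.layer 2).continuousOn_dTime hη2 (hK.integrable_dTime 2 T hT)
  have i3 := key (hK.layer 3).continuousOn_dTime hη2 (hK.integrable_dTime 3 T hT)
  exact (i0.smul (η ^ 2)).add (((i1.smul (η ^ 3)).add (i2.smul (η ^ 2))).add (i3.smul (η ^ 3)))

end Source

/-! ### The error estimate -/

section ErrorEstimate

variable {m : ℕ}

theorem inner_toEuclideanCLM_comm {n : Type*} [Fintype n] [DecidableEq n] {A : Matrix n n ℝ}
    (hA : Aᵀ = A) (x y : EuclideanSpace ℝ n) :
    inner ℝ (Matrix.toEuclideanCLM (𝕜 := ℝ) A x) y =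
      inner ℝ x (Matrix.toEuclideanCLM (𝕜 := ℝ) A y) := by
  rw [real_inner_comm, Matrix.inner_toEuclideanCLM, Matrix.inner_toEuclideanCLM,
    Matrix.dotProduct_mulVec, ← Matrix.mulVec_transpose, hA, dotProduct_comm]

theorem inner_collision (x : State m) :
    inner ℝ (Matrix.toEuclideanCLM (𝕜 := ℝ) (Qc m) x) x =
      ‖Matrix.toEuclideanCLM (𝕜 := ℝ) (Qc m) x‖ ^ 2 := by
  rw [real_inner_comm, Matrix.inner_toEuclideanCLM, dotProduct_Qc_mulVec,
    EuclideanSpace.real_norm_sq_eq, dotProduct]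
  exact Finset.sum_congr rfl fun i _ => (pow_two _).symm

/-- This is the purpose of the velocity equation at order `ε`: without a velocity component the
residual lies in the range of `Q_c` and can be absorbed by collisions. -/
theorem collision_viscousResidual {V : Fin 4 → ℝ → ℝ → State m} (hV : IsViscousLayer V) {t y : ℝ}
    (ht : 0 < t) (hy : 0 < y) :
    Matrix.toEuclideanCLM (𝕜 := ℝ) (Qc m) (viscousResidual V t y) = viscousResidual V t y :=
  congrArg (WithLp.toLp 2) (Qc_mulVec_of_inl_zero (hV.order_one_first t ht y hy))

/-- The dissipation of the collision term absorbs the residual on the viscous scale. -/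
theorem inner_residual_le {r v e : State m} {η b : ℝ} (hη : 0 < η)
    (hr : Matrix.toEuclideanCLM (𝕜 := ℝ) (Qc m) r = r) (hv : ‖v‖ ≤ b) :
    inner ℝ (η ^ 2 • r + v - (1 / η ^ 2) • Matrix.toEuclideanCLM (𝕜 := ℝ) (Qc m) e) e ≤
      η ^ 6 / 4 * ‖r‖ ^ 2 + b * ‖e‖ := by
  set Q := Matrix.toEuclideanCLM (𝕜 := ℝ) (Qc m) with hQ
  have h1 : inner ℝ r e ≤ ‖r‖ * ‖Q e‖ := by
    have : inner ℝ r e = inner ℝ r (Q e) := by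
      rw [← inner_toEuclideanCLM_comm (Qc_transpose m), ← hQ, hr]
    rw [this]
    exact real_inner_le_norm _ _
  have h2 : inner ℝ v e ≤ b * ‖e‖ := (real_inner_le_norm v e).trans (by gcongr)
  rw [inner_sub_left, inner_add_left, real_inner_smul_left, real_inner_smul_left, inner_collision,
    ← hQ]
  -- Completing the square uses up the whole collision dissipation.
  have h3 : η ^ 2 * (‖r‖ * ‖Q e‖) - 1 / η ^ 2 * ‖Q e‖ ^ 2 ≤ η ^ 6 / 4 * ‖r‖ ^ 2 := by
    have h4 : η ^ 6 / 4 * ‖r‖ ^ 2 - (η ^ 2 * (‖r‖ * ‖Q e‖) - 1 / η ^ 2 * ‖Q e‖ ^ 2) =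
        (η ^ 3 / 2 * ‖r‖ - ‖Q e‖ / η) ^ 2 := by field_simp; ring
    linarith [sq_nonneg (η ^ 3 / 2 * ‖r‖ - ‖Q e‖ / η)]
  have h5 : η ^ 2 * inner ℝ r e ≤ η ^ 2 * (‖r‖ * ‖Q e‖) := by gcongr
  linarith

variable {χ : ℝ} {S : Matrix (Fin (m + 1)) (Fin (m + 1)) ℝ} {uw : ℝ → ℝ}
  {V K : Fin 4 → ℝ → ℝ → State m} {T η : ℝ} {W : ℝ → ℝ → State m}

theorem continuousOn_error (hVK : IsLayerExpansion χ S uw V K) (hη : 0 < η)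
    (hW : IsExactSolution χ S uw T (η ^ 2) W) :
    ContinuousOn (fun p : ℝ × ℝ => Wapp V K (η ^ 2) p.1 p.2 - W p.1 p.2) (Icc 0 T ×ˢ Ici 0) :=
  ((isLayerFunction_Wapp hVK.viscous.layer hVK.knudsen.layer hη).continuousOn.mono
    (prod_mono_left Icc_subset_Ici_self)).sub hW.continuousOn

theorem contDiffOn_error (hVK : IsLayerExpansion χ S uw V K) (hη : 0 < η)
    (hW : IsExactSolution χ S uw T (η ^ 2) W) :
    ContDiffOn ℝ 1 (fun p : ℝ × ℝ => Wapp V K (η ^ 2) p.1 p.2 - W p.1 p.2)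
      (Ioo 0 T ×ˢ Ioi 0) :=
  ((isLayerFunction_Wapp hVK.viscous.layer hVK.knudsen.layer hη).contDiffOn.mono
    (prod_mono_left Ioo_subset_Ioi_self)).sub hW.contDiffOn

theorem error_equation (hVK : IsLayerExpansion χ S uw V K) (hη : 0 < η)
    (hW : IsExactSolution χ S uw T (η ^ 2) W) {t x : ℝ} (ht : t ∈ Ioo 0 T) (hx : 0 < x) :
    deriv (fun s => Wapp V K (η ^ 2) s x - W s x) t +
        Matrix.toEuclideanCLM (𝕜 := ℝ) (Ac m) (deriv (fun y => Wapp V K (η ^ 2) t y - W t y) x) =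
      η ^ 2 • viscousResidual V t (x / η) + timeResidual V K η t x -
        (1 / η ^ 2) • Matrix.toEuclideanCLM (𝕜 := ℝ) (Qc m) (Wapp V K (η ^ 2) t x - W t x) := by
  have hL := isLayerFunction_Wapp hVK.viscous.layer hVK.knudsen.layer hη
  have hs : IsOpen (Ioo 0 T ×ˢ Ioi 0 : Set (ℝ × ℝ)) := isOpen_Ioo.prod isOpen_Ioi
  have h1 : deriv (fun s => Wapp V K (η ^ 2) s x - W s x) t =
      dTime (Wapp V K (η ^ 2)) t x - dTime W t x :=
    deriv_fun_sub (hL.hasDerivAt_time ht.1 hx).differentiableAt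
      (hasDerivAt_fst_of_contDiffOn hs hW.contDiffOn ⟨ht, hx⟩).differentiableAt
  have h2 : deriv (fun y => Wapp V K (η ^ 2) t y - W t y) x =
      dSpace (Wapp V K (η ^ 2)) t x - dSpace W t x :=
    deriv_fun_sub (hL.hasDerivAt_space ht.1 hx).differentiableAt
      (hasDerivAt_snd_of_contDiffOn hs hW.contDiffOn ⟨ht, hx⟩).differentiableAt
  have h3 := Wapp_residual hVK.viscous hVK.knudsen hη ht.1 hx
  have h4 : dTime W t x + Matrix.toEuclideanCLM (𝕜 := ℝ) (Ac m) (dSpace W t x) =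
      -(1 / η ^ 2) • Matrix.toEuclideanCLM (𝕜 := ℝ) (Qc m) (W t x) :=
    congrArg (WithLp.toLp 2) (hW.equation t ht x hx)
  rw [h1, h2, ← h3, map_sub, map_sub]
  linear_combination (norm := module) -h4

/-- The three matched orders reproduce the exact boundary data, so only the unmatched fourth
coefficients remain. -/
theorem boundaryOp_error (hVK : IsLayerExpansion χ S uw V K) (hη : 0 < η)
    (hW : IsExactSolution χ S uw T (η ^ 2) W) {t : ℝ} (ht : t ∈ Icc 0 T) :
    boundaryOp χ S (Wapp V K (η ^ 2) t 0 - W t 0) =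
      η ^ 3 • boundaryOp χ S (V 3 t 0 + K 3 t 0) := by
  have e : Wapp V K (η ^ 2) t 0 = (V 0 t 0 + K 0 t 0) + η • (V 1 t 0 + K 1 t 0) +
      η ^ 2 • (V 2 t 0 + K 2 t 0) + η ^ 3 • (V 3 t 0 + K 3 t 0) := by
    rw [Wapp_sq hη, zero_div, zero_div]
    module
  have b0 := hVK.boundary_zero t ht.1
  have b1 := hVK.boundary_half t ht.1
  have b2 := hVK.boundary_one t ht.1
  have bW := hW.boundary t ht
  rw [e]
  generalize V 0 t 0 + K 0 t 0 = u₀ at *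
  generalize V 1 t 0 + K 1 t 0 = u₁ at *
  generalize V 2 t 0 + K 2 t 0 = u₂ at *
  apply WithLp.ofLp_injective 2
  simp only [boundaryOp, WithLp.ofLp_smul, WithLp.ofLp_sub, WithLp.ofLp_add, Matrix.mulVec_sub,
    Matrix.mulVec_add, Matrix.mulVec_smul, b0, b1, b2, bW, smul_zero, add_zero,
    add_sub_cancel_left]

/-- The error is bounded on compact boxes and the residual is integrable there. -/
theorem integrableOn_inner_error (hVK : IsLayerExpansion χ S uw V K) (hT : 0 < T) (hη : 0 < η)
    (hW : IsExactSolution χ S uw T (η ^ 2) W) (L : ℝ) :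
    IntegrableOn (fun p : ℝ × ℝ => inner ℝ
      (η ^ 2 • viscousResidual V p.1 (p.2 / η) + timeResidual V K η p.1 p.2 -
        (1 / η ^ 2) • Matrix.toEuclideanCLM (𝕜 := ℝ) (Qc m)
          (Wapp V K (η ^ 2) p.1 p.2 - W p.1 p.2))
      (Wapp V K (η ^ 2) p.1 p.2 - W p.1 p.2)) (Ioo 0 T ×ˢ Ioo 0 L) := by
  have hE := continuousOn_error hVK hη hW
  have hK : IsCompact (Icc 0 T ×ˢ Icc 0 L) := isCompact_Icc.prod isCompact_Icc
  have hEK := hE.mono (prod_mono_right (t₁ := Icc 0 L) Icc_subset_Ici_self)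
  have hs : (Ioo 0 T ×ˢ Ioo 0 L : Set (ℝ × ℝ)) ⊆ Icc 0 T ×ˢ Icc 0 L :=
    prod_mono Ioo_subset_Icc_self Ioo_subset_Icc_self
  have hms : MeasurableSet (Ioo 0 T ×ˢ Ioo 0 L : Set (ℝ × ℝ)) :=
    measurableSet_Ioo.prod measurableSet_Ioo
  obtain ⟨B, hB⟩ := hK.exists_bound_of_continuousOn hEK
  have hQE := ((((Matrix.toEuclideanCLM (𝕜 := ℝ) (Qc m)).continuous.comp_continuousOn
    hEK).const_smul (1 / η ^ 2)).integrableOn_compact (μ := volume) hK).mono_set hs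
  have hr := (integrableOn_residual hVK.viscous hVK.knudsen hT hη L).sub hQE
  refine (hr.norm.mul_const B).mono' (hr.1.inner ((hEK.mono hs).aestronglyMeasurable hms)) ?_
  filter_upwards [ae_restrict_mem hms] with p hp
  refine (norm_inner_le_norm _ _).trans ?_
  exact mul_le_mul_of_nonneg_left (hB p (hs hp)) (norm_nonneg _)

/-- The error estimate, with `ε = η ^ 2`. -/
theorem exists_error_bound (h0 : 0 < χ) (h1 : χ ≤ 1) (hS : S.PosDef)
    (hVK : IsLayerExpansion χ S uw V K) (hT : 0 < T) :
    ∃ C, ∀ η, 0 < η → η ≤ 1 → ∀ W, IsExactSolution χ S uw T (η ^ 2) W → ∀ t ∈ Icc 0 T,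
      eLpNorm (fun x => Wapp V K (η ^ 2) t x - W t x) 2 (volume.restrict (Ioi 0)) +
        eLpNorm (fun s => Wapp V K (η ^ 2) s 0 - W s 0) 2 (volume.restrict (Ioc 0 T)) ≤
      ENNReal.ofReal (C * η ^ 3) := by
  obtain ⟨c, hc, C, hC, hdiss⟩ := exists_boundary_dissipation h0 h1 hS
  obtain ⟨k, hk, htime⟩ := exists_lintegral_timeSource_le hVK.viscous hVK.knudsen hT
  obtain ⟨r, hr, hvisc⟩ := exists_lintegral_viscousResidual_le hVK.viscous hT
  have hbc : ContinuousOn (fun t => boundaryOp χ S (V 3 t 0 + K 3 t 0)) (Icc 0 T) := by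
    have h : ∀ {U : ℝ → ℝ → State m}, IsLayerFunction U → ContinuousOn (fun t => U t 0) (Icc 0 T) :=
      fun hU => hU.continuousOn.comp (f := fun t : ℝ => (t, (0 : ℝ))) (by fun_prop)
        fun t ht => ⟨ht.1, self_mem_Ici⟩
    exact (continuous_boundaryOp χ S).comp_continuousOn
      ((h (hVK.viscous.layer 3)).add (h (hVK.knudsen.layer 3)))
  obtain ⟨B, hB⟩ := isCompact_Icc.exists_bound_of_continuousOn hbc
  -- Boundary defect, viscous residual and time residual enter the squared estimate with the common
  -- factor `(η³)²`; `n` collects their constants, independent of `η`.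
  set n := C * B ^ 2 * T + r + k ^ 2 with hn
  have hn0 : 0 ≤ n := by positivity
  refine ⟨√(4 * n) + √(2 * n / c), fun η hη hη1 W hW t ht => ?_⟩
  have hη3 : 0 ≤ η ^ 3 := by positivity
  obtain ⟨e1, e2⟩ := energy_estimate (A := Matrix.toEuclideanCLM (𝕜 := ℝ) (Ac m))
    (E := fun t x => Wapp V K (η ^ 2) t x - W t x)
    (r := fun t x => η ^ 2 • viscousResidual V t (x / η) + timeResidual V K η t x -
        (1 / η ^ 2) • Matrix.toEuclideanCLM (𝕜 := ℝ) (Qc m) (Wapp V K (η ^ 2) t x - W t x))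
    (a := fun t x => η ^ 6 / 4 * ‖viscousResidual V t (x / η)‖ ^ 2) (b := timeSource V K η)
    (α := η ^ 6 * r) (κ := η ^ 3 * k) (c₁ := c) (β := η ^ 6 * (C * B ^ 2))
    (inner_toEuclideanCLM_comm (Ac_transpose m)) hT.le (continuousOn_error hVK hη hW)
    (contDiffOn_error hVK hη hW)
    (fun x hx => by
      rw [(isLayerFunction_Wapp hVK.viscous.layer hVK.knudsen.layer hη).initial x hx,
        hW.initial x hx, sub_zero])
    (fun t ht x hx => error_equation hVK hη hW ht hx) (integrableOn_inner_error hVK hT hη hW)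
    (continuousOn_const.mul ((continuousOn_comp_space_div
      (continuousOn_viscousResidual hVK.viscous) hη).norm.pow 2))
    (continuousOn_timeSource hVK.viscous hVK.knudsen hη) (fun t x => by positivity)
    (timeSource_nonneg hη)
    (fun t ht x hx => inner_residual_le hη
      (collision_viscousResidual hVK.viscous ht.1 (div_pos hx hη)) (norm_timeResidual_le hη t x))
    (by positivity) (by positivity) (hvisc η hη hη1) (htime η hη hη1) hc (by positivity)
    (fun s hs => by
      refine (hdiss _).trans ?_
      rw [boundaryOp_error hVK hη hW hs, norm_smul, Real.norm_of_nonneg hη3]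
      have h2 : C * (η ^ 3 * ‖boundaryOp χ S (V 3 s 0 + K 3 s 0)‖) ^ 2 ≤ C * (η ^ 3 * B) ^ 2 := by
        gcongr
        exact hB s hs
      linarith [mul_pow (η ^ 3) B 2])
  have e3 : η ^ 6 * (C * B ^ 2) * T + η ^ 6 * r + (η ^ 3 * k) ^ 2 = (η ^ 3) ^ 2 * n := by
    rw [hn]; ring
  have h4 : √(4 * ((η ^ 3) ^ 2 * n)) = √(4 * n) * η ^ 3 := by
    rw [mul_left_comm, Real.sqrt_mul (sq_nonneg _), Real.sqrt_sq hη3, mul_comm]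
  have h5 : √(2 * ((η ^ 3) ^ 2 * n) / c) = √(2 * n / c) * η ^ 3 := by
    rw [mul_left_comm, mul_div_assoc, Real.sqrt_mul (sq_nonneg _), Real.sqrt_sq hη3, mul_comm]
  rw [e3, h4] at e1
  rw [e3, h5] at e2
  rw [add_mul, ENNReal.ofReal_add (by positivity) (by positivity)]
  exact add_le_add (e1 t ht) e2

end ErrorEstimate

end CouetteMoment


theorem mainTheorem1 (m : ℕ) (χ : ℝ) (hχ0 : 0 < χ) (hχ1 : χ ≤ 1)
    (S : Matrix (Fin (m + 1)) (Fin (m + 1)) ℝ) (hS : S.PosDef)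
    (uw : ℝ → ℝ) (huw : ContDiffOn ℝ 3 uw (Ici 0))
    (huw0 : uw 0 = 0) (huw1 : derivWithin uw (Ici 0) 0 = 0) :
    (∃ V K : Fin 4 → ℝ → ℝ → CouetteMoment.State m,
        CouetteMoment.IsLayerExpansion χ S uw V K) ∧
    ∀ V K : Fin 4 → ℝ → ℝ → CouetteMoment.State m,
      CouetteMoment.IsLayerExpansion χ S uw V K →
      ∀ T : ℝ, 0 < T → ∃ C : ℝ, ∀ ε : ℝ, 0 < ε → ε ≤ 1 →
        ∀ W : ℝ → ℝ → CouetteMoment.State m,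
          CouetteMoment.IsExactSolution χ S uw T ε W →
          ∀ t ∈ Icc 0 T,
            eLpNorm (fun x => CouetteMoment.Wapp V K ε t x - W t x) 2
                (volume.restrict (Ioi 0)) +
              eLpNorm (fun s => CouetteMoment.Wapp V K ε s 0 - W s 0) 2
                (volume.restrict (Ioc 0 T)) ≤
            ENNReal.ofReal (C * ε ^ (3 / 2 : ℝ)) := by
  refine ⟨CouetteMoment.exists_layerExpansion hχ0 hχ1 hS huw huw0 huw1, fun V K hVK T hT => ?_⟩
  obtain ⟨C, hC⟩ := CouetteMoment.exists_error_bound hχ0 hχ1 hS hVK hT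
  refine ⟨C, fun ε hε hε1 W hW t ht => ?_⟩
  obtain ⟨η, hη, rfl⟩ : ∃ η, 0 < η ∧ ε = η ^ 2 :=
    ⟨√ε, Real.sqrt_pos.2 hε, (Real.sq_sqrt hε.le).symm⟩
  have h : (η ^ 2) ^ (3 / 2 : ℝ) = η ^ 3 := by
    rw [← Real.rpow_natCast, ← Real.rpow_mul hη.le, ← Real.rpow_natCast]
    norm_num
  rw [h]
  exact hC η hη ((sq_le_one_iff₀ hη.le).1 hε1) W hW t ht
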